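/- **Setting.** Let $X$ be a non-empty set. A partial hypothesis is a function $h:X\to[-1,1]\cup\{*\}$, where $*$ means "undefined". For $u\in\mathbb R$ put $u\diamond v:=uv$ if $v\in[-1,1]$ and $u\diamond *:=-|u|$. All probability distributions are discrete (countably supported), and $\log$ is the base-2 logarithm. A learner taking $n$ data points is a randomized map from $(X\times[-1,1])^n$ to (descriptions of) models $f:X\to\{-1,1\}$. Let $S,B\subseteq([-1,1]\cup\{*\})^X$ and let $\sup\emptyset=-\infty$. * $\mathsf{DCorM}_n(S,B,\varepsilon,\delta)$ is the set of learners taking $n$ data points such that, for every distribution $\mu$ on $X\times[-1,1]$ with $\Pr_{(x,y)\sim\mu}[s(x)=y]=1$ for some $s\in S$, on $n$ i.i.d. data points from $\mu$ the output model $f$ satisfies $\mathbb E_\mu[yf(x)]\ge\sup_{b\in B}\mathbb E_\mu[y\diamond b(x)]-\varepsilon$ with probability at least $1-\delta$ (over the data and the internal randomness). * $\textsf{W-DCorM}_n(S,B,\alpha,\gamma,\delta)$ is the set of learners taking $n$ data points such that, for every $\mu$ as above which moreover satisfies $\sup_{b\in B}\mathbb E_\mu[y\diamond b(x)]\ge\alpha$,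 on $n$ i.i.d. data points from $\mu$ the output model $f$ satisfies $\mathbb E_\mu[yf(x)]\ge\gamma$ with probability at least $1-\delta$. The evaluation time of a description of a model $f$ is the worst-case time, over $x\in X$, needed to compute $f(x)$ from the description and $x$. Running times are measured on a random access machine with registers for natural numbers, for real numbers and for descriptions of models. It performs in unit time: arithmetic (including integer division with remainder, and rounding a non-negative real down to an integer), comparison, indirect addressing, and the flip of a coin of given bias. The points of $X$ and the descriptions returned by the oracle are opaque: the machine may only pass data points to the oracle, or evaluate a description at a point at the cost of the corresponding evaluation time. The description of the model output by an oracle program is the final content of its memory, from which a second, deterministic program without oracle access computes $f(x)$ given $x$. **Theorem.** There are an absolute constant $C>0$, an oracle program and an evaluation program such that the following holds. Let $\alpha,\gamma,\varepsilon,\delta_1,\delta_2,\delta_3\in(0,1/2)$ and $n_0\in\mathbb Z_{\ge0}$. Then there are $W,W',n\in\mathbb Z_{\ge0}$ with $$W'\le C\gamma^{-2}\alpha^{-1}\log(1/\alpha),\qquad W'\le W\le W'+C\varepsilon^{-2},$$ $$n\le C\Bigl(W'\bigl(n_0/\alpha+\alpha^{-2}\gamma^{-2}\log(1/\delta_2)\bigr)+W\varepsilon^{-2}\log(1/\delta_3)\Bigr),$$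 and further integers $n_1,n_2,n_3\ge 0$ (batch sizes), all of them depending only on $\alpha,\gamma,\varepsilon,\delta_1,\delta_2,\delta_3,n_0$, such that for all $X$, all $S,B\subseteq([-1,1]\cup\{*\})^X$, every integer $T_{\mathsf{eval}}\ge1$, and every learner $L\in\textsf{W-DCorM}_{n_0}(S,B,\alpha,\gamma,\delta_1)$ that always represents its output model by a description with evaluation time at most $T_{\mathsf{eval}}$, the oracle program with parameters $\alpha,\gamma,\varepsilon,n_0,n,W,W',n_1,n_2,n_3$ and oracle $L$ is a learner $L'$ such that: 1. $L'\in\mathsf{DCorM}_n\bigl(S,B,\alpha+\varepsilon,\,W'(\delta_1+\delta_2)+W\delta_3\bigr)$; 2. on every input, $L'$ invokes $L$ at most $W'$ times and its running time, not counting the running time of $L$ itself, is at most $C\,W'T_{\mathsf{eval}}\,n$; 3. $L'$ always represents its output model by a description with evaluation time at most $C\,W'T_{\mathsf{eval}}$. -/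

import Mathlib

namespace CompLearn

noncomputable section

/-! ### Hypotheses, distributions, learning tasks -/

/-- Labels: real numbers in `[-1, 1]`. -/
abbrev Label : Type := Set.Icc (-1 : ℝ) 1

/-- The two-point set `{-1, 1}` of values of a binary model. -/
abbrev Sign : Type := ({-1, 1} : Set ℝ)

/-- Partial real-valued hypotheses `X → [-1, 1] ∪ {*}`; `none` is the undefined label `*`. -/
abbrev Hyp (X : Type*) : Type _ := X → Option Label

/-- Generalized product of a real number and an element of `[-1, 1] ∪ {*}`. -/
def gprod (u : ℝ) : Option Label → ℝ
  | some v => u * (v : ℝ)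
  | none => -|u|

/-- Expectation of a real function under a discrete distribution
(an absolutely convergent series for bounded `g`). -/
def expect {Z : Type*} (μ : PMF Z) (g : Z → ℝ) : ℝ := ∑' z, (μ z).toReal * g z

/-- The law of `n` independent draws from `μ`. -/
def iid {Z : Type*} (μ : PMF Z) : (n : ℕ) → PMF (Fin n → Z)
  | 0 => PMF.pure Fin.elim0
  | n + 1 => μ.bind fun z => (iid μ n).map fun zs => Fin.cons z zs

/-- A (possibly randomized) learner taking `n` data points in `Z` to a model in `F`. -/
abbrev Learner (Z : Type*) (n : ℕ) (F : Type*) : Type _ := (Fin n → Z) → PMF F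

/-- The abstract learning task: `P` is the distribution class, `adm μ` the admissible set of `μ`.
A learner solves it if for every `μ ∈ P`, on `n` i.i.d. data points from `μ`, its output is in
`adm μ` with probability at least `1 - δ`. -/
def Learn {Z F : Type*} (n : ℕ) (P : Set (PMF Z)) (adm : PMF Z → Set F) (δ : ℝ) :
    Set (Learner Z n F) :=
  {L | ∀ μ ∈ P, 1 - δ ≤ (((iid μ n).bind L).toOuterMeasure (adm μ)).toReal}

/-- The labels are given deterministically by some source hypothesis `s ∈ S`:
`Pr_{(x,y) ∼ μ}[s(x) = y] = 1`. -/
def DeterministicLabels {X : Type*} (S : Set (Hyp X)) (μ : PMF (X × Label)) : Prop :=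
  ∃ s ∈ S, μ.toOuterMeasure {z | s z.1 = some z.2} = 1

/-- `sup_{b ∈ B} E_{(x,y) ∼ μ}[y ◇ b(x)]`, in the extended reals. -/
def benchmark {X : Type*} (B : Set (Hyp X)) (μ : PMF (X × Label)) : EReal :=
  ⨆ b ∈ B, ((expect μ (fun z => gprod (z.2 : ℝ) (b z.1)) : ℝ) : EReal)

/-- `E_{(x,y) ∼ μ}[y f(x)]`. -/
def correlation {X : Type*} (μ : PMF (X × Label)) (f : X → Sign) : ℝ :=
  expect μ (fun z => (z.2 : ℝ) * (f z.1 : ℝ))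

/-- (Strong) deterministic-label correlation maximization. -/
def DCorM {X : Type*} (n : ℕ) (S B : Set (Hyp X)) (ε δ : ℝ) :
    Set (Learner (X × Label) n (X → Sign)) :=
  Learn n {μ | DeterministicLabels S μ}
    (fun μ => {f | benchmark B μ - (ε : EReal) ≤ (correlation μ f : EReal)}) δ

/-- Weak deterministic-label correlation maximization. -/
def WDCorM {X : Type*} (n : ℕ) (S B : Set (Hyp X)) (α γ δ : ℝ) :
    Set (Learner (X × Label) n (X → Sign)) :=
  Learn n {μ | DeterministicLabels S μ ∧ (α : EReal) ≤ benchmark B μ}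
    (fun μ => {f | γ ≤ correlation μ f}) δ

/-! ### Descriptions of models -/

/-- A format in which models `X → {-1, 1}` are described: each description `d` determines a model
`eval d`, and `time d x` is the time needed to compute `eval d x` from `d` and `x`. -/
structure Rep (X D : Type*) where
  eval : D → X → Sign
  time : D → X → ℕ

/-- The learner, seen as outputting the models which its output descriptions represent. -/
def Rep.models {X D Z : Type*} (R : Rep X D) {n : ℕ} (L : Learner Z n D) :
    Learner Z n (X → Sign) :=
  fun z => (L z).map R.eval

/-- The learner always outputs a description with (worst-case) evaluation time at most `T`. -/
def Rep.EvalTimeLE {X D Z : Type*} (R : Rep X D) {n : ℕ} (L : Learner Z n D) (T : ℝ) : Prop :=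
  ∀ z, ∀ d ∈ (L z).support, ∀ x, (R.time d x : ℝ) ≤ T

/-! ### A random access machine with integer and real registers

Programs are built from the instructions below by sequencing, branching and counted loops. The
memory consists of registers holding natural numbers, registers holding real numbers, and slots
holding descriptions of models. Individuals of `X` can be accessed only by referring to a data point
of the input by its index, and descriptions can be used only by evaluating them. Every instruction,
every node of an expression, every branching and every iteration of a loop takes one time step. -/

/-- Memory; `D` is the type of descriptions. -/
structure Mem (D : Type*) where
  nat : ℕ → ℕ
  real : ℕ → ℝ
  slot : ℕ → Option D

/-- Memory, together with the number of time steps made and the number of oracle calls made. -/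
structure Config (D : Type*) where
  mem : Mem D
  time : ℕ
  calls : ℕ

/-- Integer expressions; `mem a` is the content of the integer register with address `a`;
subtraction is truncated and division rounds down. -/
inductive NExp : Type
  | lit (k : ℕ)
  | mem (a : NExp)
  | add (a b : NExp)
  | sub (a b : NExp)
  | mul (a b : NExp)
  | div (a b : NExp)
  | mod (a b : NExp)

/-- Real expressions; `mem a` is the content of the real register with address `a`, and `label i`
is the label of the data point with index `i`. -/
inductive RExp : Type
  | ofNat (a : NExp)
  | mem (a : NExp)
  | label (i : NExp)
  | add (a b : RExp)
  | sub (a b : RExp)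
  | mul (a b : RExp)
  | div (a b : RExp)

/-- Tests. -/
inductive BExp : Type
  | natLE (a b : NExp)
  | realLE (a b : RExp)
  | not (a : BExp)
  | and (a b : BExp)

def NExp.size : NExp → ℕ
  | lit _ => 1
  | mem a => a.size + 1
  | add a b => a.size + b.size + 1
  | sub a b => a.size + b.size + 1
  | mul a b => a.size + b.size + 1
  | div a b => a.size + b.size + 1
  | mod a b => a.size + b.size + 1

def RExp.size : RExp → ℕ
  | ofNat a => a.size + 1
  | mem a => a.size + 1
  | label i => i.size + 1
  | add a b => a.size + b.size + 1
  | sub a b => a.size + b.size + 1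
  | mul a b => a.size + b.size + 1
  | div a b => a.size + b.size + 1

def BExp.size : BExp → ℕ
  | natLE a b => a.size + b.size + 1
  | realLE a b => a.size + b.size + 1
  | not a => a.size + 1
  | and a b => a.size + b.size + 1

def NExp.val {D : Type*} (m : Mem D) : NExp → ℕ
  | lit k => k
  | mem a => m.nat (a.val m)
  | add a b => a.val m + b.val m
  | sub a b => a.val m - b.val m
  | mul a b => a.val m * b.val m
  | div a b => a.val m / b.val m
  | mod a b => a.val m % b.val m

/-- The label of the data point with index `i` (`0` if there is none). -/
def labelAt {X : Type*} {N : ℕ} (data : Fin N → X × Label) (i : ℕ) : ℝ :=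
  if h : i < N then ((data ⟨i, h⟩).2 : ℝ) else 0

def RExp.val {X D : Type*} {N : ℕ} (data : Fin N → X × Label) (m : Mem D) : RExp → ℝ
  | ofNat a => (a.val m : ℝ)
  | mem a => m.real (a.val m)
  | label i => labelAt data (i.val m)
  | add a b => a.val data m + b.val data m
  | sub a b => a.val data m - b.val data m
  | mul a b => a.val data m * b.val data m
  | div a b => a.val data m / b.val data m

def BExp.Holds {X D : Type*} {N : ℕ} (data : Fin N → X × Label) (m : Mem D) : BExp → Prop
  | natLE a b => a.val m ≤ b.val m
  | realLE a b => a.val data m ≤ b.val data m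
  | not a => ¬ a.Holds data m
  | and a b => a.Holds data m ∧ b.Holds data m

/-- Let `k` time steps pass. -/
def Config.tick {D : Type*} (k : ℕ) (c : Config D) : Config D := { c with time := c.time + k }

def Config.setNat {D : Type*} (a k : ℕ) (c : Config D) : Config D :=
  { c with mem := { c.mem with nat := Function.update c.mem.nat a k } }

def Config.setReal {D : Type*} (a : ℕ) (r : ℝ) (c : Config D) : Config D :=
  { c with mem := { c.mem with real := Function.update c.mem.real a r } }

/-- Evaluate the description in slot `j` at the data point with index `i`, and store the result in
the real register `a`; the time needed for the evaluation is counted. (Nothing happens if the slot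
is empty or there is no such data point.) -/
def Config.query {X D : Type*} (R : Rep X D) {N : ℕ} (data : Fin N → X × Label) (a j i : ℕ)
    (c : Config D) : Config D :=
  match c.mem.slot j with
  | some d =>
    if h : i < N then
      (c.setReal a (R.eval d (data ⟨i, h⟩).1 : ℝ)).tick (R.time d (data ⟨i, h⟩).1)
    else c
  | none => c

/-- Deterministic programs. `floor a e` rounds a real number down to a natural number
(to `0` if it is negative); `loop e c` executes `c` as many times as the value of `e` tells. -/
inductive Det : Type
  | skip
  | setNat (a e : NExp)
  | setReal (a : NExp) (e : RExp)
  | floor (a : NExp) (e : RExp)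
  | query (a j i : NExp)
  | seq (c₁ c₂ : Det)
  | ite (b : BExp) (c₁ c₂ : Det)
  | loop (e : NExp) (c : Det)

open Classical in
/-- Execution of a deterministic program. -/
def Det.exec {X D : Type*} (R : Rep X D) {N : ℕ} (data : Fin N → X × Label) :
    Det → Config D → Config D
  | skip, c => c.tick 1
  | setNat a e, c => (c.setNat (a.val c.mem) (e.val c.mem)).tick (a.size + e.size + 1)
  | setReal a e, c => (c.setReal (a.val c.mem) (e.val data c.mem)).tick (a.size + e.size + 1)
  | floor a e, c => (c.setNat (a.val c.mem) ⌊e.val data c.mem⌋₊).tick (a.size + e.size + 1)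
  | query a j i, c =>
    (c.query R data (a.val c.mem) (j.val c.mem) (i.val c.mem)).tick (a.size + j.size + i.size + 1)
  | seq c₁ c₂, c => c₂.exec R data (c₁.exec R data c)
  | ite b c₁ c₂, c =>
    if b.Holds data c.mem then c₁.exec R data (c.tick (b.size + 1))
    else c₂.exec R data (c.tick (b.size + 1))
  | loop e c₁, c =>
    (fun c' => c₁.exec R data (c'.tick 1))^[e.val c.mem] (c.tick (e.size + 1))

/-- A coin which shows `true` with probability `p` (with `p` first projected to `[0, 1]`). -/
def coin (p : ℝ) : PMF Bool :=
  PMF.ofFintype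
    (fun b => if b then ENNReal.ofReal (Set.projIcc (0 : ℝ) 1 zero_le_one p : ℝ)
      else ENNReal.ofReal (1 - (Set.projIcc (0 : ℝ) 1 zero_le_one p : ℝ)))
    (by
      have h := (Set.projIcc (0 : ℝ) 1 zero_le_one p).2
      rw [Fintype.sum_bool]
      simp only [if_true, Bool.false_eq_true, if_false]
      rw [← ENNReal.ofReal_add h.1 (by linarith [h.2])]
      simp)

/-- Randomized programs with oracle access to a learner. `flip a p` flips a coin of bias `p` and
stores the outcome (`1` or `0`) in the integer register `a`. `call j b` invokes the oracle on the
data points whose indices are stored in the integer registers `b, b + 1, …`, and stores the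
description which it returns in slot `j`. -/
inductive Prog : Type
  | det (c : Det)
  | flip (a : NExp) (p : RExp)
  | call (j b : NExp)
  | seq (c₁ c₂ : Prog)
  | ite (b : BExp) (c₁ c₂ : Prog)
  | loop (e : NExp) (c : Prog)

/-- Invoke the oracle `L`, which takes `n₀` data points. Reading off the indices of these takes `n₀`
time steps; the running time of `L` itself is not counted. (Nothing is returned if one of the
indices is not that of a data point.) -/
def Config.call {X D : Type*} {n₀ : ℕ} (L : Learner (X × Label) n₀ D) {N : ℕ}
    (data : Fin N → X × Label) (j b : ℕ) (c : Config D) : PMF (Config D) :=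
  let c' : Config D := { c with time := c.time + n₀, calls := c.calls + 1 }
  if h : ∀ i : Fin n₀, c.mem.nat (b + i) < N then
    (L fun i => data ⟨c.mem.nat (b + i), h i⟩).map fun d =>
      { c' with mem := { c'.mem with slot := Function.update c'.mem.slot j (some d) } }
  else PMF.pure c'

open Classical in
/-- Execution of a randomized program with oracle `L`: the law of the final configuration. -/
def Prog.exec {X D : Type*} (R : Rep X D) {n₀ : ℕ} (L : Learner (X × Label) n₀ D) {N : ℕ}
    (data : Fin N → X × Label) : Prog → Config D → PMF (Config D)
  | det c₁, c => PMF.pure (c₁.exec R data c)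
  | flip a p, c =>
    (coin (p.val data c.mem)).map fun r =>
      (c.setNat (a.val c.mem) (if r then 1 else 0)).tick (a.size + p.size + 1)
  | call j b, c =>
    (c.call L data (j.val c.mem) (b.val c.mem)).map (Config.tick (j.size + b.size + 1))
  | seq c₁ c₂, c => (c₁.exec R L data c).bind (c₂.exec R L data)
  | ite b c₁ c₂, c =>
    if b.Holds data c.mem then c₁.exec R L data (c.tick (b.size + 1))
    else c₂.exec R L data (c.tick (b.size + 1))
  | loop e c₁, c =>
    Nat.rec (PMF.pure (c.tick (e.size + 1)))
      (fun _ p => p.bind fun c' => c₁.exec R L data (c'.tick 1)) (e.val c.mem)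

/-- Initial configuration: the parameters of the program are in the first registers, all other
registers contain `0`, and all slots are empty. -/
def initConfig (D : Type*) (ints : List ℕ) (reals : List ℝ) : Config D where
  mem := { nat := fun i => ints.getD i 0, real := fun i => reals.getD i 0, slot := fun _ => none }
  time := 0
  calls := 0

/-- The law of the final configuration when the program is run on the given parameters and data. -/
def Prog.run {X D : Type*} (P : Prog) (R : Rep X D) {n₀ : ℕ} (L : Learner (X × Label) n₀ D)
    (ints : List ℕ) (reals : List ℝ) {n : ℕ} (data : Fin n → X × Label) : PMF (Config D) :=
  P.exec R L data (initConfig D ints reals)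

/-- The learner given by a program: its output description is the final content of the memory. -/
def Prog.learner {X D : Type*} (P : Prog) (R : Rep X D) {n₀ : ℕ} (L : Learner (X × Label) n₀ D)
    (ints : List ℕ) (reals : List ℝ) (n : ℕ) : Learner (X × Label) n (Mem D) :=
  fun data => (P.run R L ints reals data).map Config.mem

/-- Run the deterministic program `E` on the memory `m` with the single individual `x` as input
(with the dummy label `0`). -/
def Det.evalRun {X D : Type*} (E : Det) (R : Rep X D) (m : Mem D) (x : X) : Config D :=
  E.exec R (fun _ : Fin 1 => (x, ⟨0, by norm_num, by norm_num⟩)) ⟨m, 0, 0⟩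

open Classical in
/-- Memory contents as descriptions of models: the value of the model described by `m` at `x` is
computed by `E`, which returns `1` by leaving the number `1` in the integer register `0`, and `-1`
by leaving any other number there. -/
def Det.rep {X D : Type*} (E : Det) (R : Rep X D) : Rep X (Mem D) where
  eval m x := if (E.evalRun R m x).mem.nat 0 = 1 then ⟨1, by simp⟩ else ⟨-1, by simp⟩
  time m x := (E.evalRun R m x).time

end

end CompLearn

namespace CompLearn
open scoped ENNReal
noncomputable section

/-! ### Expectations of non-negative functions -/

/-! The output model is the sign `sg H` of a real score function `H` built by boosting against a
convex potential. With `pot t = 1 - t` for `t ≤ 0` and `1 / (1 + t)` for `t > 0`, the potential of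
`H` is `E[|y| pot (sg y * H x)]`. The weight `w` of a labelled point is `wt (sg y * H x)`, where `wt
= -pot'`. Thus `w` lies in `[0, 1]`, and it equals `1` wherever `sg H` makes a mistake.

Why halting is safe (`expect_gprod_sub_le`): pointwise `(1 - w) (y ◇ b - y sg H) ≤ 0`, because
either `w = 1`, or `sg H` has the sign of `y` and `y sg H = |y| ≥ y ◇ b`. Hence `E[y ◇ b] ≤ E[y sg
H] + E[w (y ◇ b)] - E[w y sg H]`, so `H` is good enough once `E[w (y ◇ b)] ≤ α` for every `b ∈ B`
and `E[w y sg H] ≥ -ε`.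

Why a violated condition gives progress: if `E[w y sg H]` is clearly negative, a step of size `ε /
16` of all scores towards zero lowers the potential by `ε ^ 2 / 128` (`potential_osc_le`). If `E[w
(y ◇ b)] > α` for some `b`, the distribution reweighted by `w` is still labelled by `S` and has
benchmark at least `α`. So the weak learner, run on points obtained by rejection sampling, should
return an `f` for which adding `γ / 4 * f` lowers the potential by `γ ^ 2 * α / 32`
(`potential_weak_le`). Both use `pot_add_le`, whose second-order error is proportional to the weight
itself. The potential starts at most `1` and stays nonnegative, so there are `O(γ⁻² α⁻¹)` useful
weak models and `O(ε⁻²)` steps towards zero.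

The expectations are estimated on fresh batches. Both tests have a gap between the levels that must
be accepted and those that must be rejected, so a Chernoff bound suffices (`prob_draws_tooLow`,
`prob_draws_useful`). Accepted points of rejection sampling are dominated by i.i.d. draws from the
reweighted distribution (`ev_trials_le`), and a shortage of them is unlikely
(`prob_trials_length_lt`). `ev_weakStep_le` adds up the errors of one weak step, and
`prob_not_correct_le` does the induction over all steps: each edge test costs `δ₃`, each weak step
`δ₁ + δ₂`.

There may be far more steps towards zero than weak models, yet evaluation must take time
proportional to `W' * T`. Only the number of consecutive steps between weak models is stored: the
iterate runs straight towards zero and then alternates with period two, so it is computable in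
constant time (`osc_iterate`). The program is compared with the abstract Markov chain by a coupling
(`boostCode_coupled`) whose invariant also bounds time and oracle calls on every outcome. -/

/-- Expectation of a function with values in `[0, ∞]` under a discrete distribution. -/
def ev {A : Type*} (p : PMF A) (f : A → ℝ≥0∞) : ℝ≥0∞ := ∑' a, p a * f a

section ev
variable {A B : Type*}

theorem ev_pure (a : A) (f : A → ℝ≥0∞) : ev (PMF.pure a) f = f a := by
  classical
  unfold ev
  rw [tsum_eq_single a]
  · simp
  · intro b hb
    simp [PMF.pure_apply, hb]

theorem ev_bind (p : PMF A) (q : A → PMF B) (f : B → ℝ≥0∞) :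
    ev (p.bind q) f = ev p fun a => ev (q a) f := by
  unfold ev
  simp only [PMF.bind_apply, ← ENNReal.tsum_mul_right, ← ENNReal.tsum_mul_left]
  rw [ENNReal.tsum_comm]
  simp only [mul_assoc]

theorem ev_map (p : PMF A) (g : A → B) (f : B → ℝ≥0∞) :
    ev (p.map g) f = ev p fun a => f (g a) := by
  rw [PMF.map, ev_bind]
  simp [ev_pure]

theorem ev_const (p : PMF A) (r : ℝ≥0∞) : ev p (fun _ => r) = r := by
  unfold ev
  rw [ENNReal.tsum_mul_right, p.tsum_coe, one_mul]

theorem ev_mono_support {p : PMF A} {f g : A → ℝ≥0∞} (h : ∀ a ∈ p.support, f a ≤ g a) :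
    ev p f ≤ ev p g := by
  unfold ev
  refine ENNReal.tsum_le_tsum fun a => ?_
  by_cases ha : a ∈ p.support
  · gcongr
    exact h a ha
  · rw [PMF.mem_support_iff, not_not] at ha
    simp [ha]

theorem ev_mono {p : PMF A} {f g : A → ℝ≥0∞} (h : ∀ a, f a ≤ g a) : ev p f ≤ ev p g :=
  ev_mono_support fun a _ => h a

theorem ev_le_const {p : PMF A} {f : A → ℝ≥0∞} {r : ℝ≥0∞} (h : ∀ a, f a ≤ r) : ev p f ≤ r :=
  (ev_mono h).trans_eq (ev_const p r)

theorem ev_add (p : PMF A) (f g : A → ℝ≥0∞) :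
    ev p (fun a => f a + g a) = ev p f + ev p g := by
  unfold ev
  simp only [mul_add, ENNReal.tsum_add]

theorem ev_mul_left (p : PMF A) (r : ℝ≥0∞) (f : A → ℝ≥0∞) :
    ev p (fun a => r * f a) = r * ev p f := by
  unfold ev
  rw [← ENNReal.tsum_mul_left]
  congr with a
  ring

theorem ev_mul_right (p : PMF A) (r : ℝ≥0∞) (f : A → ℝ≥0∞) :
    ev p (fun a => f a * r) = ev p f * r := by
  simp only [mul_comm _ r, ev_mul_left]

theorem ev_comm (p : PMF A) (q : PMF B) (f : A → B → ℝ≥0∞) :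
    ev p (fun a => ev q (f a)) = ev q fun b => ev p fun a => f a b := by
  unfold ev
  simp only [← ENNReal.tsum_mul_left]
  rw [ENNReal.tsum_comm]
  congr with b
  congr with a
  ring

/-- Moves the choice of a weak model outside the averages over the later batches, so that the test
batch can be averaged with the model held fixed. -/
theorem ev_comm₃ {I : Type*} (p : PMF A) (q : PMF B) (r : PMF I) (f : A → B → I → ℝ≥0∞) :
    ev p (fun a => ev q fun b => ev r (f a b)) =
      ev r fun i => ev p fun a => ev q fun b => f a b i :=
  (congrArg (ev p) (funext fun _ => ev_comm _ _ _)).trans (ev_comm _ _ _)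

open Classical in
/-- The probability of an event. -/
def prob (p : PMF A) (Q : A → Prop) : ℝ≥0∞ := ev p fun a => if Q a then 1 else 0

theorem toOuterMeasure_eq_prob (p : PMF A) (s : Set A) :
    p.toOuterMeasure s = prob p fun a => a ∈ s := by
  classical
  rw [PMF.toOuterMeasure_apply, prob, ev]
  congr with a
  by_cases h : a ∈ s <;> simp [h]

theorem prob_add_prob_not (p : PMF A) (Q : A → Prop) : prob p Q + prob p (fun a => ¬ Q a) = 1 := by
  classical
  unfold prob
  rw [← ev_add]
  refine Eq.trans ?_ (ev_const p 1)
  congr with a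
  by_cases h : Q a <;> simp [h]

theorem prob_le_one (p : PMF A) (Q : A → Prop) : prob p Q ≤ 1 :=
  (prob_add_prob_not p Q) ▸ le_self_add

theorem prob_mono {p : PMF A} {Q Q' : A → Prop} (h : ∀ a, Q a → Q' a) : prob p Q ≤ prob p Q' := by
  classical
  refine ev_mono fun a => ?_
  by_cases hQ : Q a
  · simp [hQ, h a hQ]
  · simp [hQ]

theorem prob_bind (p : PMF A) (q : A → PMF B) (Q : B → Prop) :
    prob (p.bind q) Q = ev p fun a => prob (q a) Q := ev_bind _ _ _

theorem prob_map (p : PMF A) (g : A → B) (Q : B → Prop) :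
    prob (p.map g) Q = prob p fun a => Q (g a) := ev_map _ _ _

open Classical in
theorem prob_pure (a : A) (Q : A → Prop) : prob (PMF.pure a) Q = if Q a then 1 else 0 :=
  ev_pure _ _

/-- Union bound: a function bounded by `1` is, on average, at most the probability of an
exceptional event plus a bound that holds outside of that event. -/
theorem ev_le_prob_add {p : PMF A} {f : A → ℝ≥0∞} {Q : A → Prop} {r : ℝ≥0∞}
    (h₁ : ∀ a, f a ≤ 1) (h : ∀ a, ¬ Q a → f a ≤ r) : ev p f ≤ prob p Q + r := by
  classical
  unfold prob
  rw [← ev_const p r, ← ev_add]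
  refine ev_mono fun a => ?_
  by_cases hQ : Q a
  · simpa [hQ] using (h₁ a).trans le_self_add
  · simpa [hQ] using h a hQ

end ev

/-! ### Couplings -/

/-- The two laws have a coupling which is supported in the relation `R`. -/
def Coupled {A B : Type*} (p : PMF A) (q : PMF B) (R : A → B → Prop) : Prop :=
  ∃ j : PMF (A × B), j.map Prod.fst = p ∧ j.map Prod.snd = q ∧ ∀ x ∈ j.support, R x.1 x.2

section Coupled
variable {A B A' B' : Type*}

theorem Coupled.mono {p : PMF A} {q : PMF B} {R R' : A → B → Prop} (h : Coupled p q R)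
    (hR : ∀ a b, R a b → R' a b) : Coupled p q R' := by
  obtain ⟨j, h₁, h₂, h₃⟩ := h
  exact ⟨j, h₁, h₂, fun x hx => hR _ _ (h₃ x hx)⟩

theorem Coupled.map {I : Type*} {p : PMF I} {f : I → A} {g : I → B} {R : A → B → Prop}
    (h : ∀ i ∈ p.support, R (f i) (g i)) : Coupled (p.map f) (p.map g) R := by
  refine ⟨p.map fun i => (f i, g i), ?_, ?_, ?_⟩
  · rw [PMF.map_comp]; rfl
  · rw [PMF.map_comp]; rfl
  · intro x hx
    rw [PMF.support_map] at hx
    obtain ⟨i, hi, rfl⟩ := hx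
    exact h i hi

theorem Coupled.pure {a : A} {b : B} {R : A → B → Prop} (h : R a b) :
    Coupled (PMF.pure a) (PMF.pure b) R := by
  refine ⟨PMF.pure (a, b), by simp [PMF.pure_map], by simp [PMF.pure_map], ?_⟩
  intro x hx
  rw [PMF.mem_support_pure_iff] at hx
  subst hx
  exact h

theorem Coupled.bind {p : PMF A} {q : PMF B} {R : A → B → Prop} {f : A → PMF A'} {g : B → PMF B'}
    {R' : A' → B' → Prop} (h : Coupled p q R) (hfg : ∀ a b, R a b → Coupled (f a) (g b) R') :
    Coupled (p.bind f) (q.bind g) R' := by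
  classical
  obtain ⟨j, rfl, rfl, h₃⟩ := h
  have key : ∀ x : A × B, ∃ k : PMF (A' × B'), k.map Prod.fst = f x.1 ∧ k.map Prod.snd = g x.2 ∧
      (R x.1 x.2 → ∀ y ∈ k.support, R' y.1 y.2) := by
    intro x
    by_cases hx : R x.1 x.2
    · obtain ⟨k, h₁, h₂, h₃⟩ := hfg _ _ hx
      exact ⟨k, h₁, h₂, fun _ => h₃⟩
    -- Pairs outside `R` are not charged by `j`, so any coupling will do there; the product law is
    -- used.
    · refine ⟨(f x.1).bind fun a => (g x.2).map fun b => (a, b), ?_, ?_, fun h => absurd h hx⟩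
      · have hc : ∀ a : A', (g x.2).map (fun _ => a) = PMF.pure a := fun a => PMF.map_const _ _
        simp [PMF.map_bind, PMF.map_comp, Function.comp_def, hc]
      · simp [PMF.map_bind, PMF.map_comp, Function.comp_def]
        exact PMF.map_id _
  choose k hk₁ hk₂ hk₃ using key
  refine ⟨j.bind k, ?_, ?_, ?_⟩
  · rw [PMF.map_bind, PMF.bind_map]
    simp [hk₁, Function.comp_def]
  · rw [PMF.map_bind, PMF.bind_map]
    simp [hk₂, Function.comp_def]
  · intro y hy
    rw [PMF.mem_support_bind_iff] at hy
    obtain ⟨x, hx, hy⟩ := hy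
    exact hk₃ x (h₃ x hx) y hy

/-- Turns a coupling into a statement about every possible outcome, as needed for the worst-case
bounds on time and calls. -/
theorem Coupled.exists_of_mem_support {p : PMF A} {q : PMF B} {R : A → B → Prop}
    (h : Coupled p q R) {a : A} (ha : a ∈ p.support) : ∃ b, R a b := by
  obtain ⟨j, rfl, rfl, h₃⟩ := h
  rw [PMF.support_map] at ha
  obtain ⟨x, hx, rfl⟩ := ha
  exact ⟨x.2, h₃ x hx⟩

theorem Coupled.prob_le {p : PMF A} {q : PMF B} {R : A → B → Prop} (h : Coupled p q R)
    {Q : A → Prop} {Q' : B → Prop} (hQ : ∀ a b, R a b → Q a → Q' b) : prob p Q ≤ prob q Q' := by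
  classical
  obtain ⟨j, rfl, rfl, h₃⟩ := h
  rw [prob_map, prob_map]
  refine ev_mono_support fun x hx => ?_
  by_cases h : Q x.1
  · simp [h, hQ _ _ (h₃ x hx) h]
  · simp [h]

end Coupled

/-! ### Iteration of a random step -/

/-- The law after `k` independent steps of the Markov kernel `f`, starting from `a`. -/
def kiter {A : Type*} (f : A → PMF A) (k : ℕ) (a : A) : PMF A :=
  Nat.rec (PMF.pure a) (fun _ p => p.bind f) k

theorem kiter_zero {A : Type*} (f : A → PMF A) (a : A) : kiter f 0 a = PMF.pure a := rfl

theorem kiter_succ {A : Type*} (f : A → PMF A) (k : ℕ) (a : A) :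
    kiter f (k + 1) a = (kiter f k a).bind f := rfl

/-- Loops append an iteration at the end, whereas the probabilistic inductions condition on the
first one; this passes between the two. -/
theorem kiter_succ' {A : Type*} (f : A → PMF A) (k : ℕ) (a : A) :
    kiter f (k + 1) a = (f a).bind (kiter f k) := by
  induction k with
  | zero =>
    rw [kiter_succ, kiter_zero, PMF.pure_bind]
    exact (PMF.bind_pure _).symm
  | succ k ih =>
    rw [kiter_succ, ih, PMF.bind_bind]
    rfl

theorem Coupled.kiter {A B : Type*} {f : A → PMF A} {g : B → PMF B} {R : ℕ → A → B → Prop}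
    {a : A} {b : B} {k : ℕ} (h₀ : R 0 a b)
    (h : ∀ i < k, ∀ a b, R i a b → Coupled (f a) (g b) (R (i + 1))) :
    Coupled (kiter f k a) (kiter g k b) (R k) := by
  induction k with
  | zero => exact Coupled.pure h₀
  | succ k ih =>
    rw [kiter_succ, kiter_succ]
    exact (ih fun i hi => h i (by omega)).bind (h k (by omega))

theorem ev_coin {p : ℝ} (h₀ : 0 ≤ p) (h₁ : p ≤ 1) (f : Bool → ℝ≥0∞) :
    ev (coin p) f = ENNReal.ofReal p * f true + ENNReal.ofReal (1 - p) * f false := by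
  unfold ev coin
  rw [tsum_fintype, Fintype.sum_bool]
  simp [Set.projIcc_of_mem zero_le_one (Set.mem_Icc.2 ⟨h₀, h₁⟩)]


/-! ### Expectations of bounded real functions -/

section expect
variable {Z : Type*} (μ : PMF Z)

theorem summable_toReal : Summable fun z => (μ z).toReal :=
  ENNReal.summable_toReal (by rw [μ.tsum_coe]; exact ENNReal.one_ne_top)

theorem tsum_toReal : ∑' z, (μ z).toReal = 1 := by
  rw [← ENNReal.tsum_toReal_eq fun z => μ.apply_ne_top z, μ.tsum_coe, ENNReal.toReal_one]

/-- Boundedness of a real function. -/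
def Bdd (g : Z → ℝ) : Prop := ∃ K, ∀ z, |g z| ≤ K

variable {μ} {g g' : Z → ℝ}

theorem Bdd.add (h : Bdd g) (h' : Bdd g') : Bdd fun z => g z + g' z := by
  obtain ⟨K, hK⟩ := h
  obtain ⟨K', hK'⟩ := h'
  exact ⟨K + K', fun z => (abs_add_le _ _).trans (add_le_add (hK z) (hK' z))⟩

theorem Bdd.const_mul (r : ℝ) (h : Bdd g) : Bdd fun z => r * g z := by
  obtain ⟨K, hK⟩ := h
  exact ⟨|r| * K, fun z => by rw [abs_mul]; exact mul_le_mul_of_nonneg_left (hK z) (abs_nonneg r)⟩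

theorem bdd_const (r : ℝ) : Bdd fun _ : Z => r := ⟨|r|, fun _ => le_rfl⟩

theorem Bdd.summable (h : Bdd g) : Summable fun z => (μ z).toReal * g z := by
  obtain ⟨K, hK⟩ := h
  refine Summable.of_norm_bounded ((summable_toReal μ).mul_right K) fun z => ?_
  rw [Real.norm_eq_abs, abs_mul, abs_of_nonneg ENNReal.toReal_nonneg]
  exact mul_le_mul_of_nonneg_left (hK z) ENNReal.toReal_nonneg

theorem expect_mono (h : Bdd g) (h' : Bdd g') (hg : ∀ z, g z ≤ g' z) :
    expect μ g ≤ expect μ g' :=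
  h.summable.tsum_le_tsum
    (fun z => mul_le_mul_of_nonneg_left (hg z) ENNReal.toReal_nonneg) h'.summable

theorem expect_add (h : Bdd g) (h' : Bdd g') :
    expect μ (fun z => g z + g' z) = expect μ g + expect μ g' := by
  unfold expect
  rw [← h.summable.tsum_add h'.summable]
  simp only [mul_add]

theorem expect_const_mul (r : ℝ) (g : Z → ℝ) :
    expect μ (fun z => r * g z) = r * expect μ g := by
  unfold expect
  rw [← tsum_mul_left]
  congr with z
  ring

theorem expect_const (r : ℝ) : expect μ (fun _ => r) = r := by
  unfold expect
  rw [tsum_mul_right, tsum_toReal, one_mul]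

theorem expect_neg : expect μ (fun z => - g z) = - expect μ g := by
  simpa using expect_const_mul (μ := μ) (-1) g

theorem expect_nonneg (hg : ∀ z, 0 ≤ g z) : 0 ≤ expect μ g :=
  tsum_nonneg fun z => mul_nonneg ENNReal.toReal_nonneg (hg z)

theorem expect_le_of_le {r : ℝ} (h : Bdd g) (hg : ∀ z, g z ≤ r) : expect μ g ≤ r :=
  (expect_mono h (bdd_const r) hg).trans_eq (expect_const r)

theorem abs_expect_le {K : ℝ} (hg : ∀ z, |g z| ≤ K) : |expect μ g| ≤ K := by
  have hb : Bdd g := ⟨K, hg⟩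
  rw [abs_le]
  constructor
  · rw [← expect_const (μ := μ) (-K)]
    exact expect_mono (bdd_const _) hb fun z => (abs_le.1 (hg z)).1
  · exact expect_le_of_le hb fun z => (abs_le.1 (hg z)).2

theorem ev_ofReal (h : Bdd g) (hg : ∀ z, 0 ≤ g z) :
    ev μ (fun z => ENNReal.ofReal (g z)) = ENNReal.ofReal (expect μ g) := by
  unfold ev expect
  rw [ENNReal.ofReal_tsum_of_nonneg (fun z => mul_nonneg ENNReal.toReal_nonneg (hg z)) h.summable]
  congr with z
  rw [ENNReal.ofReal_mul ENNReal.toReal_nonneg, ENNReal.ofReal_toReal (μ.apply_ne_top z)]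

end expect

/-! ### Samples as infinite sequences -/

section samples
variable {Z : Type*}

/-- The sequence which starts with the data points of `data` and continues with `z₀`. -/
def extend (z₀ : Z) {n : ℕ} (data : Fin n → Z) (i : ℕ) : Z :=
  if h : i < n then data ⟨i, h⟩ else z₀

/-- `n` independent draws from `μ`, continued by the constant `z₀`. -/
def draws (z₀ : Z) (μ : PMF Z) (n : ℕ) : PMF (ℕ → Z) := (iid μ n).map (extend z₀)

/-- The first `a` terms of `s`, followed by `t`. -/
def glue (s : ℕ → Z) (a : ℕ) (t : ℕ → Z) (i : ℕ) : Z := if i < a then s i else t (i - a)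

theorem glue_add (s : ℕ → Z) (a : ℕ) (t : ℕ → Z) (i : ℕ) : glue s a t (a + i) = t i := by
  simp [glue]

theorem glue_of_lt (s : ℕ → Z) {a i : ℕ} (t : ℕ → Z) (h : i < a) : glue s a t i = s i := by
  simp [glue, h]

theorem glue_zero (s t : ℕ → Z) : glue s 0 t = t := by
  funext i
  simp [glue]

theorem glue_glue (r s t : ℕ → Z) (a b : ℕ) :
    glue r a (glue s b t) = glue (glue r a s) (a + b) t := by
  funext i
  unfold glue
  by_cases h : i < a
  · simp [h, show i < a + b by omega]
  · by_cases h' : i - a < b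
    · simp [h, h', show i < a + b by omega]
    · simp [h, h', show ¬ i < a + b by omega, Nat.sub_sub]

theorem draws_zero (z₀ : Z) (μ : PMF Z) : draws z₀ μ 0 = PMF.pure fun _ => z₀ := by
  unfold draws iid
  rw [PMF.pure_map]
  exact congrArg PMF.pure (funext fun i => by simp [extend])

theorem draws_succ (z₀ : Z) (μ : PMF Z) (n : ℕ) :
    draws z₀ μ (n + 1) = μ.bind fun z => (draws z₀ μ n).map (glue (fun _ => z) 1) := by
  unfold draws
  rw [iid, PMF.map_bind]
  congr with z : 1
  rw [PMF.map_comp, PMF.map_comp]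
  congr 1
  funext zs i
  cases i with
  | zero => simp [extend, glue]
  | succ i =>
    by_cases h : i < n
    · simpa [extend, glue, h] using Fin.cons_succ (α := fun _ => Z) z zs ⟨i, h⟩
    · simp [extend, glue, h]

/-- Independence of consecutive batches, in the form in which the analysis uses it: the prefix can
be fixed while the rest is averaged. -/
theorem draws_add (z₀ : Z) (μ : PMF Z) (a b : ℕ) :
    draws z₀ μ (a + b) = (draws z₀ μ a).bind fun s => (draws z₀ μ b).map (glue s a) := by
  induction a with
  | zero =>
    rw [draws_zero, PMF.pure_bind, Nat.zero_add]
    have : glue (fun _ : ℕ => z₀) 0 = id := funext fun t => glue_zero _ t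
    rw [this]
    exact (PMF.map_id _).symm
  | succ a ih =>
    rw [show a + 1 + b = (a + b) + 1 by ring, draws_succ, draws_succ, PMF.bind_bind]
    congr with z : 1
    rw [ih, PMF.map_bind, PMF.bind_map]
    congr with s : 1
    rw [PMF.map_comp]
    simp only [Function.comp_apply]
    congr 1
    funext t
    simp only [Function.comp_apply]
    rw [glue_glue, Nat.add_comm 1 a]

theorem ev_draws_add (z₀ : Z) (μ : PMF Z) (a b : ℕ) (F : (ℕ → Z) → ℝ≥0∞) :
    ev (draws z₀ μ (a + b)) F =
      ev (draws z₀ μ a) fun s => ev (draws z₀ μ b) fun t => F (glue s a t) := by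
  rw [draws_add, ev_bind]
  simp only [ev_map]

theorem ev_draws_succ (z₀ : Z) (μ : PMF Z) (n : ℕ) (F : (ℕ → Z) → ℝ≥0∞) :
    ev (draws z₀ μ (n + 1)) F =
      ev μ fun z => ev (draws z₀ μ n) fun t => F (glue (fun _ => z) 1 t) := by
  rw [draws_succ, ev_bind]
  simp only [ev_map]

theorem ev_draws_prod (z₀ : Z) (μ : PMF Z) (n : ℕ) (F : Z → ℝ≥0∞) :
    ev (draws z₀ μ n) (fun s => ∏ i ∈ Finset.range n, F (s i)) = ev μ F ^ n := by
  induction n with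
  | zero => simp [ev_const]
  | succ n ih =>
    rw [ev_draws_succ]
    simp only [Finset.prod_range_succ']
    have : ∀ (z : Z) t i, glue (fun _ : ℕ => z) 1 t (i + 1) = t i := fun z t i => by
      rw [Nat.add_comm, glue_add]
    simp only [this, glue_of_lt _ _ Nat.zero_lt_one, ev_mul_right, ih, ev_mul_left]
    rw [pow_succ]

/-- A Chernoff bound for means of bounded functions. -/
theorem prob_draws_sum_ge (z₀ : Z) (μ : PMF Z) (n : ℕ) {g : Z → ℝ} (hg : ∀ z, |g z| ≤ 2)
    {m τ : ℝ} (hm : expect μ g ≤ m) (hτ₀ : 0 ≤ τ) (hτ : τ ≤ 8) :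
    prob (draws z₀ μ n) (fun s => n * (m + τ) ≤ ∑ i ∈ Finset.range n, g (s i)) ≤
      ENNReal.ofReal (Real.exp (-(n * τ ^ 2 / 64))) := by
  classical
  set v := expect μ g with hv
  have hv2 : |v| ≤ 2 := abs_expect_le hg
  -- This `l` minimizes the exponent `-l * τ + 16 * l ^ 2`; the bound `τ ≤ 8` makes `|l * (g z - v)|
  -- ≤ 1`.
  set l := τ / 32 with hl
  have hl0 : 0 ≤ l := by positivity
  have hx : ∀ z, |l * (g z - v)| ≤ 1 := by
    intro z
    rw [abs_mul, abs_of_nonneg hl0]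
    have h4 : |g z - v| ≤ 4 := (abs_sub _ _).trans (by linarith [hg z])
    nlinarith [abs_nonneg (g z - v)]
  have hb : Bdd fun z => Real.exp (l * (g z - v)) := by
    refine ⟨Real.exp 1, fun z => ?_⟩
    rw [abs_of_pos (Real.exp_pos _), Real.exp_le_exp]
    exact (abs_le.1 (hx z)).2
  have hbg : Bdd g := ⟨2, hg⟩
  have hE : expect μ (fun z => Real.exp (l * (g z - v))) ≤ Real.exp (16 * l ^ 2) := by
    -- Uses `exp u ≤ 1 + u + u ^ 2` for `|u| ≤ 1`; the linear term vanishes on average because `v`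
    -- is the mean of `g`.
    have h1 : ∀ z, Real.exp (l * (g z - v)) ≤ (1 - l * v + 16 * l ^ 2) + l * g z := by
      intro z
      have := (abs_le.1 (Real.abs_exp_sub_one_sub_id_le (hx z))).2
      have h4 : |g z - v| ≤ 4 := (abs_sub _ _).trans (by linarith [hg z])
      have h5 : (g z - v) ^ 2 ≤ 4 ^ 2 := sq_le_sq' (by linarith [(abs_le.1 h4).1]) (abs_le.1 h4).2
      nlinarith [sq_nonneg l]
    refine (expect_mono hb ((bdd_const _).add (hbg.const_mul l)) h1).trans ?_
    rw [expect_add (bdd_const _) (hbg.const_mul l), expect_const, expect_const_mul]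
    have := Real.add_one_le_exp (16 * l ^ 2)
    linarith
  have hF : prob (draws z₀ μ n) (fun s => n * (m + τ) ≤ ∑ i ∈ Finset.range n, g (s i)) ≤
      ev (draws z₀ μ n) fun s => ENNReal.ofReal (Real.exp (-(n * (l * τ)))) *
        ∏ i ∈ Finset.range n, ENNReal.ofReal (Real.exp (l * (g (s i) - v))) := by
    refine ev_mono fun s => ?_
    split_ifs with h
    · rw [← ENNReal.ofReal_prod_of_nonneg fun _ _ => (Real.exp_pos _).le, ← Real.exp_sum,
        ← ENNReal.ofReal_mul (Real.exp_pos _).le, ← Real.exp_add, ← Finset.mul_sum,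
        Finset.sum_sub_distrib]
      rw [← ENNReal.ofReal_one]
      refine ENNReal.ofReal_le_ofReal (Real.one_le_exp ?_)
      simp only [Finset.sum_const, Finset.card_range, nsmul_eq_mul]
      have : 0 ≤ l * (∑ i ∈ Finset.range n, g (s i) - n * v - n * τ) := by
        refine mul_nonneg hl0 ?_
        have : (n : ℝ) * v ≤ n * m := mul_le_mul_of_nonneg_left hm (Nat.cast_nonneg n)
        linarith
      linarith
    · exact zero_le
  refine hF.trans ?_
  rw [ev_mul_left, ev_draws_prod z₀ μ n fun z => ENNReal.ofReal (Real.exp (l * (g z - v))),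
    ev_ofReal hb fun z => (Real.exp_pos _).le]
  calc _ ≤ ENNReal.ofReal (Real.exp (-(n * (l * τ)))) * ENNReal.ofReal (Real.exp (16 * l ^ 2)) ^ n := by
        gcongr
    _ = _ := by
        rw [← ENNReal.ofReal_pow (Real.exp_pos _).le, ← Real.exp_nat_mul,
          ← ENNReal.ofReal_mul (Real.exp_pos _).le, ← Real.exp_add]
        congr 2
        rw [hl]
        ring

theorem prob_draws_sum_le (z₀ : Z) (μ : PMF Z) (n : ℕ) {g : Z → ℝ} (hg : ∀ z, |g z| ≤ 2)
    {m τ : ℝ} (hm : m ≤ expect μ g) (hτ₀ : 0 ≤ τ) (hτ : τ ≤ 8) :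
    prob (draws z₀ μ n) (fun s => ∑ i ∈ Finset.range n, g (s i) ≤ n * (m - τ)) ≤
      ENNReal.ofReal (Real.exp (-(n * τ ^ 2 / 64))) := by
  refine le_trans (prob_mono fun s hs => ?_)
    (prob_draws_sum_ge z₀ μ n (g := fun z => - g z) (m := -m) (τ := τ)
      (fun z => by simpa using hg z) (by rw [expect_neg]; linarith) hτ₀ hτ)
  rw [Finset.sum_neg_distrib]
  linarith

end samples


/-! ### The potential -/

/-- The sign of a real number, where `0` counts as positive. -/
def sg (r : ℝ) : ℝ := if 0 ≤ r then 1 else -1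

/-- The convex potential function. -/
def pot (t : ℝ) : ℝ := if t ≤ 0 then 1 - t else 1 / (1 + t)

/-- The negative derivative of the potential function. -/
def wt (t : ℝ) : ℝ := if t ≤ 0 then 1 else 1 / (1 + t) ^ 2

theorem sg_mul_self (r : ℝ) : r * sg r = |r| := by
  unfold sg
  split_ifs with h
  · rw [abs_of_nonneg h, mul_one]
  · rw [abs_of_neg (not_le.1 h), mul_neg_one]

theorem sg_sq (r : ℝ) : sg r * sg r = 1 := by
  unfold sg
  split_ifs <;> norm_num

theorem abs_sg (r : ℝ) : |sg r| = 1 := by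
  unfold sg
  split_ifs <;> simp

theorem abs_mul_sg (r : ℝ) : |r| * sg r = r := by
  rw [← sg_mul_self, mul_assoc, sg_sq, mul_one]

theorem wt_nonneg (t : ℝ) : 0 ≤ wt t := by
  unfold wt
  split_ifs
  · exact zero_le_one
  · positivity

theorem wt_le_one (t : ℝ) : wt t ≤ 1 := by
  unfold wt
  split_ifs with h
  · exact le_rfl
  · rw [div_le_one (by nlinarith)]
    nlinarith

theorem pot_nonneg (t : ℝ) : 0 ≤ pot t := by
  unfold pot
  split_ifs with h
  · linarith
  · have := not_le.1 h
    positivity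

theorem pot_le (t : ℝ) : pot t ≤ 1 + |t| := by
  unfold pot
  split_ifs with h
  · rw [abs_of_nonpos h]
    linarith
  · have := not_le.1 h
    rw [div_le_iff₀ (by linarith)]
    nlinarith [abs_nonneg t]

/-- The relative curvature of `pot` is bounded, so the quadratic error carries the factor `wt t`. A
uniform second-order bound would not suffice: when the total weight is only about `α`, the error
must shrink with it. -/
theorem pot_add_le (t : ℝ) {r : ℝ} (hr : |r| ≤ 1 / 2) :
    pot (t + r) ≤ pot t - r * wt t + 2 * r ^ 2 * wt t := by
  obtain ⟨hr₁, hr₂⟩ := abs_le.1 hr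
  unfold pot wt
  by_cases ht : t ≤ 0
  · simp only [ht, if_true]
    split_ifs with h
    · nlinarith [sq_nonneg r]
    · have h' := not_le.1 h
      rw [div_le_iff₀ (by linarith)]
      -- Here `0 < t + r ≤ r`, and `1 / (1 + u) ≤ 1 - u + u ^ 2` for `u = t + r`.
      have : (t + r) ^ 2 ≤ r ^ 2 := by nlinarith
      nlinarith [mul_nonneg h'.le (sq_nonneg (t + r)), mul_nonneg h'.le (sq_nonneg r)]
  · simp only [ht, if_false]
    have ht' := not_le.1 ht
    have ha : 0 < 1 + t := by linarith
    have hs : 1 / 2 ≤ 1 + t + r := by linarith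
    have key : 1 / (1 + t + r) ≤ 1 / (1 + t) - r * (1 / (1 + t) ^ 2) +
        2 * r ^ 2 * (1 / (1 + t) ^ 2) := by
      -- The exact remainder is nonnegative because `1 + t + r ≥ 1 / 2`.
      have : 1 / (1 + t) - r * (1 / (1 + t) ^ 2) + 2 * r ^ 2 * (1 / (1 + t) ^ 2) =
          1 / (1 + t + r) + r ^ 2 * (2 * (1 + t + r) - 1) / ((1 + t) ^ 2 * (1 + t + r)) := by
        have : 1 + t + r ≠ 0 := by linarith
        field_simp
        ring
      rw [this, le_add_iff_nonneg_right]
      refine div_nonneg (mul_nonneg (sq_nonneg r) (by linarith)) ?_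
      have : 0 ≤ 1 + t + r := by linarith
      positivity
    split_ifs with h
    -- For `u = t + r ≤ 0` the linear branch lies below the hyperbola, since `(1 - u) (1 + u) ≤ 1`.
    · refine le_trans ?_ key
      rw [le_div_iff₀ (by linarith)]
      nlinarith [sq_nonneg (t + r)]
    · rw [← add_assoc]
      exact key

/-! ### Potential and weights over the population. -/

section population
variable {X : Type*}

theorem abs_label_le (y : Label) : |(y : ℝ)| ≤ 1 := abs_le.2 y.2

theorem abs_sign (v : Sign) : |(v : ℝ)| = 1 := by
  obtain ⟨v, hv⟩ := v
  rcases hv with rfl | hv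
  · simp
  · rw [Set.mem_singleton_iff] at hv
    simp [hv]

/-- The weight of a labelled point with respect to the score function `H`. -/
def weight (H : X → ℝ) (z : X × Label) : ℝ := wt (sg z.2 * H z.1)

theorem weight_nonneg (H : X → ℝ) (z : X × Label) : 0 ≤ weight H z := wt_nonneg _

theorem weight_le_one (H : X → ℝ) (z : X × Label) : weight H z ≤ 1 := wt_le_one _

theorem bdd_weight (H : X → ℝ) : Bdd (weight H) :=
  ⟨1, fun z => by rw [abs_of_nonneg (weight_nonneg H z)]; exact weight_le_one H z⟩

theorem abs_weight_mul_le (H : X → ℝ) (z : X × Label) {r K : ℝ} (h : |r| ≤ K) :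
    |weight H z * r| ≤ K := by
  rw [abs_mul, abs_of_nonneg (weight_nonneg H z)]
  nlinarith [weight_nonneg H z, weight_le_one H z, abs_nonneg r]

/-- The potential of the score function `H`. -/
def potential (μ : PMF (X × Label)) (H : X → ℝ) : ℝ :=
  expect μ fun z => |(z.2 : ℝ)| * pot (sg z.2 * H z.1)

theorem potential_nonneg (μ : PMF (X × Label)) (H : X → ℝ) : 0 ≤ potential μ H :=
  expect_nonneg fun _ => mul_nonneg (abs_nonneg _) (pot_nonneg _)

theorem potential_zero_le (μ : PMF (X × Label)) : potential μ (fun _ => 0) ≤ 1 := by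
  have h : ∀ z : X × Label, |(z.2 : ℝ)| * pot (sg z.2 * 0) = |(z.2 : ℝ)| := fun z => by simp [pot]
  unfold potential
  simp only [h]
  exact (abs_le.1 (abs_expect_le fun z => by rw [abs_abs]; exact abs_label_le z.2)).2

theorem bdd_potential {H : X → ℝ} (h : Bdd H) :
    Bdd fun z : X × Label => |(z.2 : ℝ)| * pot (sg z.2 * H z.1) := by
  obtain ⟨K, hK⟩ := h
  refine ⟨1 + K, fun z => ?_⟩
  rw [abs_mul, abs_abs, abs_of_nonneg (pot_nonneg _)]
  have h1 := pot_le (sg z.2 * H z.1)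
  rw [abs_mul, abs_sg, one_mul] at h1
  nlinarith [hK z.1, abs_label_le z.2, abs_nonneg (z.2 : ℝ), pot_nonneg (sg z.2 * H z.1)]

/-- The effect of a small step on the potential. -/
theorem potential_add_le (μ : PMF (X × Label)) {H f : X → ℝ} (hH : Bdd H) {r : ℝ}
    (hr : |r| ≤ 1 / 2) (hf : ∀ x, |f x| = 1) :
    potential μ (fun x => H x + r * f x) ≤
      potential μ H - r * expect μ (fun z => weight H z * (z.2 * f z.1)) +
        2 * r ^ 2 * expect μ (weight H) := by
  have hbf : Bdd fun z : X × Label => weight H z * (z.2 * f z.1) :=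
    ⟨1, fun z => abs_weight_mul_le H z (by rw [abs_mul, hf, mul_one]; exact abs_label_le z.2)⟩
  have hH' : Bdd fun x => H x + r * f x :=
    hH.add (Bdd.const_mul r ⟨1, fun x => (hf x).le⟩)
  have hrhs : potential μ H - r * expect μ (fun z => weight H z * (z.2 * f z.1)) +
        2 * r ^ 2 * expect μ (weight H) =
      expect μ fun z => (|(z.2 : ℝ)| * pot (sg z.2 * H z.1) +
        (-r) * (weight H z * (z.2 * f z.1))) + 2 * r ^ 2 * weight H z := by
    rw [expect_add ((bdd_potential hH).add (hbf.const_mul _)) ((bdd_weight H).const_mul _),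
      expect_add (bdd_potential hH) (hbf.const_mul _), expect_const_mul, expect_const_mul]
    unfold potential
    ring
  rw [hrhs]
  refine expect_mono (bdd_potential hH') (((bdd_potential hH).add (hbf.const_mul _)).add
    ((bdd_weight H).const_mul _)) fun z => ?_
  have h1 : |sg z.2 * (r * f z.1)| ≤ 1 / 2 := by
    rw [abs_mul, abs_sg, one_mul, abs_mul, hf, mul_one]
    exact hr
  have h2 := pot_add_le (sg z.2 * H z.1) h1
  have h3 : (sg z.2 * (r * f z.1)) ^ 2 = r ^ 2 := by
    have : f z.1 ^ 2 = 1 := by rw [← sq_abs, hf, one_pow]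
    have h' := sg_sq z.2
    calc _ = (sg z.2 * sg z.2) * r ^ 2 * f z.1 ^ 2 := by ring
      _ = _ := by rw [this, h']; ring
  rw [h3] at h2
  have h4 := mul_le_mul_of_nonneg_left h2 (abs_nonneg (z.2 : ℝ))
  have h5 := abs_mul_sg (z.2 : ℝ)
  have h6 : |(z.2 : ℝ)| * (sg z.2 * (r * f z.1) * wt (sg z.2 * H z.1)) =
      z.2 * (r * f z.1) * wt (sg z.2 * H z.1) := by
    calc _ = (|(z.2 : ℝ)| * sg z.2) * (r * f z.1) * wt (sg z.2 * H z.1) := by ring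
      _ = _ := by rw [h5]
  have h7 : |(z.2 : ℝ)| * (2 * r ^ 2 * wt (sg z.2 * H z.1)) ≤
      2 * r ^ 2 * wt (sg z.2 * H z.1) := by
    have : 0 ≤ 2 * r ^ 2 * wt (sg z.2 * H z.1) := mul_nonneg (by positivity) (wt_nonneg _)
    nlinarith [abs_label_le z.2, abs_nonneg (z.2 : ℝ)]
  rw [mul_add (sg (z.2 : ℝ))]
  unfold weight
  linarith

/-- One step towards zero, which may overshoot. -/
def osc (e r : ℝ) : ℝ := r - e * sg r

/-- The first-order gain is at least `ε / 16 * (ε / 4) = ε ^ 2 / 64`, and the quadratic loss is at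
most `2 * (ε / 16) ^ 2 = ε ^ 2 / 128`. -/
theorem potential_osc_le (μ : PMF (X × Label)) {H : X → ℝ} (hH : Bdd H) {ε : ℝ} (hε₀ : 0 < ε)
    (hε : ε < 1 / 2)
    (h : expect μ (fun z => weight H z * (z.2 * sg (H z.1))) ≤ -(ε / 4)) :
    potential μ (fun x => osc (ε / 16) (H x)) ≤ potential μ H - ε ^ 2 / 128 := by
  have h1 := potential_add_le μ hH (f := fun x => sg (H x)) (r := -(ε / 16))
    (by rw [abs_neg, abs_of_pos (by positivity)]; linarith) fun x => abs_sg _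
  have h2 : (fun x => H x + -(ε / 16) * sg (H x)) = fun x => osc (ε / 16) (H x) := by
    funext x
    unfold osc
    ring
  rw [h2] at h1
  have h3 : expect μ (weight H) ≤ 1 := expect_le_of_le (bdd_weight H) (weight_le_one H)
  nlinarith

/-- With step size `γ / 4` the quadratic loss `2 * (γ / 4) ^ 2 * E[w]` equals `γ / 4 * (γ / 2) *
E[w]`, which is exactly what the subtraction of `γ / 2` in the hypothesis pays for. What remains is
`γ / 4` times the hypothesis. -/
theorem potential_weak_le (μ : PMF (X × Label)) {H f : X → ℝ} (hH : Bdd H) (hf : ∀ x, |f x| = 1)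
    {α γ : ℝ} (hγ₀ : 0 < γ) (hγ : γ < 1 / 2)
    (h : γ * α / 8 ≤ expect μ (fun z => weight H z * (z.2 * f z.1 - γ / 2))) :
    potential μ (fun x => H x + γ / 4 * f x) ≤ potential μ H - γ ^ 2 * α / 32 := by
  have h1 := potential_add_le μ hH (f := f) (r := γ / 4)
    (by rw [abs_of_pos (by positivity)]; linarith) hf
  have hbf : Bdd fun z : X × Label => weight H z * (z.2 * f z.1) :=
    ⟨1, fun z => abs_weight_mul_le H z (by rw [abs_mul, hf, mul_one]; exact abs_label_le z.2)⟩
  have h2 : expect μ (fun z => weight H z * (z.2 * f z.1 - γ / 2)) =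
      expect μ (fun z => weight H z * (z.2 * f z.1)) + -(γ / 2) * expect μ (weight H) := by
    rw [← expect_const_mul, ← expect_add hbf ((bdd_weight H).const_mul _)]
    congr with z
    ring
  rw [h2] at h
  nlinarith

theorem gprod_le_abs (u : ℝ) (v : Option Label) : gprod u v ≤ |u| := by
  cases v with
  | none => exact neg_le_self (abs_nonneg u)
  | some v =>
    change u * (v : ℝ) ≤ |u|
    refine (le_abs_self _).trans ?_
    rw [abs_mul]
    nlinarith [abs_nonneg u, abs_label_le v]

theorem abs_gprod_le (u : ℝ) (v : Option Label) : |gprod u v| ≤ |u| := by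
  cases v with
  | none => simp [gprod]
  | some v =>
    change |u * (v : ℝ)| ≤ |u|
    rw [abs_mul]
    nlinarith [abs_nonneg u, abs_label_le v]

/-- The key property of the weights: they are `1` at each mistake of the model `sg H`. -/
theorem expect_gprod_sub_le (μ : PMF (X × Label)) (H : X → ℝ) (b : Hyp X) :
    expect μ (fun z => gprod z.2 (b z.1)) ≤
      expect μ (fun z => z.2 * sg (H z.1)) + expect μ (fun z => weight H z * gprod z.2 (b z.1)) -
        expect μ (fun z => weight H z * (z.2 * sg (H z.1))) := by
  have hb : ∀ z : X × Label, |gprod z.2 (b z.1)| ≤ 1 :=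
    fun z => (abs_gprod_le _ _).trans (abs_label_le z.2)
  have hs : ∀ z : X × Label, |z.2 * sg (H z.1)| ≤ 1 := fun z => by
    rw [abs_mul, abs_sg, mul_one]
    exact abs_label_le z.2
  have b1 : Bdd fun z : X × Label => (z.2 : ℝ) * sg (H z.1) := ⟨1, hs⟩
  have b2 : Bdd fun z : X × Label => weight H z * gprod z.2 (b z.1) :=
    ⟨1, fun z => abs_weight_mul_le H z (hb z)⟩
  have b4 : Bdd fun z : X × Label => -(weight H z * (z.2 * sg (H z.1))) :=
    ⟨1, fun z => by rw [abs_neg]; exact abs_weight_mul_le H z (hs z)⟩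
  rw [sub_eq_add_neg, ← expect_neg, ← expect_add b1 b2, ← expect_add (b1.add b2) b4]
  refine expect_mono ⟨1, hb⟩ ((b1.add b2).add b4) fun z => ?_
  -- With nonpositive margin the weight is `1` and both sides agree. With positive margin the model
  -- is right in sign, attains `|y|`, and `y ◇ b` cannot exceed that.
  by_cases hz : sg z.2 * H z.1 ≤ 0
  · have : weight H z = 1 := if_pos hz
    rw [this]
    linarith
  · have h1 : (z.2 : ℝ) * sg (H z.1) = |(z.2 : ℝ)| := by
      unfold sg at hz ⊢
      split_ifs at hz ⊢ with h2 h3 h3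
      · rw [abs_of_nonneg h3, mul_one]
      · exact absurd (by linarith) hz
      · exact absurd (by linarith) hz
      · rw [abs_of_neg (not_le.1 h3), mul_neg_one]
    rw [h1]
    nlinarith [gprod_le_abs z.2 (b z.1), weight_le_one H z]

/-! ### Reweighting -/

/-- The distribution obtained from `μ` by rejection sampling with acceptance probability
`weight H`. -/
def reweight (μ : PMF (X × Label)) (H : X → ℝ) (h : 0 < expect μ (weight H)) : PMF (X × Label) :=
  ⟨fun z => μ z * ENNReal.ofReal (weight H z / expect μ (weight H)), by
    have h1 : ev μ (fun z => ENNReal.ofReal (weight H z / expect μ (weight H))) = 1 := by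
      simp only [div_eq_inv_mul]
      rw [ev_ofReal ((bdd_weight H).const_mul _)
        fun z => mul_nonneg (inv_nonneg.2 h.le) (weight_nonneg H z), expect_const_mul,
        inv_mul_cancel₀ h.ne', ENNReal.ofReal_one]
    exact h1 ▸ ENNReal.summable.hasSum⟩

theorem reweight_apply (μ : PMF (X × Label)) (H : X → ℝ) (h : 0 < expect μ (weight H))
    (z : X × Label) :
    reweight μ H h z = μ z * ENNReal.ofReal (weight H z / expect μ (weight H)) := rfl

theorem expect_reweight (μ : PMF (X × Label)) (H : X → ℝ) (h : 0 < expect μ (weight H))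
    (g : X × Label → ℝ) :
    expect (reweight μ H h) g = expect μ (fun z => weight H z * g z) / expect μ (weight H) := by
  rw [div_eq_inv_mul, ← expect_const_mul]
  unfold expect
  congr with z
  rw [reweight_apply, ENNReal.toReal_mul,
    ENNReal.toReal_ofReal (div_nonneg (weight_nonneg H z) h.le)]
  unfold expect
  ring

theorem mul_ev_reweight (μ : PMF (X × Label)) (H : X → ℝ) (h : 0 < expect μ (weight H))
    (F : X × Label → ℝ≥0∞) :
    ENNReal.ofReal (expect μ (weight H)) * ev (reweight μ H h) F =
      ev μ fun z => ENNReal.ofReal (weight H z) * F z := by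
  rw [← ev_mul_left]
  unfold ev
  congr with z
  rw [reweight_apply]
  beta_reduce
  have : ENNReal.ofReal (weight H z) = ENNReal.ofReal (expect μ (weight H)) *
      ENNReal.ofReal (weight H z / expect μ (weight H)) := by
    rw [← ENNReal.ofReal_mul h.le, mul_div_cancel₀ _ h.ne']
  rw [this]
  ring

/-- Reweighting only shrinks the support, so the same source hypothesis keeps explaining the labels.
This is why the weak guarantee relative to `S` applies to the reweighted distribution. -/
theorem DeterministicLabels.reweight {S : Set (Hyp X)} {μ : PMF (X × Label)}
    (hμ : DeterministicLabels S μ) (H : X → ℝ) (h : 0 < expect μ (weight H)) :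
    DeterministicLabels S (reweight μ H h) := by
  obtain ⟨s, hs, hμ⟩ := hμ
  refine ⟨s, hs, ?_⟩
  rw [PMF.toOuterMeasure_apply_eq_one_iff] at hμ ⊢
  refine subset_trans (fun z hz => ?_) hμ
  rw [PMF.mem_support_iff, reweight_apply] at hz
  exact (PMF.mem_support_iff _ _).2 (left_ne_zero_of_mul hz)

end population


/-! ### Rejection sampling -/

section trials
variable {X : Type*}

/-- One trial of rejection sampling: a state consists of the index of the next data point and the
list of points which have been accepted so far, of which at most `n₀` are kept. -/
def trial (s : ℕ → X × Label) (H : X → ℝ) (n₀ : ℕ) (st : ℕ × List (X × Label)) :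
    PMF (ℕ × List (X × Label)) :=
  (coin (weight H (s st.1))).map fun r =>
    (st.1 + 1, if r = true ∧ st.2.length < n₀ then st.2 ++ [s st.1] else st.2)

/-- A run of `k` trials reads only `k` consecutive points, so it is unaffected by the batches that
follow. -/
theorem kiter_trial_congr {s s' : ℕ → X × Label} (H : X → ℝ) (n₀ k : ℕ) :
    ∀ (p : ℕ) (l : List (X × Label)), (∀ i < k, s (p + i) = s' (p + i)) →
      kiter (trial s H n₀) k (p, l) = kiter (trial s' H n₀) k (p, l) := by
  induction k with
  | zero => intros; rfl
  | succ k ih =>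
    intro p l h
    have h0 : s p = s' p := h 0 (by omega)
    have h1 : trial s H n₀ (p, l) = trial s' H n₀ (p, l) := by simp only [trial, h0]
    rw [kiter_succ', kiter_succ', h1, trial, PMF.bind_map, PMF.bind_map]
    refine congrArg (PMF.bind _) (funext fun r => ih _ _ fun i hi => ?_)
    rw [Nat.add_assoc, Nat.add_comm 1]
    exact h (i + 1) (by omega)

variable (z₀ : X × Label) (μ : PMF (X × Label)) (H : X → ℝ) (n₀ : ℕ)

theorem ev_trial_succ (k p : ℕ) (pre : ℕ → X × Label) (l : List (X × Label))
    (F : ℕ × List (X × Label) → ℝ≥0∞) :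
    ev (draws z₀ μ (k + 1)) (fun t => ev (kiter (trial (glue pre p t) H n₀) (k + 1) (p, l)) F) =
      ev μ fun z =>
        ENNReal.ofReal (weight H z) * ev (draws z₀ μ k) (fun t =>
          ev (kiter (trial (glue (glue pre p fun _ => z) (p + 1) t) H n₀) k
            (p + 1, if l.length < n₀ then l ++ [z] else l)) F) +
        ENNReal.ofReal (1 - weight H z) * ev (draws z₀ μ k) (fun t =>
          ev (kiter (trial (glue (glue pre p fun _ => z) (p + 1) t) H n₀) k (p + 1, l)) F) := by
  rw [ev_draws_succ]
  congr with z
  rw [← ev_mul_left, ← ev_mul_left, ← ev_add]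
  congr with t
  rw [kiter_succ', ev_bind, glue_glue]
  have hz : glue (glue pre p fun _ => z) (p + 1) t p = z := by
    rw [glue_of_lt _ _ (Nat.lt_succ_self p)]
    simp [glue]
  rw [trial, ev_map, hz, ev_coin (weight_nonneg H z) (weight_le_one H z)]
  simp

/-- Conservation law of one trial: acceptance replaces the value by an `F z` whose average over
accepted points is `r`, rejection leaves `r` as it is. It drives the induction for rejection
sampling. -/
theorem ev_weight_mul_add {h : 0 < expect μ (weight H)} (F : X × Label → ℝ≥0∞) (r : ℝ≥0∞)
    (hF : ev (reweight μ H h) F = r) :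
    ev μ (fun z => ENNReal.ofReal (weight H z) * F z + ENNReal.ofReal (1 - weight H z) * r) =
      r := by
  have h1 : ev μ (fun z => ENNReal.ofReal (1 - weight H z)) =
      ENNReal.ofReal (1 - expect μ (weight H)) := by
    have hb : Bdd fun z => 1 + -1 * weight H z := (bdd_const 1).add ((bdd_weight H).const_mul _)
    have := ev_ofReal (μ := μ) hb fun z => by linarith [weight_le_one H z]
    rw [expect_add (bdd_const _) ((bdd_weight H).const_mul _), expect_const, expect_const_mul]
      at this
    simpa only [neg_one_mul, ← sub_eq_add_neg] using this
  have h2 : expect μ (weight H) ≤ 1 := expect_le_of_le (bdd_weight H) (weight_le_one H)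
  rw [ev_add, ev_mul_right, ← mul_ev_reweight μ H h, hF, h1, ← add_mul,
    ← ENNReal.ofReal_add h.le (by linarith)]
  simp

/-- The accepted points behave like independent draws from the reweighted distribution. -/
theorem ev_trials_le (h : 0 < expect μ (weight H)) (F : List (X × Label) → ℝ≥0∞) (k : ℕ) :
    ∀ (p r : ℕ) (pre : ℕ → X × Label) (l : List (X × Label)), l.length + r = n₀ →
      ev (draws z₀ μ k) (fun t => ev (kiter (trial (glue pre p t) H n₀) k (p, l))
        fun st => if st.2.length < n₀ then 0 else F st.2) ≤
      ev (iid (reweight μ H h) r) fun v => F (l ++ List.ofFn v) := by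
  -- The first trial is conditioned upon; `r` is the number of points still wanted. Runs that end
  -- short of points count as zero, which is why there is an inequality rather than an equality.
  induction k with
  | zero =>
    intro p r pre l hl
    simp only [kiter_zero, ev_pure, ev_const]
    split_ifs with h1
    · exact zero_le
    · have hr : r = 0 := by omega
      subst hr
      simp [iid, ev_pure]
  | succ k ih =>
    intro p r pre l hl
    rw [ev_trial_succ]
    cases r with
    | zero =>
      have h1 : ¬ l.length < n₀ := by omega
      simp only [h1, if_false]
      have hr := ev_weight_mul_add μ H (h := h) (fun _ => ev (iid (reweight μ H h) 0)
        fun v => F (l ++ List.ofFn v)) _ (ev_const _ _)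
      rw [← hr]
      refine ev_mono fun z => ?_
      gcongr
      · exact ih _ _ _ _ hl
      · exact ih _ _ _ _ hl
    | succ r =>
      have h1 : l.length < n₀ := by omega
      simp only [h1, if_true]
      have hr := ev_weight_mul_add μ H (h := h) (fun z => ev (iid (reweight μ H h) r)
        fun v => F (l ++ [z] ++ List.ofFn v)) (ev (iid (reweight μ H h) (r + 1))
        fun v => F (l ++ List.ofFn v)) (by simp [iid, ev_bind, ev_map])
      rw [← hr]
      refine ev_mono fun z => ?_
      gcongr
      · exact ih _ _ _ _ (by simp; omega)
      · exact ih _ _ _ _ hl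

/-- It is unlikely that too few points are accepted. -/
theorem prob_trials_length_lt {α : ℝ} (hα : α ≤ expect μ (weight H)) (k : ℕ) :
    ∀ (p : ℕ) (pre : ℕ → X × Label) (l : List (X × Label)),
      ev (draws z₀ μ k) (fun t => prob (kiter (trial (glue pre p t) H n₀) k (p, l))
        fun st => st.2.length < n₀) ≤
      if l.length < n₀ then
        ENNReal.ofReal (Real.exp ((n₀ : ℝ) - l.length) * (1 - α / 2) ^ k) else 0 := by
  have hM : expect μ (weight H) ≤ 1 := expect_le_of_le (bdd_weight H) (weight_le_one H)
  induction k with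
  | zero =>
    intro p pre l
    simp only [kiter_zero, prob_pure, ev_const]
    split_ifs with h1
    · rw [← ENNReal.ofReal_one, pow_zero, mul_one]
      refine ENNReal.ofReal_le_ofReal (Real.one_le_exp ?_)
      have : (l.length : ℝ) ≤ n₀ := by exact_mod_cast h1.le
      linarith
    · exact le_rfl
  | succ k ih =>
    intro p pre l
    unfold prob
    rw [ev_trial_succ]
    by_cases h1 : l.length < n₀
    · simp only [h1, if_true]
      -- Supermartingale argument: an accepted point divides the bound by `e`, hence at least halves
      -- it. A trial therefore multiplies it on average by at most `1 - E[w] / 2 ≤ 1 - α / 2`.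
      set E := Real.exp ((n₀ : ℝ) - l.length) * (1 - α / 2) ^ k with hE
      have hE0 : 0 ≤ E := mul_nonneg (Real.exp_pos _).le (pow_nonneg (by linarith) _)
      have hexp : Real.exp (-1) ≤ 1 / 2 := by
        rw [Real.exp_neg, inv_le_comm₀ (Real.exp_pos _) (by norm_num)]
        linarith [Real.add_one_le_exp 1]
      have hA : ∀ z pre, ev (draws z₀ μ k) (fun t => prob (kiter (trial (glue pre (p + 1) t) H n₀) k
          (p + 1, l ++ [z])) fun st => st.2.length < n₀) ≤ ENNReal.ofReal (1 / 2 * E) := by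
        intro z pre
        refine (ih _ _ _).trans ?_
        split_ifs
        · refine ENNReal.ofReal_le_ofReal ?_
          rw [hE, ← mul_assoc]
          refine mul_le_mul_of_nonneg_right ?_ (pow_nonneg (by linarith) _)
          rw [List.length_append, List.length_singleton, Nat.cast_add, Nat.cast_one,
            show (n₀ : ℝ) - (l.length + 1) = -1 + ((n₀ : ℝ) - l.length) by ring, Real.exp_add]
          exact mul_le_mul_of_nonneg_right hexp (Real.exp_pos _).le
        · exact zero_le
      have hB : ∀ pre, ev (draws z₀ μ k) (fun t => prob (kiter (trial (glue pre (p + 1) t) H n₀) k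
          (p + 1, l)) fun st => st.2.length < n₀) ≤ ENNReal.ofReal E := by
        intro pre
        refine (ih _ _ _).trans ?_
        rw [if_pos h1]
      calc _ ≤ ev μ fun z => ENNReal.ofReal (E + -(E / 2) * weight H z) := by
            refine ev_mono fun z => (add_le_add (mul_le_mul_right (hA _ _) _)
              (mul_le_mul_right (hB _) _)).trans_eq ?_
            have hw := weight_nonneg H z
            have hw1 := weight_le_one H z
            rw [← ENNReal.ofReal_mul hw, ← ENNReal.ofReal_mul (by linarith),
              ← ENNReal.ofReal_add (by positivity) (mul_nonneg (by linarith) hE0)]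
            congr 1
            ring
        _ ≤ _ := by
            rw [ev_ofReal ((bdd_const _).add ((bdd_weight H).const_mul _))
              (fun z => by nlinarith [weight_le_one H z]),
              expect_add (bdd_const _) ((bdd_weight H).const_mul _), expect_const,
              expect_const_mul]
            refine ENNReal.ofReal_le_ofReal ?_
            rw [pow_succ, ← mul_assoc, ← hE]
            nlinarith
    · simp only [h1, if_false]
      refine le_of_eq_of_le ?_ (le_refl (0 : ℝ≥0∞))
      have hB : ∀ pre, ev (draws z₀ μ k) (fun t => prob (kiter (trial (glue pre (p + 1) t) H n₀) k
          (p + 1, l)) fun st => st.2.length < n₀) = 0 := by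
        intro pre
        refine le_antisymm ((ih _ _ _).trans ?_) zero_le
        rw [if_neg h1]
      unfold prob at hB
      simp only [hB]
      simp [ev_const]

end trials


/-! ### The boosting algorithm on score functions -/

/-- Parameters of the boosting algorithm. -/
structure Par where
  (α γ ε : ℝ)
  (n₀ W' n₁ n₂ n₃ : ℕ)

/-- States of the boosting algorithm: the current score function, the numbers of weak models and of
steps towards zero from which it has been made, and a flag for termination. -/
structure St (X : Type*) where
  score : X → ℝ
  weak : ℕ
  flips : ℕ
  halted : Bool

section algorithm
variable {X D : Type*}

/-- The number of data points which have been used so far. -/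
def St.pos (q : Par) (σ : St X) : ℕ :=
  (σ.weak + σ.flips) * q.n₃ + σ.weak * (q.n₁ + q.n₂)

/-- The weighted correlation of a point with the model given by `H`. -/
def edge (H : X → ℝ) (z : X × Label) : ℝ := weight H z * (z.2 * sg (H z.1))

/-- The weighted correlation of a point with the model `f`, diminished by `γ / 2`. -/
def gain (γ : ℝ) (H f : X → ℝ) (z : X × Label) : ℝ := weight H z * (z.2 * f z.1 - γ / 2)

/-- On the sample, `H` correlates negatively with the weighted labels. -/
def TooLow (q : Par) (H : X → ℝ) (s : ℕ → X × Label) (p : ℕ) : Prop :=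
  ∑ i ∈ Finset.range q.n₃, edge H (s (p + i)) ≤ q.n₃ * -(q.ε / 2)

/-- On the sample, `f` correlates with the weighted labels. -/
def Useful (q : Par) (H f : X → ℝ) (s : ℕ → X × Label) (p : ℕ) : Prop :=
  q.n₂ * (q.γ * q.α / 4) ≤ ∑ i ∈ Finset.range q.n₂, gain q.γ H f (s (p + i))

theorem tooLow_congr (q : Par) (H : X → ℝ) {s s' : ℕ → X × Label} {p p' : ℕ}
    (h : ∀ i < q.n₃, s (p + i) = s' (p' + i)) : TooLow q H s p ↔ TooLow q H s' p' := by
  unfold TooLow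
  rw [Finset.sum_congr rfl fun i hi => by rw [h i (Finset.mem_range.1 hi)]]

theorem useful_congr (q : Par) (H f : X → ℝ) {s s' : ℕ → X × Label} {p p' : ℕ}
    (h : ∀ i < q.n₂, s (p + i) = s' (p' + i)) : Useful q H f s p ↔ Useful q H f s' p' := by
  unfold Useful
  rw [Finset.sum_congr rfl fun i hi => by rw [h i (Finset.mem_range.1 hi)]]

/-- The score function after a step towards zero. -/
def St.flip (q : Par) (σ : St X) : St X :=
  ⟨fun x => osc (q.ε / 16) (σ.score x), σ.weak, σ.flips + 1, false⟩

/-- The score function after adding a model. -/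
def St.add (q : Par) (σ : St X) (f : X → ℝ) : St X :=
  ⟨fun x => σ.score x + q.γ / 4 * f x, σ.weak + 1, σ.flips, false⟩

/-- Termination. -/
def St.halt (σ : St X) : St X := { σ with halted := true }

open Classical in
/-- Call the weak learner on points from the reweighted distribution, and add its output to the
score function if it turns out to be useful. -/
def weakStep (q : Par) (R : Rep X D) (L : Learner (X × Label) q.n₀ D) (z₀ : X × Label)
    (s : ℕ → X × Label) (p : ℕ) (σ : St X) : PMF (St X) :=
  (kiter (trial s σ.score q.n₀) q.n₁ (p, [])).bind fun st =>
    if st.2.length < q.n₀ then PMF.pure σ.halt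
    else (L fun i => st.2.getD i z₀).map fun d =>
      if Useful q σ.score (fun x => R.eval d x) s (p + q.n₁) then σ.add q fun x => R.eval d x
      else σ.halt

open Classical in
/-- One step of the boosting algorithm on the data `s`. -/
def step (q : Par) (R : Rep X D) (L : Learner (X × Label) q.n₀ D) (z₀ : X × Label)
    (s : ℕ → X × Label) (σ : St X) : PMF (St X) :=
  if σ.halted = true then PMF.pure σ
  else if TooLow q σ.score s (σ.pos q) then PMF.pure (σ.flip q)
  else if q.W' ≤ σ.weak then PMF.pure σ.halt
  else weakStep q R L z₀ s (σ.pos q + q.n₃) σ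

theorem step_of_tooLow {q : Par} {R : Rep X D} {L : Learner (X × Label) q.n₀ D} {z₀ : X × Label}
    {s : ℕ → X × Label} {σ : St X} (h : σ.halted = false) (h' : TooLow q σ.score s (σ.pos q)) :
    step q R L z₀ s σ = PMF.pure (σ.flip q) := by
  rw [step, if_neg (by simp [h]), if_pos h']

theorem step_of_not_tooLow {q : Par} {R : Rep X D} {L : Learner (X × Label) q.n₀ D}
    {z₀ : X × Label} {s : ℕ → X × Label} {σ : St X} (h : σ.halted = false)
    (h' : ¬ TooLow q σ.score s (σ.pos q)) (hw : σ.weak < q.W') :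
    step q R L z₀ s σ = weakStep q R L z₀ s (σ.pos q + q.n₃) σ := by
  rw [step, if_neg (by simp [h]), if_neg h', if_neg (not_le.2 hw)]

/-- The guarantee for the output of the boosting algorithm. -/
def St.Correct (q : Par) (B : Set (Hyp X)) (μ : PMF (X × Label)) (σ : St X) : Prop :=
  σ.halted = true ∧ ∀ b ∈ B, expect μ (fun z => gprod z.2 (b z.1)) ≤
    expect μ (fun z => z.2 * sg (σ.score z.1)) + (q.α + q.ε)

theorem kiter_step_of_halted (q : Par) (R : Rep X D) (L : Learner (X × Label) q.n₀ D)
    (z₀ : X × Label) (s : ℕ → X × Label) {σ : St X} (h : σ.halted = true) (T : ℕ) :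
    kiter (step q R L z₀ s) T σ = PMF.pure σ := by
  induction T with
  | zero => rfl
  | succ T ih => rw [kiter_succ, ih, PMF.pure_bind, step, if_pos h]

/-- Conditions on the parameters. -/
structure Par.Good (q : Par) (δ₂ δ₃ : ℝ) (W : ℕ) : Prop where
  α_pos : 0 < q.α
  γ_pos : 0 < q.γ
  γ_lt : q.γ < 1 / 2
  α_lt : q.α < 1 / 2
  ε_pos : 0 < q.ε
  ε_lt : q.ε < 1 / 2
  δ₂_pos : 0 < δ₂
  δ₃_pos : 0 < δ₃
  h₁ : Real.exp q.n₀ * (1 - q.α / 2) ^ q.n₁ ≤ δ₂ / 2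
  h₂ : Real.exp (-(q.n₂ * (q.γ * q.α / 8) ^ 2 / 64)) ≤ δ₂ / 2
  h₃ : Real.exp (-(q.n₃ * (q.ε / 4) ^ 2 / 64)) ≤ δ₃
  hW' : 1 < q.W' * (q.γ ^ 2 * q.α / 32)
  hW : q.W' + 128 / q.ε ^ 2 ≤ W

/-! ### Failure probability of the boosting algorithm. -/

variable {q : Par} {δ₁ δ₂ δ₃ : ℝ} {W : ℕ}

/-- The test threshold `-ε / 2` is at distance at least `ε / 4` from both critical levels `-ε / 4`
and `-ε`. The true expectation decides which of the two errors is possible, so a one-sided deviation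
bound is enough; between the levels either answer is harmless. -/
theorem prob_draws_tooLow (hq : q.Good δ₂ δ₃ W) (z₀ : X × Label) (μ : PMF (X × Label))
    (H : X → ℝ) :
    prob (draws z₀ μ q.n₃) (fun s => (-(q.ε / 4) < expect μ (edge H) ∧ TooLow q H s 0) ∨
      (expect μ (edge H) < -q.ε ∧ ¬ TooLow q H s 0)) ≤ ENNReal.ofReal δ₃ := by
  have hε := hq.ε_pos
  have hε' := hq.ε_lt
  have hg : ∀ z, |edge H z| ≤ 2 := fun z => abs_weight_mul_le H z (by
    rw [abs_mul, abs_sg, mul_one]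
    linarith [abs_label_le z.2])
  by_cases h : -(q.ε / 4) < expect μ (edge H)
  · refine le_trans (prob_mono ?_) ((prob_draws_sum_le z₀ μ q.n₃ hg h.le (τ := q.ε / 4)
      (by linarith) (by linarith)).trans (ENNReal.ofReal_le_ofReal hq.h₃))
    rintro s (⟨-, hs⟩ | ⟨h', -⟩)
    · simp only [TooLow, Nat.zero_add] at hs
      rw [show -(q.ε / 4) - q.ε / 4 = -(q.ε / 2) by ring]
      exact hs
    · linarith
  · by_cases h' : expect μ (edge H) < -q.ε
    -- The mean is compared with `-3ε/4` instead of `-ε`, so that a deviation of `ε / 4` leads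
    -- exactly to the threshold.
    · refine le_trans (prob_mono ?_) ((prob_draws_sum_ge z₀ μ q.n₃ hg (m := -(3 * q.ε / 4))
        (by linarith) (τ := q.ε / 4)
        (by linarith) (by linarith)).trans (ENNReal.ofReal_le_ofReal hq.h₃))
      rintro s (⟨h1, -⟩ | ⟨-, hs⟩)
      · exact absurd h1 h
      · simp only [TooLow, Nat.zero_add] at hs
        rw [show -(3 * q.ε / 4) + q.ε / 4 = -(q.ε / 2) by ring]
        exact (not_le.1 hs).le
    · refine le_trans (prob_mono (Q' := fun _ => False) ?_) ?_
      · rintro s (⟨h1, -⟩ | ⟨h1, -⟩)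
        · exact h h1
        · exact h' h1
      · simp [prob, ev_const]

/-- The threshold `γα/4` separates `γα/8`, the least gain that buys potential, from `γα/2`, the gain
that a successful weak call provides; the distance is at least `γα/8` on either side. -/
theorem prob_draws_useful (hq : q.Good δ₂ δ₃ W) (z₀ : X × Label) (μ : PMF (X × Label))
    (H : X → ℝ) {f : X → ℝ} (hf : ∀ x, |f x| = 1) :
    prob (draws z₀ μ q.n₂) (fun s =>
      (expect μ (gain q.γ H f) < q.γ * q.α / 8 ∧ Useful q H f s 0) ∨
      (q.γ * q.α / 2 ≤ expect μ (gain q.γ H f) ∧ ¬ Useful q H f s 0)) ≤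
        ENNReal.ofReal (δ₂ / 2) := by
  have hγ := hq.γ_pos
  have hγ' := hq.γ_lt
  have hγα : 0 < q.γ * q.α := mul_pos hq.γ_pos hq.α_pos
  have hγα' : q.γ * q.α < 1 := by nlinarith [hq.α_lt, hq.α_pos]
  have hg : ∀ z, |gain q.γ H f z| ≤ 2 := fun z => abs_weight_mul_le H z (by
    refine (abs_sub _ _).trans ?_
    rw [abs_mul, hf, mul_one, abs_of_pos (half_pos hγ)]
    linarith [abs_label_le z.2])
  by_cases h : expect μ (gain q.γ H f) < q.γ * q.α / 8
  · refine le_trans (prob_mono ?_) ((prob_draws_sum_ge z₀ μ q.n₂ hg h.le (τ := q.γ * q.α / 8)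
      (by linarith) (by linarith)).trans (ENNReal.ofReal_le_ofReal hq.h₂))
    rintro s (⟨-, hs⟩ | ⟨h', -⟩)
    · simp only [Useful, Nat.zero_add] at hs
      rw [show q.γ * q.α / 8 + q.γ * q.α / 8 = q.γ * q.α / 4 by ring]
      exact hs
    · linarith
  · by_cases h' : q.γ * q.α / 2 ≤ expect μ (gain q.γ H f)
    · refine le_trans (prob_mono ?_) ((prob_draws_sum_le z₀ μ q.n₂ hg (m := 3 * (q.γ * q.α) / 8)
        (by linarith) (τ := q.γ * q.α / 8)
        (by linarith) (by linarith)).trans (ENNReal.ofReal_le_ofReal hq.h₂))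
      rintro s (⟨h1, -⟩ | ⟨-, hs⟩)
      · exact absurd h1 h
      · simp only [Useful, Nat.zero_add] at hs
        rw [show 3 * (q.γ * q.α) / 8 - q.γ * q.α / 8 = q.γ * q.α / 4 by ring]
        exact (not_le.1 hs).le
    · refine le_trans (prob_mono (Q' := fun _ => False) ?_) ?_
      · rintro s (⟨h1, -⟩ | ⟨h1, -⟩)
        · exact h h1
        · exact h' h1
      · simp [prob, ev_const]


/-- The defining property of weak learners, in terms of the descriptions which they return. -/
def IsWeakLearner (R : Rep X D) {n₀ : ℕ} (L : Learner (X × Label) n₀ D) (S B : Set (Hyp X))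
    (α γ δ : ℝ) : Prop :=
  ∀ ν, DeterministicLabels S ν → (∃ b ∈ B, α ≤ expect ν fun z => gprod z.2 (b z.1)) →
    prob ((iid ν n₀).bind L) (fun d => expect ν (fun z => z.2 * R.eval d z.1) < γ) ≤
      ENNReal.ofReal δ

/-- If the reweighted distribution has a good benchmark, then rejection sampling is likely to
succeed, and the weak learner is likely to return a model with large gain. -/
theorem ev_trials_bad_le (hq : q.Good δ₂ δ₃ W) (z₀ : X × Label) {μ : PMF (X × Label)}
    {R : Rep X D} {L : Learner (X × Label) q.n₀ D} {S B : Set (Hyp X)}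
    (hL : IsWeakLearner R L S B q.α q.γ δ₁) (hμ : DeterministicLabels S μ) {H : X → ℝ}
    (h : ∃ b ∈ B, q.α < expect μ fun z => weight H z * gprod z.2 (b z.1))
    (pre : ℕ → X × Label) (p : ℕ) :
    ev (draws z₀ μ q.n₁) (fun t => prob (kiter (trial (glue pre p t) H q.n₀) q.n₁ (p, []))
        fun st => st.2.length < q.n₀) ≤ ENNReal.ofReal (δ₂ / 2) ∧
    ev (draws z₀ μ q.n₁) (fun t => ev (kiter (trial (glue pre p t) H q.n₀) q.n₁ (p, []))
        fun st => if st.2.length < q.n₀ then 0 else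
          prob (L fun i => st.2.getD i z₀)
            fun d => expect μ (gain q.γ H fun x => R.eval d x) < q.γ * q.α / 2) ≤
      ENNReal.ofReal δ₁ := by
  obtain ⟨b, hb, hα⟩ := h
  have hgb : ∀ z : X × Label, |gprod z.2 (b z.1)| ≤ 1 :=
    fun z => (abs_gprod_le _ _).trans (abs_label_le z.2)
  -- A large weighted benchmark forces a large total weight, because `y ◇ b ≤ 1`. So rejection
  -- sampling accepts often enough.
  have hM : q.α < expect μ (weight H) := by
    refine hα.trans_le (expect_mono ⟨1, fun z => abs_weight_mul_le H z (hgb z)⟩ (bdd_weight H) ?_)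
    intro z
    nlinarith [(abs_le.1 (hgb z)).2, weight_nonneg H z]
  have hM0 := hq.α_pos.trans hM
  have hM1 : expect μ (weight H) ≤ 1 := expect_le_of_le (bdd_weight H) (weight_le_one H)
  constructor
  · refine (prob_trials_length_lt z₀ μ H q.n₀ hM.le q.n₁ p pre []).trans ?_
    split_ifs
    · refine ENNReal.ofReal_le_ofReal ?_
      simpa using hq.h₁
    · exact zero_le
  · refine (ev_trials_le z₀ μ H q.n₀ hM0 (fun l => prob (L fun i => l.getD i z₀)
      fun d => expect μ (gain q.γ H fun x => R.eval d x) < q.γ * q.α / 2) q.n₁ p q.n₀ pre []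
      (by simp)).trans ?_
    -- Dividing by the total weight, which is at most `1`, only raises the benchmark, so it still
    -- exceeds `α`.
    have hν := hL (reweight μ H hM0) (hμ.reweight H hM0) ⟨b, hb, by
      rw [expect_reweight, le_div_iff₀ hM0]
      nlinarith [hq.α_pos]⟩
    refine le_trans ?_ hν
    rw [prob_bind]
    refine ev_mono fun v => ?_
    have hv : (fun i : Fin q.n₀ => ([] ++ List.ofFn v).getD i z₀) = v := by
      funext i
      simp [List.getD]
    rw [hv]
    -- Contrapositive: correlation `γ` under the reweighted law leaves gain at least `γ / 2 * E[w]`,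
    -- and `E[w] > α`.
    refine prob_mono fun d hd => ?_
    rw [expect_reweight, div_lt_iff₀ hM0]
    have hf : Bdd fun z : X × Label => weight H z * (z.2 * R.eval d z.1) :=
      ⟨1, fun z => abs_weight_mul_le H z (by
        rw [abs_mul, abs_sign, mul_one]; exact abs_label_le z.2)⟩
    have h2 : expect μ (gain q.γ H fun x => R.eval d x) =
        expect μ (fun z => weight H z * (z.2 * R.eval d z.1)) +
          -(q.γ / 2) * expect μ (weight H) := by
      rw [← expect_const_mul, ← expect_add hf ((bdd_weight H).const_mul _)]
      congr with z
      unfold gain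
      ring
    rw [h2] at hd
    nlinarith [hq.γ_pos]

open Classical in
/-- The probability of failure of a call of the weak learner, together with what follows. -/
theorem ev_weakStep_le (hq : q.Good δ₂ δ₃ W) (hδ₁ : 0 < δ₁) (z₀ : X × Label)
    {μ : PMF (X × Label)} {R : Rep X D} {L : Learner (X × Label) q.n₀ D} {S B : Set (Hyp X)}
    (hL : IsWeakLearner R L S B q.α q.γ δ₁) (hμ : DeterministicLabels S μ) (σ : St X)
    (hv : -q.ε ≤ expect μ (edge σ.score)) (T p m : ℕ) (r : ℝ≥0∞)
    (hr : ∀ d, q.γ * q.α / 8 ≤ expect μ (gain q.γ σ.score fun x => R.eval d x) →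
      ∀ pre : ℕ → X × Label, ev (draws z₀ μ m) (fun t =>
        prob (kiter (step q R L z₀ (glue pre (p + q.n₁ + q.n₂) t)) T
          (σ.add q fun x => R.eval d x)) fun τ => ¬ τ.Correct q B μ) ≤ r)
    (pre : ℕ → X × Label) :
    ev (draws z₀ μ (q.n₁ + (q.n₂ + m))) (fun t =>
      prob ((weakStep q R L z₀ (glue pre p t) p σ).bind (kiter (step q R L z₀ (glue pre p t)) T))
        fun τ => ¬ τ.Correct q B μ) ≤ ENNReal.ofReal (δ₁ + δ₂) + r := by
  set H := σ.score with hH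
  set G : Prop := ∃ b ∈ B, q.α < expect μ fun z => weight H z * gprod z.2 (b z.1) with hG
  set J : ℝ≥0∞ := prob (PMF.pure σ.halt) fun τ => ¬ τ.Correct q B μ with hJ
  -- Halting is wrong only if some weighted benchmark exceeds `α`: otherwise the key inequality and
  -- `hv` give the guarantee `α + ε`.
  have hJ1 : J ≤ if G then 1 else 0 := by
    split_ifs with h
    · exact prob_le_one _ _
    · rw [hJ, prob_pure, if_neg]
      rw [not_not]
      refine ⟨rfl, fun b hb => ?_⟩
      have h1 := expect_gprod_sub_le μ H b
      have h2 : expect μ (fun z => weight H z * gprod z.2 (b z.1)) ≤ q.α := by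
        by_contra h'
        exact h ⟨b, hb, not_le.1 h'⟩
      have h3 : expect μ (edge H) = expect μ (fun z => weight H z * (z.2 * sg (H z.1))) := rfl
      change _ ≤ expect μ (fun z => z.2 * sg (H z.1)) + _
      linarith
  have hhalt : ∀ s, kiter (step q R L z₀ s) T σ.halt = PMF.pure σ.halt :=
    fun s => kiter_step_of_halted q R L z₀ s rfl T
  -- Failure probability once the batches and the returned description are fixed: `b` feeds
  -- rejection sampling, `c` the usefulness test, `t` everything later.
  set Y : (ℕ → X × Label) → (ℕ → X × Label) → (ℕ → X × Label) → D → ℝ≥0∞ := fun b c t d =>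
    if Useful q H (fun x => R.eval d x) c 0 then
      prob (kiter (step q R L z₀ (glue (glue (glue pre p b) (p + q.n₁) c) (p + q.n₁ + q.n₂) t)) T
          (σ.add q fun x => R.eval d x)) fun τ => ¬ τ.Correct q B μ
    else J with hY
  have hYd : ∀ b d, ev (draws z₀ μ q.n₂) (fun c => ev (draws z₀ μ m) fun t => Y b c t d) ≤
      (ENNReal.ofReal (δ₂ / 2) + r) + if G ∧
        expect μ (gain q.γ H fun x => R.eval d x) < q.γ * q.α / 2 then 1 else 0 := by
    intro b d
    have hY1 : ∀ c t, Y b c t d ≤ 1 := by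
      intro c t
      simp only [hY]
      split_ifs
      · exact prob_le_one _ _
      · exact prob_le_one _ _
    by_cases h : G ∧ expect μ (gain q.γ H fun x => R.eval d x) < q.γ * q.α / 2
    · rw [if_pos h]
      exact (ev_le_const fun c => ev_le_const fun t => hY1 c t).trans le_add_self
    · rw [if_neg h, add_zero]
      have hu := prob_draws_useful hq z₀ μ H (f := fun x => R.eval d x) fun x => abs_sign _
      -- Outside the error event of the test, an accepted model has true gain at least `γα/8`, so
      -- `hr` applies. A rejected model has gain below `γα/2`; since the exceptional pair of
      -- conditions is excluded, `G` fails and halting is right.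
      refine le_trans (ev_le_prob_add (fun c => ev_le_const fun t => hY1 c t) ?_)
        (add_le_add hu le_rfl)
      intro c hc
      rw [not_or, not_and, not_and, not_not] at hc
      by_cases hcu : Useful q H (fun x => R.eval d x) c 0
      · simp only [hY, hcu, if_true]
        refine hr d ?_ _
        by_contra h'
        exact hc.1 (not_le.1 h') hcu
      · simp only [hY, hcu, if_false, ev_const]
        have hnG : ¬ G := fun hg => hcu (hc.2 (by
          by_contra h'
          exact h ⟨hg, not_le.1 h'⟩))
        rw [if_neg hnG] at hJ1
        exact hJ1.trans zero_le
  set Q : (ℕ → X × Label) → PMF (ℕ × List (X × Label)) := fun b =>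
    kiter (trial (glue pre p b) H q.n₀) q.n₁ (p, []) with hQ
  have hexp : ∀ b c t, prob ((weakStep q R L z₀ (glue pre p (glue b q.n₁ (glue c q.n₂ t))) p σ).bind
      (kiter (step q R L z₀ (glue pre p (glue b q.n₁ (glue c q.n₂ t)))) T))
        (fun τ => ¬ τ.Correct q B μ) = ev (Q b) fun st =>
          if st.2.length < q.n₀ then J else ev (L fun i => st.2.getD i z₀) (Y b c t) := by
    intro b c t
    have h1 : kiter (trial (glue pre p (glue b q.n₁ (glue c q.n₂ t))) σ.score q.n₀) q.n₁ (p, []) =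
        Q b := by
      refine kiter_trial_congr _ _ _ _ _ fun i hi => ?_
      rw [glue_add, glue_add, glue_of_lt _ _ hi]
    rw [weakStep, h1, PMF.bind_bind, prob_bind]
    congr with st
    split_ifs with h2
    · rw [PMF.pure_bind, hhalt]
    · rw [PMF.bind_map, prob_bind]
      congr with d
      simp only [Function.comp_apply, hY]
      have h3 : Useful q H (fun x => R.eval d x) (glue pre p (glue b q.n₁ (glue c q.n₂ t)))
          (p + q.n₁) ↔ Useful q H (fun x => R.eval d x) c 0 := by
        refine useful_congr _ _ _ fun i hi => ?_
        rw [Nat.add_assoc, glue_add, glue_add, glue_of_lt _ _ hi, Nat.zero_add]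
      simp only [← hH, h3]
      split_ifs
      · rw [glue_glue, glue_glue]
      · rw [hhalt]
  rw [ev_draws_add]
  simp only [ev_draws_add, hexp]
  -- The failures that matter only under `G`: a shortage of accepted points, and a weak model of
  -- insufficient gain.
  set e : ℕ × List (X × Label) → ℝ≥0∞ := fun st => (if G ∧ st.2.length < q.n₀ then 1 else 0) +
    if st.2.length < q.n₀ then 0 else prob (L fun i => st.2.getD i z₀) fun d =>
      G ∧ expect μ (gain q.γ H fun x => R.eval d x) < q.γ * q.α / 2 with he
  have hst : ∀ b st, ev (draws z₀ μ q.n₂) (fun c => ev (draws z₀ μ m) fun t =>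
      if st.2.length < q.n₀ then J else ev (L fun i => st.2.getD i z₀) (Y b c t)) ≤
      (ENNReal.ofReal (δ₂ / 2) + r) + e st := by
    intro b st
    by_cases h : st.2.length < q.n₀
    · simp only [h, if_true, ev_const, he, and_true, add_zero]
      exact hJ1.trans le_add_self
    · simp only [h, if_false, he, and_false, zero_add]
      refine (ev_comm₃ _ _ _ _).trans_le ((ev_mono fun d => hYd b d).trans ?_)
      rw [ev_add, ev_const]
      unfold prob
      refine le_of_eq ?_
      congr!
  calc _ ≤ ev (draws z₀ μ q.n₁) fun b => ev (Q b) fun st =>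
        (ENNReal.ofReal (δ₂ / 2) + r) + e st := by
        refine ev_mono fun b => ?_
        -- The trials do not read the later batches, so those can be averaged with the outcome of
        -- the trials fixed.
        exact (ev_comm₃ _ _ _ _).trans_le (ev_mono fun st => hst b st)
    _ = (ENNReal.ofReal (δ₂ / 2) + r) + ev (draws z₀ μ q.n₁) fun b => ev (Q b) e := by
        simp only [ev_add, ev_const]
    _ ≤ (ENNReal.ofReal (δ₂ / 2) + r) + (ENNReal.ofReal (δ₂ / 2) + ENNReal.ofReal δ₁) := by
        gcongr
        by_cases hg : G
        · obtain ⟨h1, h2⟩ := ev_trials_bad_le hq z₀ hL hμ hg pre p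
          simp only [he, hg, true_and, ev_add]
          unfold prob at h1 h2 ⊢
          convert add_le_add h1 h2
        · simp [he, hg, ev_const, prob]
    _ = _ := by
        have := hq.δ₂_pos
        rw [show δ₁ + δ₂ = δ₂ / 2 + δ₂ / 2 + δ₁ by ring, ENNReal.ofReal_add (by positivity) hδ₁.le,
          ENNReal.ofReal_add (by positivity) (by positivity)]
        ring

theorem St.flip_bdd {σ : St X} (h : Bdd σ.score) : Bdd (σ.flip q).score := by
  have : (σ.flip q).score = fun x => σ.score x + -(q.ε / 16) * sg (σ.score x) := by
    funext x
    simp only [St.flip, osc]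
    ring
  rw [this]
  exact h.add (Bdd.const_mul _ ⟨1, fun x => (abs_sg _).le⟩)

theorem St.add_bdd {σ : St X} (h : Bdd σ.score) {f : X → ℝ} (hf : ∀ x, |f x| = 1) :
    Bdd (σ.add q f).score :=
  h.add (Bdd.const_mul _ ⟨1, fun x => (hf x).le⟩)

/-- Induction on the number `T` of remaining steps, with an arbitrary used-up prefix `pre`. The
invariant records the potential already spent. The sample-size equation says that the unread data
are just enough for the remaining edge tests and weak calls, which keeps every batch fresh. -/
theorem prob_not_correct_le (hq : q.Good δ₂ δ₃ W) (hδ₁ : 0 < δ₁) (z₀ : X × Label)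
    {μ : PMF (X × Label)} {R : Rep X D} {L : Learner (X × Label) q.n₀ D} {S B : Set (Hyp X)}
    (hL : IsWeakLearner R L S B q.α q.γ δ₁) (hμ : DeterministicLabels S μ) (T : ℕ) :
    ∀ (σ : St X) (m : ℕ) (pre : ℕ → X × Label), σ.halted = false → Bdd σ.score →
      potential μ σ.score ≤
        1 - σ.weak * (q.γ ^ 2 * q.α / 32) - σ.flips * (q.ε ^ 2 / 128) →
      σ.weak + σ.flips + T = W →
      T * q.n₃ + q.W' * (q.n₁ + q.n₂) = m + σ.weak * (q.n₁ + q.n₂) →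
      ev (draws z₀ μ m) (fun t => prob (kiter (step q R L z₀ (glue pre (σ.pos q) t)) T σ)
        fun τ => ¬ τ.Correct q B μ) ≤
        ENNReal.ofReal (T * δ₃ + (q.W' - σ.weak) * (δ₁ + δ₂)) := by
  have ha₂ : 0 < q.γ ^ 2 * q.α / 32 := by
    have := hq.γ_pos
    have := hq.α_pos
    positivity
  have ha₃ : 0 < q.ε ^ 2 / 128 := by
    have := hq.ε_pos
    positivity
  -- The potential is nonnegative and `W'` weak models would use up more than its initial value. So
  -- the cap on oracle calls is never reached by a state satisfying the invariant.
  have hweak : ∀ σ : St X, potential μ σ.score ≤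
      1 - σ.weak * (q.γ ^ 2 * q.α / 32) - σ.flips * (q.ε ^ 2 / 128) → σ.weak < q.W' := by
    intro σ h
    by_contra h'
    have h1 : (q.W' : ℝ) ≤ σ.weak := by exact_mod_cast not_lt.1 h'
    have h2 : 0 ≤ σ.flips * (q.ε ^ 2 / 128) := by positivity
    nlinarith [potential_nonneg μ σ.score, hq.hW']
  induction T with
  | zero =>
    intro σ m pre _ _ hpot hT _
    -- Without halting, `W` steps contain more than `128 / ε ^ 2` steps towards zero, which would
    -- make the potential negative.
    exfalso
    have h1 := hweak σ hpot
    have h2 : (σ.weak : ℝ) + 1 ≤ q.W' := by exact_mod_cast h1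
    have h3 : (σ.weak : ℝ) + σ.flips = W := by exact_mod_cast hT
    have h4 : 128 / q.ε ^ 2 + 1 ≤ σ.flips := by linarith [hq.hW]
    have h5 : 128 / q.ε ^ 2 * (q.ε ^ 2 / 128) = 1 := by
      have := hq.ε_pos.ne'
      field_simp
    have h6 : 0 ≤ σ.weak * (q.γ ^ 2 * q.α / 32) := by positivity
    nlinarith [potential_nonneg μ σ.score]
  | succ T ih =>
    intro σ m pre hhalt hbdd hpot hT hm
    have hw := hweak σ hpot
    have hw' : (σ.weak : ℝ) + 1 ≤ q.W' := by exact_mod_cast hw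
    have hδ₂ := hq.δ₂_pos
    have hδ₃ := hq.δ₃_pos
    obtain ⟨v, hv⟩ : ∃ v, q.W' = σ.weak + 1 + v := ⟨q.W' - (σ.weak + 1), by omega⟩
    obtain ⟨m', rfl⟩ : ∃ m', m = q.n₃ + m' := by
      refine ⟨T * q.n₃ + (1 + v) * (q.n₁ + q.n₂), ?_⟩
      rw [hv] at hm
      nlinarith
    have hm' : T * q.n₃ + q.W' * (q.n₁ + q.n₂) = m' + σ.weak * (q.n₁ + q.n₂) := by
      rw [Nat.succ_mul] at hm
      omega
    rw [ev_draws_add]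
    have hsum : ENNReal.ofReal ((T + 1 : ℕ) * δ₃ + (q.W' - σ.weak) * (δ₁ + δ₂)) =
        ENNReal.ofReal δ₃ + ENNReal.ofReal (T * δ₃ + (q.W' - σ.weak) * (δ₁ + δ₂)) := by
      rw [← ENNReal.ofReal_add hδ₃.le]
      · congr 1
        push_cast
        ring
      · have : 0 ≤ (q.W' - σ.weak) * (δ₁ + δ₂) := mul_nonneg (by linarith) (by linarith)
        positivity
    rw [hsum]
    -- The error of the edge test is paid for first; afterwards its verdict may be trusted for the
    -- fixed batch `a`.
    refine le_trans (ev_le_prob_add (fun a => ev_le_const fun t => prob_le_one _ _) ?_)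
      (add_le_add (prob_draws_tooLow hq z₀ μ σ.score) le_rfl)
    intro a ha
    rw [not_or, not_and, not_and, not_not] at ha
    simp only [glue_glue]
    set pre' := glue pre (σ.pos q) a with hpre'
    have hlow : ∀ t, TooLow q σ.score (glue pre' (σ.pos q + q.n₃) t) (σ.pos q) ↔
        TooLow q σ.score a 0 := by
      intro t
      refine tooLow_congr _ _ fun i hi => ?_
      rw [glue_of_lt _ _ (by omega), hpre', glue_add, Nat.zero_add]
    by_cases hta : TooLow q σ.score a 0
    · have hk : ∀ t, kiter (step q R L z₀ (glue pre' (σ.pos q + q.n₃) t)) (T + 1) σ =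
          kiter (step q R L z₀ (glue pre' (σ.pos q + q.n₃) t)) T (σ.flip q) := fun t => by
        rw [kiter_succ', step_of_tooLow hhalt ((hlow t).2 hta), PMF.pure_bind]
      simp only [hk]
      have h1 : expect μ (edge σ.score) ≤ -(q.ε / 4) := by
        by_contra h'
        exact ha.1 (not_le.1 h') hta
      have h2 := potential_osc_le μ hbdd hq.ε_pos hq.ε_lt h1
      have hpos : σ.pos q + q.n₃ = (σ.flip q).pos q := by
        simp only [St.pos, St.flip]
        ring
      rw [hpos]
      refine ih (σ.flip q) m' pre' rfl (St.flip_bdd hbdd) ?_ ?_ hm'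
      · refine h2.trans ?_
        simp only [St.flip, Nat.cast_add, Nat.cast_one]
        linarith
      · simp only [St.flip]
        omega
    · have hk : ∀ t, kiter (step q R L z₀ (glue pre' (σ.pos q + q.n₃) t)) (T + 1) σ =
          (weakStep q R L z₀ (glue pre' (σ.pos q + q.n₃) t) (σ.pos q + q.n₃) σ).bind
            (kiter (step q R L z₀ (glue pre' (σ.pos q + q.n₃) t)) T) := fun t => by
        rw [kiter_succ', step_of_not_tooLow hhalt (fun h => hta ((hlow t).1 h)) hw]
      simp only [hk]
      obtain ⟨m'', rfl⟩ : ∃ m'', m' = q.n₁ + (q.n₂ + m'') := by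
        refine ⟨T * q.n₃ + v * (q.n₁ + q.n₂), ?_⟩
        rw [hv] at hm'
        nlinarith
      have hbound : ENNReal.ofReal (T * δ₃ + (q.W' - σ.weak) * (δ₁ + δ₂)) =
          ENNReal.ofReal (δ₁ + δ₂) +
            ENNReal.ofReal (T * δ₃ + (q.W' - (σ.weak + 1 : ℕ)) * (δ₁ + δ₂)) := by
        rw [← ENNReal.ofReal_add (by positivity)]
        · congr 1
          push_cast
          ring
        · have : 0 ≤ (q.W' - (σ.weak + 1 : ℕ)) * (δ₁ + δ₂) :=
            mul_nonneg (by push_cast; linarith) (by linarith)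
          positivity
      rw [hbound]
      refine ev_weakStep_le hq hδ₁ z₀ hL hμ σ ?_ T _ m'' _ ?_ pre'
      · by_contra h'
        exact hta (ha.2 (not_le.1 h'))
      · intro d hd pre''
        have hpos : σ.pos q + q.n₃ + q.n₁ + q.n₂ = (σ.add q fun x => R.eval d x).pos q := by
          simp only [St.pos, St.add]
          ring
        rw [hpos]
        refine ih (σ.add q fun x => R.eval d x) m'' pre'' rfl
          (St.add_bdd hbdd fun x => abs_sign _) ?_ ?_ ?_
        · refine (potential_weak_le μ hbdd (fun x => abs_sign _) hq.γ_pos hq.γ_lt hd).trans ?_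
          simp only [St.add, Nat.cast_add, Nat.cast_one]
          linarith
        · simp only [St.add]
          omega
        · simp only [St.add]
          nlinarith

end algorithm


/-! ### Iterated steps towards zero -/

/-- As long as zero is not crossed the sign stays the same, so the steps simply add up. -/
theorem osc_iterate_of_le {e : ℝ} (he : 0 < e) (r : ℝ) (k : ℕ) (hk : k * e ≤ |r|) :
    (osc e)^[k] r = r - k * e * sg r := by
  induction k with
  | zero => simp
  | succ k ih =>
    push_cast at hk ⊢
    rw [Function.iterate_succ_apply', ih (by linarith)]
    have : sg (r - k * e * sg r) = sg r := by
      unfold sg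
      by_cases h : 0 ≤ r
      · rw [abs_of_nonneg h] at hk
        simp only [h, if_true]
        rw [if_pos (by linarith)]
      · rw [abs_of_neg (not_le.1 h)] at hk
        simp only [h, if_false]
        rw [if_neg (by linarith)]
    rw [osc, this]
    ring

/-- Closer to zero than the step size, a step changes sides and the next one returns: the orbit has
period two. -/
theorem osc_osc {e r : ℝ} (hr : |r| < e) : osc e (osc e r) = r := by
  obtain ⟨h1, h2⟩ := abs_lt.1 hr
  unfold osc sg
  by_cases h : 0 ≤ r
  · rw [if_pos h, if_neg (by linarith)]
    ring
  · rw [if_neg h, if_pos (by linarith)]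
    ring

/-- Iterated steps towards zero can be computed in constant time. -/
theorem osc_iterate {e : ℝ} (he : 0 < e) (r : ℝ) (k j : ℕ) (hj : j = min ⌊|r| / e⌋₊ k) :
    (osc e)^[k] r = if (k - j) % 2 = 1 then osc e (r - j * e * sg r) else r - j * e * sg r := by
  have hj1 : (j : ℝ) * e ≤ |r| := by
    rw [← le_div_iff₀ he]
    refine (Nat.cast_le.2 (hj ▸ min_le_left _ _)).trans (Nat.floor_le (by positivity))
  have hk : k = (k - j) + j := by
    have : j ≤ k := hj ▸ min_le_right _ _
    omega
  conv_lhs => rw [hk, Function.iterate_add_apply, osc_iterate_of_le he r j hj1]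
  rcases Nat.eq_zero_or_pos (k - j) with h0 | h0
  · simp [h0]
  -- If some steps remain, the minimum was the floor, so the remainder is smaller than `e` and only
  -- the parity of `k - j` matters.
  · have hj2 : j = ⌊|r| / e⌋₊ := by omega
    have hsmall : |r - j * e * sg r| < e := by
      have h1 : |r| < (j + 1) * e := by
        rw [← div_lt_iff₀ he, hj2]
        exact Nat.lt_floor_add_one _
      rw [show r - j * e * sg r = (|r| - j * e) * sg r by rw [sub_mul, abs_mul_sg],
        abs_mul, abs_sg, mul_one, abs_of_nonneg (by linarith)]
      linarith
    have h2 : ∀ m, (osc e)^[2 * m] (r - j * e * sg r) = r - j * e * sg r := by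
      intro m
      rw [Function.iterate_mul]
      exact Function.iterate_fixed (osc_osc hsmall) m
    split_ifs with h
    · obtain ⟨m, hm⟩ : ∃ m, k - j = 2 * m + 1 := ⟨(k - j) / 2, by omega⟩
      rw [hm, Function.iterate_succ_apply', h2]
    · obtain ⟨m, hm⟩ : ∃ m, k - j = 2 * m := ⟨(k - j) / 2, by omega⟩
      rw [hm, h2]

/-! ### Deterministic parts of the program

The integer registers `0, …, 6` hold the parameters `n₀, n, W, W', n₁, n₂, n₃`, and the real
registers `0, 1, 2` hold `α, γ, ε`. Register `7` is the index of the next data point, `8` the number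
of weak models, `9` the flag for termination. Slot `j` holds the `j`-th weak model, and the real
register `20 + j` the number of steps towards zero between the models `j - 1` and `j`. The integer
registers from `40` on hold the indices of accepted points. -/

namespace Det

/-- The integer register `k`. -/
abbrev nreg (k : ℕ) : NExp := .mem (.lit k)

/-- The real register `k`. -/
abbrev rreg (k : ℕ) : RExp := .mem (.lit k)

/-- The step size towards zero. -/
abbrev oscSize : RExp := .div (rreg 2) (.ofNat (.lit 16))

/-- Apply steps towards zero to the real register `10`; their number is in the real register
`20 + j`, where `j` is in the integer register `12`. -/
def oscCode : Det :=
  .seq (.floor (.lit 13) (.mem (.add (.lit 20) (nreg 12))))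
  (.seq (.ite (.realLE (.ofNat (.lit 0)) (rreg 10))
    (.seq (.floor (.lit 14) (.div (rreg 10) oscSize))
      (.seq (.ite (.natLE (nreg 14) (nreg 13)) .skip (.setNat (.lit 14) (nreg 13)))
        (.setReal (.lit 10) (.sub (rreg 10) (.mul (.ofNat (nreg 14)) oscSize)))))
    (.seq (.floor (.lit 14) (.div (.sub (.ofNat (.lit 0)) (rreg 10)) oscSize))
      (.seq (.ite (.natLE (nreg 14) (nreg 13)) .skip (.setNat (.lit 14) (nreg 13)))
        (.setReal (.lit 10) (.add (rreg 10) (.mul (.ofNat (nreg 14)) oscSize))))))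
  (.ite (.natLE (.lit 1) (.mod (.sub (nreg 13) (nreg 14)) (.lit 2)))
    (.ite (.realLE (.ofNat (.lit 0)) (rreg 10))
      (.setReal (.lit 10) (.sub (rreg 10) oscSize))
      (.setReal (.lit 10) (.add (rreg 10) oscSize)))
    .skip))

/-- Compute the score of the data point with index in register `7`, in the real register `10`. -/
def scoreCode : Det :=
  .seq (.setReal (.lit 10) (.ofNat (.lit 0)))
  (.seq (.setNat (.lit 12) (.lit 0))
  (.seq oscCode
  (.loop (nreg 8)
    (.seq (.query (.lit 11) (nreg 12) (nreg 7))
    (.seq (.setReal (.lit 10)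
      (.add (rreg 10) (.mul (.div (rreg 1) (.ofNat (.lit 4))) (rreg 11))))
    (.seq (.setNat (.lit 12) (.add (nreg 12) (.lit 1)))
    oscCode))))))

/-- Compute the weight of the data point with index in register `7`, in the real register `12`. -/
def weightCode : Det :=
  .seq (.ite (.realLE (.ofNat (.lit 0)) (.label (nreg 7)))
    (.setReal (.lit 14) (rreg 10))
    (.setReal (.lit 14) (.sub (.ofNat (.lit 0)) (rreg 10))))
  (.ite (.realLE (rreg 14) (.ofNat (.lit 0)))
    (.setReal (.lit 12) (.ofNat (.lit 1)))
    (.setReal (.lit 12) (.div (.ofNat (.lit 1))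
      (.mul (.add (.ofNat (.lit 1)) (rreg 14)) (.add (.ofNat (.lit 1)) (rreg 14))))))

/-- Go to the next data point. -/
def nextCode : Det := .setNat (.lit 7) (.add (nreg 7) (.lit 1))

/-- Sum up the weighted correlations with the current model, in the real register `13`. -/
def edgeCode : Det :=
  .seq (.setReal (.lit 13) (.ofNat (.lit 0)))
  (.loop (nreg 6)
    (.seq scoreCode
    (.seq weightCode
    (.seq (.ite (.realLE (.ofNat (.lit 0)) (rreg 10))
      (.setReal (.lit 13) (.add (rreg 13) (.mul (rreg 12) (.label (nreg 7)))))
      (.setReal (.lit 13) (.sub (rreg 13) (.mul (rreg 12) (.label (nreg 7))))))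
    nextCode))))

/-- Sum up the gains of the new weak model, in the real register `13`. -/
def gainCode : Det :=
  .seq (.setReal (.lit 13) (.ofNat (.lit 0)))
  (.loop (nreg 5)
    (.seq scoreCode
    (.seq weightCode
    (.seq (.query (.lit 11) (nreg 8) (nreg 7))
    (.seq (.setReal (.lit 13) (.add (rreg 13) (.mul (rreg 12)
      (.sub (.mul (.label (nreg 7)) (rreg 11)) (.div (rreg 1) (.ofNat (.lit 2)))))))
    nextCode)))))

end Det

section det
set_option linter.unusedSimpArgs false
variable {X D : Type*} (R : Rep X D)

/-- The score function which is represented by the first `j` weak models in the memory. -/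
def scoreAt (m : Mem D) : ℕ → X → ℝ
  | 0, _ => (osc (m.real 2 / 16))^[⌊m.real 20⌋₊] 0
  | j + 1, x => (osc (m.real 2 / 16))^[⌊m.real (20 + (j + 1))⌋₊]
      (scoreAt m j x + m.real 1 / 4 * (match m.slot j with
        | some d => (R.eval d x : ℝ)
        | none => 0))

theorem scoreAt_congr {m m' : Mem D} (h₁ : m.real 1 = m'.real 1) (h₂ : m.real 2 = m'.real 2)
    (j : ℕ) (x : X) (h₃ : ∀ i ≤ j, m.real (20 + i) = m'.real (20 + i))
    (h₄ : ∀ i < j, m.slot i = m'.slot i) : scoreAt R m j x = scoreAt R m' j x := by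
  induction j with
  | zero =>
    have := h₃ 0 le_rfl
    simp only [Nat.add_zero] at this
    simp only [scoreAt, h₂, this]
  | succ j ih =>
    simp only [scoreAt, h₂, h₁, h₃ (j + 1) le_rfl, h₄ j (Nat.lt_succ_self j),
      ih (fun i hi => h₃ i (by omega)) fun i hi => h₄ i (by omega)]

variable {R} {N : ℕ} {data : Fin N → X × Label}

/-- The configurations `c` and `c'` agree in all registers that are not listed. -/
structure Frame (A B : List ℕ) (c c' : Config D) : Prop where
  nat : ∀ a, a ∉ A → c'.mem.nat a = c.mem.nat a
  real : ∀ a, a ∉ B → c'.mem.real a = c.mem.real a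
  slot : c'.mem.slot = c.mem.slot
  calls : c'.calls = c.calls

theorem Frame.mono {A B A' B' : List ℕ} {c c' : Config D} (h : Frame A B c c')
    (hA : ∀ a ∈ A, a ∈ A') (hB : ∀ a ∈ B, a ∈ B') : Frame A' B' c c' :=
  ⟨fun a ha => h.nat a fun h' => ha (hA a h'), fun a ha => h.real a fun h' => ha (hB a h'),
    h.slot, h.calls⟩

theorem Frame.trans {A B : List ℕ} {c c' c'' : Config D} (h : Frame A B c c')
    (h' : Frame A B c' c'') : Frame A B c c'' :=
  ⟨fun a ha => (h'.nat a ha).trans (h.nat a ha), fun a ha => (h'.real a ha).trans (h.real a ha),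
    h'.slot.trans h.slot, h'.calls.trans h.calls⟩

theorem Frame.of_tick {A B : List ℕ} {k : ℕ} {c c' : Config D} (h : Frame A B (c.tick k) c') :
    Frame A B c c' :=
  ⟨h.nat, h.real, h.slot, h.calls⟩

theorem oscCode_spec (c : Config D) (he : 0 < c.mem.real 2) :
    let c' := Det.oscCode.exec R data c
    c'.mem.real 10 =
      (osc (c.mem.real 2 / 16))^[⌊c.mem.real (20 + c.mem.nat 12)⌋₊] (c.mem.real 10) ∧
    Frame [13, 14] [10] c c' ∧ c'.time ≤ c.time + 100 := by
  obtain ⟨⟨n, r, s⟩, t, k⟩ := c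
  intro c'
  simp only at he
  have he' : 0 < r 2 / 16 := by positivity
  rw [osc_iterate he' (r 10) ⌊r (20 + n 12)⌋₊ _ rfl]
  set K := ⌊r (20 + n 12)⌋₊ with hK
  have hmod : ∀ a : ℕ, 1 ≤ a % 2 ↔ a % 2 = 1 := fun a => by omega
  obtain ⟨j, hj⟩ : ∃ j, j = min ⌊|r 10| / (r 2 / 16)⌋₊ K := ⟨_, rfl⟩
  rw [← hj]
  by_cases h0 : 0 ≤ r 10
  · rw [abs_of_nonneg h0] at hj
    have hs : sg (r 10) = 1 := if_pos h0
    by_cases hle : ⌊r 10 / (r 2 / 16)⌋₊ ≤ K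
    · rw [min_eq_left hle] at hj
      rw [← hj] at hle
      by_cases hp : (K - j) % 2 = 1 <;> by_cases h1 : 0 ≤ r 10 - j * (r 2 / 16) <;>
      refine ⟨?_, ⟨?_, ?_, ?_, ?_⟩, ?_⟩ <;>
      simp +contextual [c', Det.oscCode, Det.exec, Config.setNat, Config.setReal, Config.tick, NExp.val, RExp.val,
          BExp.Holds, NExp.size, RExp.size, BExp.size,
          h0, hle, hp, h1, hs, ← hj, ← hK, hmod, osc, sg]
    · rw [min_eq_right (not_le.1 hle).le] at hj
      refine ⟨?_, ⟨?_, ?_, ?_, ?_⟩, ?_⟩ <;>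
      simp +contextual [c', Det.oscCode, Det.exec, Config.setNat, Config.setReal, Config.tick, NExp.val, RExp.val,
          BExp.Holds, NExp.size, RExp.size, BExp.size,
          h0, hle, hs, hj, ← hK]
  · rw [abs_of_neg (not_le.1 h0)] at hj
    have hs : sg (r 10) = -1 := if_neg h0
    by_cases hle : ⌊-r 10 / (r 2 / 16)⌋₊ ≤ K
    · rw [min_eq_left hle] at hj
      rw [← hj] at hle
      by_cases hp : (K - j) % 2 = 1 <;> by_cases h1 : 0 ≤ r 10 + j * (r 2 / 16) <;>
      refine ⟨?_, ⟨?_, ?_, ?_, ?_⟩, ?_⟩ <;>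
      simp +contextual [c', Det.oscCode, Det.exec, Config.setNat, Config.setReal, Config.tick, NExp.val, RExp.val,
          BExp.Holds, NExp.size, RExp.size, BExp.size,
          h0, hle, hp, h1, hs, ← hj, ← hK, hmod, osc, sg]
    · rw [min_eq_right (not_le.1 hle).le] at hj
      refine ⟨?_, ⟨?_, ?_, ?_, ?_⟩, ?_⟩ <;>
      simp +contextual [c', Det.oscCode, Det.exec, Config.setNat, Config.setReal, Config.tick, NExp.val, RExp.val,
          BExp.Holds, NExp.size, RExp.size, BExp.size,
          h0, hle, hs, hj, ← hK]

variable (R) in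
/-- The memory holds the parameters and a representation of the score function `H`. -/
structure Represents (q : Par) (T : ℕ) (H : X → ℝ) (m : Mem D) : Prop where
  n₀ : m.nat 0 = q.n₀
  W' : m.nat 3 = q.W'
  n₁ : m.nat 4 = q.n₁
  n₂ : m.nat 5 = q.n₂
  n₃ : m.nat 6 = q.n₃
  α : m.real 0 = q.α
  γ : m.real 1 = q.γ
  ε : m.real 2 = q.ε
  ε_pos : 0 < q.ε
  T_pos : 1 ≤ T
  cnt : m.nat 8 ≤ q.W'
  nonneg : ∀ j, 0 ≤ m.real (20 + j)
  slots : ∀ j < m.nat 8, ∃ d, m.slot j = some d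
  time : ∀ j d, m.slot j = some d → ∀ x, R.time d x ≤ T
  score : ∀ x, scoreAt R m (m.nat 8) x = H x

/-- Integer register `7`, those from `9` on and the real registers `3, …, 19` are scratch space:
none of them enters the represented score. -/
theorem Represents.congr {q : Par} {T : ℕ} {H : X → ℝ} {m m' : Mem D}
    (h : Represents R q T H m) (hn : ∀ a, a < 9 → a ≠ 7 → m'.nat a = m.nat a)
    (hr : ∀ a, a < 3 ∨ 20 ≤ a → m'.real a = m.real a) (hs : m'.slot = m.slot) :
    Represents R q T H m' := by
  have h8 := hn 8 (by decide) (by decide)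
  constructor
  · rw [hn 0 (by decide) (by decide), h.n₀]
  · rw [hn 3 (by decide) (by decide), h.W']
  · rw [hn 4 (by decide) (by decide), h.n₁]
  · rw [hn 5 (by decide) (by decide), h.n₂]
  · rw [hn 6 (by decide) (by decide), h.n₃]
  · rw [hr 0 (by decide), h.α]
  · rw [hr 1 (by decide), h.γ]
  · rw [hr 2 (by decide), h.ε]
  · exact h.ε_pos
  · exact h.T_pos
  · rw [h8]
    exact h.cnt
  · intro j
    rw [hr _ (by omega)]
    exact h.nonneg j
  · rw [h8, hs]
    exact h.slots
  · rw [hs]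
    exact h.time
  · intro x
    rw [h8, ← h.score]
    exact scoreAt_congr R (hr 1 (by decide)) (hr 2 (by decide)) _ _ (fun i _ => hr _ (by omega))
      fun i _ => by rw [hs]

theorem Represents.frame {q : Par} {T : ℕ} {H : X → ℝ} {c c' : Config D}
    (h : Represents R q T H c.mem) {A B : List ℕ} (hc : Frame A B c c')
    (hA : ∀ a ∈ A, a = 7 ∨ 9 ≤ a) (hB : ∀ a ∈ B, 3 ≤ a ∧ a < 20) :
    Represents R q T H c'.mem :=
  h.congr (fun a h9 h7 => hc.nat a fun ha => by have := hA a ha; omega)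
    (fun a h20 => hc.real a fun ha => by have := hB a ha; omega) hc.slot

theorem query_exec {c : Config D} {a j i : NExp} {d : D} (hd : c.mem.slot (j.val c.mem) = some d)
    (hi : i.val c.mem < N) :
    (Det.query a j i).exec R data c =
      ((c.setReal (a.val c.mem) (R.eval d (data ⟨i.val c.mem, hi⟩).1 : ℝ)).tick
        (R.time d (data ⟨i.val c.mem, hi⟩).1)).tick (a.size + j.size + i.size + 1) := by
  rw [Det.exec, Config.query, hd]
  simp [hi]

/-- The body of the loop of `Det.scoreCode`. -/
theorem scoreCode_loop (c : Config D) (he : 0 < c.mem.real 2) {d : D}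
    (hd : c.mem.slot (c.mem.nat 12) = some d) (hp : c.mem.nat 7 < N) :
    let c' := (Det.seq (.query (.lit 11) (Det.nreg 12) (Det.nreg 7))
      (.seq (.setReal (.lit 10)
        (.add (Det.rreg 10) (.mul (.div (Det.rreg 1) (.ofNat (.lit 4))) (Det.rreg 11))))
      (.seq (.setNat (.lit 12) (.add (Det.nreg 12) (.lit 1))) Det.oscCode))).exec R data (c.tick 1)
    c'.mem.real 10 = (osc (c.mem.real 2 / 16))^[⌊c.mem.real (20 + (c.mem.nat 12 + 1))⌋₊]
      (c.mem.real 10 + c.mem.real 1 / 4 * R.eval d (data ⟨c.mem.nat 7, hp⟩).1) ∧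
    c'.mem.nat 12 = c.mem.nat 12 + 1 ∧ Frame [12, 13, 14] [10, 11] c c' ∧
    c'.time ≤ c.time + R.time d (data ⟨c.mem.nat 7, hp⟩).1 + 150 := by
  intro c'
  set c₁ := (Det.setNat (.lit 12) (.add (Det.nreg 12) (.lit 1))).exec R data
    ((Det.setReal (.lit 10) (.add (Det.rreg 10)
      (.mul (.div (Det.rreg 1) (.ofNat (.lit 4))) (Det.rreg 11)))).exec R data
      ((Det.query (.lit 11) (Det.nreg 12) (Det.nreg 7)).exec R data (c.tick 1))) with hc₁
  rw [query_exec (c := c.tick 1) (j := Det.nreg 12) (i := Det.nreg 7) hd hp] at hc₁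
  have e : c' = Det.oscCode.exec R data c₁ := by
    rw [hc₁, ← query_exec (c := c.tick 1) (j := Det.nreg 12) (i := Det.nreg 7) hd hp]
    rfl
  have f : Frame [12] [10, 11] c c₁ := by
    constructor <;> simp +contextual [hc₁, Det.exec, Config.setNat, Config.setReal, Config.tick, NExp.val, RExp.val,
          BExp.Holds, NExp.size, RExp.size, BExp.size]
  have h2 : c₁.mem.nat 12 = c.mem.nat 12 + 1 := by
    simp [hc₁, Det.exec, Config.setNat, Config.setReal, Config.tick, NExp.val, RExp.val,
          BExp.Holds, NExp.size, RExp.size, BExp.size]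
  have h3 : c₁.mem.real 10 =
      c.mem.real 10 + c.mem.real 1 / 4 * R.eval d (data ⟨c.mem.nat 7, hp⟩).1 := by
    simp [hc₁, Det.exec, Config.setNat, Config.setReal, Config.tick, NExp.val, RExp.val,
          BExp.Holds, NExp.size, RExp.size, BExp.size]
  have h4 : c₁.time ≤ c.time + R.time d (data ⟨c.mem.nat 7, hp⟩).1 + 50 := by
    simp [hc₁, Det.exec, Config.setNat, Config.setReal, Config.tick, NExp.val, RExp.val,
          BExp.Holds, NExp.size, RExp.size, BExp.size]
    omega
  have hr2 := f.real 2 (by decide)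
  obtain ⟨g1, g2, g3⟩ := oscCode_spec (R := R) (data := data) c₁ (by rw [hr2]; exact he)
  rw [← e] at g1 g2 g3
  refine ⟨?_, ?_, (f.mono (by simp) (by simp)).trans (g2.mono (by simp) (by simp)), by omega⟩
  · rw [g1, h3, hr2, h2, f.real _ (by simp; omega)]
  · rw [g2.nat 12 (by decide), h2]

/-- Each stored weak model costs one query of at most `T` steps and constant overhead, hence a total
proportional to `(W' + 1) * T`; the summand `1` covers the set-up when no model is stored. -/
theorem scoreCode_spec {q : Par} {T : ℕ} {H : X → ℝ} (c : Config D)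
    (h : Represents R q T H c.mem) (hp : c.mem.nat 7 < N) :
    let c' := Det.scoreCode.exec R data c
    c'.mem.real 10 = H (data ⟨c.mem.nat 7, hp⟩).1 ∧ Frame [12, 13, 14] [10, 11] c c' ∧
    c'.time ≤ c.time + 160 * ((q.W' + 1) * T) := by
  intro c'
  have he : 0 < c.mem.real 2 := by
    rw [h.ε]
    exact h.ε_pos
  set x := (data ⟨c.mem.nat 7, hp⟩).1 with hx
  set c₀ := (Det.setNat (.lit 12) (.lit 0)).exec R data
    ((Det.setReal (.lit 10) (.ofNat (.lit 0))).exec R data c) with hc₀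
  have f₀ : Frame [12] [10] c c₀ := by
    constructor <;> simp +contextual [hc₀, Det.exec, Config.setNat, Config.setReal, Config.tick, NExp.val, RExp.val,
          BExp.Holds, NExp.size, RExp.size, BExp.size]
  have h₀ : c₀.mem.nat 12 = 0 ∧ c₀.mem.real 10 = 0 ∧ c₀.time ≤ c.time + 10 := by
    simp [hc₀, Det.exec, Config.setNat, Config.setReal, Config.tick, NExp.val, RExp.val,
          BExp.Holds, NExp.size, RExp.size, BExp.size]
  set c₁ := Det.oscCode.exec R data c₀ with hc₁
  obtain ⟨g1, g2, g3⟩ := oscCode_spec (R := R) (data := data) c₀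
    (by rw [f₀.real 2 (by decide)]; exact he)
  rw [← hc₁] at g1 g2 g3
  have f₁ : Frame [12, 13, 14] [10, 11] c c₁ :=
    (f₀.mono (by simp) (by simp)).trans (g2.mono (by simp) (by simp))
  set F : Config D → Config D := fun c' => (Det.seq (.query (.lit 11) (Det.nreg 12) (Det.nreg 7))
      (.seq (.setReal (.lit 10)
        (.add (Det.rreg 10) (.mul (.div (Det.rreg 1) (.ofNat (.lit 4))) (Det.rreg 11))))
      (.seq (.setNat (.lit 12) (.add (Det.nreg 12) (.lit 1))) Det.oscCode))).exec R data
        (c'.tick 1) with hF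
  have e : c' = F^[c₁.mem.nat 8] (c₁.tick 3) := rfl
  have key : ∀ j ≤ c.mem.nat 8, (F^[j] (c₁.tick 3)).mem.nat 12 = j ∧
      (F^[j] (c₁.tick 3)).mem.real 10 = scoreAt R c.mem j x ∧
      Frame [12, 13, 14] [10, 11] c (F^[j] (c₁.tick 3)) ∧
      (F^[j] (c₁.tick 3)).time ≤ c.time + 113 + j * (T + 150) := by
    intro j
    induction j with
    | zero =>
      intro _
      refine ⟨?_, ?_, ?_, ?_⟩
      · exact (g2.nat 12 (by decide)).trans h₀.1
      · change c₁.mem.real 10 = _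
        rw [g1, h₀.1, h₀.2.1, f₀.real 2 (by decide), f₀.real 20 (by decide)]
        rfl
      · exact ⟨f₁.nat, f₁.real, f₁.slot, f₁.calls⟩
      · change c₁.time + 3 ≤ _
        omega
    | succ j ih =>
      intro hj
      obtain ⟨i1, i2, i3, i4⟩ := ih (by omega)
      rw [Function.iterate_succ_apply']
      set c₂ := F^[j] (c₁.tick 3) with hc₂
      obtain ⟨d, hd⟩ := h.slots j (by omega)
      have h7 := i3.nat 7 (by decide)
      have hd' : c₂.mem.slot (c₂.mem.nat 12) = some d := by rw [i1, i3.slot, hd]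
      obtain ⟨k1, k2, k3, k4⟩ := scoreCode_loop (R := R) (data := data) c₂
        (by rw [i3.real 2 (by decide)]; exact he) hd' (by rw [h7]; exact hp)
      have hx' : (data ⟨c₂.mem.nat 7, by rw [h7]; exact hp⟩).1 = x := by
        simp only [h7, hx]
      rw [hx'] at k1 k4
      refine ⟨?_, ?_, i3.trans k3, ?_⟩
      · rw [← i1]
        exact k2
      · refine k1.trans ?_
        rw [i3.real 2 (by decide), i3.real 1 (by decide), i2, i1, i3.real _ (by simp; omega)]
        simp only [scoreAt, hd]
      · refine k4.trans ?_
        have := h.time j d hd x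
        rw [Nat.succ_mul]
        omega
  have h8 : c₁.mem.nat 8 = c.mem.nat 8 := f₁.nat 8 (by decide)
  rw [e, h8]
  obtain ⟨-, i2, i3, i4⟩ := key _ le_rfl
  refine ⟨by rw [i2, h.score], i3, i4.trans ?_⟩
  have h1 := h.cnt
  have h2 := h.T_pos
  have h3 : c.mem.nat 8 * (T + 150) ≤ q.W' * (151 * T) := Nat.mul_le_mul h1 (by omega)
  have h4 : 160 * ((q.W' + 1) * T) = 160 * (q.W' * T) + 160 * T := by ring
  have h5 : q.W' * (151 * T) = 151 * (q.W' * T) := by ring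
  omega

end det


/-! ### Weights and sample sums computed by the program. -/

section det
set_option linter.unusedSimpArgs false
variable {X D : Type*} {R : Rep X D} {N : ℕ} {data : Fin N → X × Label}

/-- `s` is an infinite continuation of the data. -/
def Continues (s : ℕ → X × Label) (data : Fin N → X × Label) : Prop :=
  ∀ i (h : i < N), data ⟨i, h⟩ = s i

theorem Continues.labelAt {s : ℕ → X × Label} (hs : Continues s data) {i : ℕ} (h : i < N) :
    labelAt data i = (s i).2 := by
  rw [CompLearn.labelAt, dif_pos h, hs i h]

theorem weightCode_spec (c : Config D) :
    let c' := Det.weightCode.exec R data c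
    c'.mem.real 12 = wt (sg (labelAt data (c.mem.nat 7)) * c.mem.real 10) ∧
    Frame [] [12, 14] c c' ∧ c'.time ≤ c.time + 40 := by
  obtain ⟨⟨n, r, s⟩, t, k⟩ := c
  intro c'
  by_cases h : 0 ≤ labelAt data (n 7)
  · have hs : sg (labelAt data (n 7)) = 1 := if_pos h
    by_cases h' : r 10 ≤ 0
    · refine ⟨?_, ⟨?_, ?_, ?_, ?_⟩, ?_⟩ <;>
      simp +contextual [c', Det.weightCode, Det.exec, Config.setNat, Config.setReal, Config.tick, NExp.val, RExp.val,
          BExp.Holds, NExp.size, RExp.size, BExp.size, h, h', hs, wt]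
    · refine ⟨?_, ⟨?_, ?_, ?_, ?_⟩, ?_⟩ <;>
      simp +contextual [c', Det.weightCode, Det.exec, Config.setNat, Config.setReal, Config.tick, NExp.val, RExp.val,
          BExp.Holds, NExp.size, RExp.size, BExp.size, h, h', hs, wt, pow_two]
  · have hs : sg (labelAt data (n 7)) = -1 := if_neg h
    by_cases h' : 0 ≤ r 10
    · refine ⟨?_, ⟨?_, ?_, ?_, ?_⟩, ?_⟩ <;>
      simp +contextual [c', Det.weightCode, Det.exec, Config.setNat, Config.setReal, Config.tick, NExp.val, RExp.val,
          BExp.Holds, NExp.size, RExp.size, BExp.size, h, h', hs, wt]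
    · refine ⟨?_, ⟨?_, ?_, ?_, ?_⟩, ?_⟩ <;>
      simp +contextual [c', Det.weightCode, Det.exec, Config.setNat, Config.setReal, Config.tick, NExp.val, RExp.val,
          BExp.Holds, NExp.size, RExp.size, BExp.size, h, h', hs, wt, pow_two]

theorem scoreCode_weightCode_spec {q : Par} {T : ℕ} {H : X → ℝ} {s : ℕ → X × Label}
    (hs : Continues s data) (c : Config D) (h : Represents R q T H c.mem) (hp : c.mem.nat 7 < N) :
    let c' := Det.weightCode.exec R data (Det.scoreCode.exec R data c)
    c'.mem.real 10 = H (s (c.mem.nat 7)).1 ∧ c'.mem.real 12 = weight H (s (c.mem.nat 7)) ∧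
    Frame [12, 13, 14] [10, 11, 12, 14] c c' ∧
    c'.time ≤ c.time + 160 * ((q.W' + 1) * T) + 40 := by
  intro c'
  obtain ⟨h1, h2, h3⟩ := scoreCode_spec (data := data) c h hp
  obtain ⟨k1, k2, k3⟩ := weightCode_spec (R := R) (data := data) (Det.scoreCode.exec R data c)
  rw [hs _ hp] at h1
  refine ⟨?_, ?_, (h2.mono (by simp) (by simp)).trans (k2.mono (by simp) (by simp)),
    by simp only [c']; omega⟩
  · rw [k2.real 10 (by decide), h1]
  · rw [k1, h1, h2.nat 7 (by decide), hs.labelAt hp]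
    rfl

/-- The body of the loop of `Det.edgeCode`. -/
theorem edgeCode_loop {q : Par} {T : ℕ} {H : X → ℝ} {s : ℕ → X × Label}
    (hs : Continues s data) (c : Config D) (h : Represents R q T H c.mem) (hp : c.mem.nat 7 < N) :
    let c' := (Det.seq .scoreCode (.seq .weightCode
      (.seq (.ite (.realLE (.ofNat (.lit 0)) (Det.rreg 10))
        (.setReal (.lit 13) (.add (Det.rreg 13) (.mul (Det.rreg 12) (.label (Det.nreg 7)))))
        (.setReal (.lit 13) (.sub (Det.rreg 13) (.mul (Det.rreg 12) (.label (Det.nreg 7))))))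
      .nextCode))).exec R data (c.tick 1)
    c'.mem.real 13 = c.mem.real 13 + edge H (s (c.mem.nat 7)) ∧
    c'.mem.nat 7 = c.mem.nat 7 + 1 ∧ Frame [7, 12, 13, 14] [10, 11, 12, 13, 14] c c' ∧
    c'.time ≤ c.time + 300 * ((q.W' + 1) * T) := by
  intro c'
  obtain ⟨h1, h2, h3, h4⟩ := scoreCode_weightCode_spec hs (c.tick 1) h hp
  set c₁ := Det.weightCode.exec R data (Det.scoreCode.exec R data (c.tick 1)) with hc₁
  have e : c' = Det.nextCode.exec R data
      ((Det.ite (.realLE (.ofNat (.lit 0)) (Det.rreg 10))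
        (.setReal (.lit 13) (.add (Det.rreg 13) (.mul (Det.rreg 12) (.label (Det.nreg 7)))))
        (.setReal (.lit 13) (.sub (Det.rreg 13) (.mul (Det.rreg 12) (.label (Det.nreg 7)))))).exec
          R data c₁) := rfl
  have h7 : c₁.mem.nat 7 = c.mem.nat 7 := h3.nat 7 (by decide)
  have h13 : c₁.mem.real 13 = c.mem.real 13 := h3.real 13 (by decide)
  have f₁ : Frame [7, 12, 13, 14] [10, 11, 12, 13, 14] c c₁ :=
    h3.of_tick.mono (by simp) (by simp)
  have hl : labelAt data (c.mem.nat 7) = (s (c.mem.nat 7)).2 := hs.labelAt hp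
  have hU : 1 ≤ (q.W' + 1) * T := Nat.mul_pos (by omega) h.T_pos
  have ht : c₁.time ≤ c.time + 1 + 160 * ((q.W' + 1) * T) + 40 := h4
  have h10 : c₁.mem.real 10 = H (s (c.mem.nat 7)).1 := h1
  have h12 : c₁.mem.real 12 = weight H (s (c.mem.nat 7)) := h2
  by_cases h0 : 0 ≤ H (s (c.mem.nat 7)).1
  · have hsg : sg (H (s (c.mem.nat 7)).1) = 1 := if_pos h0
    refine ⟨?_, ?_, f₁.trans ⟨?_, ?_, ?_, ?_⟩, ?_⟩
    on_goal 7 => refine le_trans (b := c₁.time + 40) ?_ (by omega)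
    all_goals simp +contextual [e, Det.nextCode, Det.exec, Config.setNat, Config.setReal, Config.tick, NExp.val, RExp.val,
          BExp.Holds, NExp.size, RExp.size, BExp.size, h10, h0, hsg, h12, hl, h7, h13, edge]
  · have hsg : sg (H (s (c.mem.nat 7)).1) = -1 := if_neg h0
    refine ⟨?_, ?_, f₁.trans ⟨?_, ?_, ?_, ?_⟩, ?_⟩
    on_goal 7 => refine le_trans (b := c₁.time + 40) ?_ (by omega)
    all_goals simp +contextual [e, Det.nextCode, Det.exec, Config.setNat, Config.setReal, Config.tick, NExp.val, RExp.val,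
          BExp.Holds, NExp.size, RExp.size, BExp.size, h10, h0, hsg, h12, hl, h7, h13, edge,
        sub_eq_add_neg]

/-- The body of the loop of `Det.gainCode`. -/
theorem gainCode_loop {q : Par} {T : ℕ} {H : X → ℝ} {s : ℕ → X × Label}
    (hs : Continues s data) (c : Config D) (h : Represents R q T H c.mem) (hp : c.mem.nat 7 < N)
    {d : D} (hd : c.mem.slot (c.mem.nat 8) = some d) :
    let c' := (Det.seq .scoreCode (.seq .weightCode
      (.seq (.query (.lit 11) (Det.nreg 8) (Det.nreg 7))
      (.seq (.setReal (.lit 13) (.add (Det.rreg 13) (.mul (Det.rreg 12)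
        (.sub (.mul (.label (Det.nreg 7)) (Det.rreg 11)) (.div (Det.rreg 1) (.ofNat (.lit 2)))))))
      .nextCode)))).exec R data (c.tick 1)
    c'.mem.real 13 = c.mem.real 13 + gain q.γ H (fun x => R.eval d x) (s (c.mem.nat 7)) ∧
    c'.mem.nat 7 = c.mem.nat 7 + 1 ∧ Frame [7, 12, 13, 14] [10, 11, 12, 13, 14] c c' ∧
    c'.time ≤ c.time + 300 * ((q.W' + 1) * T) := by
  intro c'
  obtain ⟨h1, h2, h3, h4⟩ := scoreCode_weightCode_spec hs (c.tick 1) h hp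
  set c₁ := Det.weightCode.exec R data (Det.scoreCode.exec R data (c.tick 1)) with hc₁
  have h7 : c₁.mem.nat 7 = c.mem.nat 7 := h3.nat 7 (by decide)
  have hp₁ : c₁.mem.nat 7 < N := h7.trans_lt hp
  have hd₁ : c₁.mem.slot (c₁.mem.nat 8) = some d := by
    rw [h3.slot, h3.nat 8 (by decide)]
    exact hd
  have e : c' = Det.nextCode.exec R data
      ((Det.setReal (.lit 13) (.add (Det.rreg 13) (.mul (Det.rreg 12)
        (.sub (.mul (.label (Det.nreg 7)) (Det.rreg 11)) (.div (Det.rreg 1)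
          (.ofNat (.lit 2))))))).exec R data
        ((Det.query (.lit 11) (Det.nreg 8) (Det.nreg 7)).exec R data c₁)) := rfl
  rw [query_exec (j := Det.nreg 8) (i := Det.nreg 7) hd₁ hp₁] at e
  have h13 : c₁.mem.real 13 = c.mem.real 13 := h3.real 13 (by decide)
  have hγ : c₁.mem.real 1 = q.γ := (h3.real 1 (by decide)).trans h.γ
  have f₁ : Frame [7, 12, 13, 14] [10, 11, 12, 13, 14] c c₁ :=
    h3.of_tick.mono (by simp) (by simp)
  have hl : labelAt data (c.mem.nat 7) = (s (c.mem.nat 7)).2 := hs.labelAt hp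
  have hx : data ⟨c.mem.nat 7, hp⟩ = s (c.mem.nat 7) := hs _ hp
  have hU : T ≤ (q.W' + 1) * T := Nat.le_mul_of_pos_left _ (by omega)
  have hT := h.T_pos
  have htime := h.time _ _ hd (s (c.mem.nat 7)).1
  have ht : c₁.time ≤ c.time + 1 + 160 * ((q.W' + 1) * T) + 40 := h4
  have h12 : c₁.mem.real 12 = weight H (s (c.mem.nat 7)) := h2
  refine ⟨?_, ?_, f₁.trans ⟨?_, ?_, ?_, ?_⟩, ?_⟩
  on_goal 7 =>
    refine le_trans (b := c₁.time + R.time d (s (c.mem.nat 7)).1 + 60) ?_ (by omega)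
  all_goals simp +contextual [e, Det.nextCode, Det.exec, Config.setNat, Config.setReal, Config.tick, NExp.val, RExp.val,
          BExp.Holds, NExp.size, RExp.size, BExp.size, h12, hl, h7, h13, gain, hγ, hx]

theorem edgeCode_spec {q : Par} {T : ℕ} {H : X → ℝ} {s : ℕ → X × Label}
    (hs : Continues s data) (c : Config D) (h : Represents R q T H c.mem)
    (hp : c.mem.nat 7 + q.n₃ ≤ N) :
    let c' := Det.edgeCode.exec R data c
    c'.mem.real 13 = ∑ i ∈ Finset.range q.n₃, edge H (s (c.mem.nat 7 + i)) ∧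
    c'.mem.nat 7 = c.mem.nat 7 + q.n₃ ∧ Frame [7, 12, 13, 14] [10, 11, 12, 13, 14] c c' ∧
    c'.time ≤ c.time + 10 + 300 * ((q.W' + 1) * T) * q.n₃ := by
  intro c'
  set F : Config D → Config D := fun c' => (Det.seq .scoreCode (.seq .weightCode
      (.seq (.ite (.realLE (.ofNat (.lit 0)) (Det.rreg 10))
        (.setReal (.lit 13) (.add (Det.rreg 13) (.mul (Det.rreg 12) (.label (Det.nreg 7)))))
        (.setReal (.lit 13) (.sub (Det.rreg 13) (.mul (Det.rreg 12) (.label (Det.nreg 7))))))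
      .nextCode))).exec R data (c'.tick 1) with hF
  set c₀ := ((Det.setReal (.lit 13) (.ofNat (.lit 0))).exec R data c).tick 3 with hc₀
  have f₀ : Frame [7, 12, 13, 14] [10, 11, 12, 13, 14] c c₀ := by
    constructor <;> simp +contextual [hc₀, Det.exec, Config.setNat, Config.setReal, Config.tick, NExp.val, RExp.val,
          BExp.Holds, NExp.size, RExp.size, BExp.size]
  have h₀ : c₀.mem.nat 7 = c.mem.nat 7 ∧ c₀.mem.real 13 = 0 ∧ c₀.time ≤ c.time + 10 := by
    simp [hc₀, Det.exec, Config.setNat, Config.setReal, Config.tick, NExp.val, RExp.val,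
          BExp.Holds, NExp.size, RExp.size, BExp.size]
  have h6 : c₀.mem.nat 6 = q.n₃ := (f₀.nat 6 (by decide)).trans h.n₃
  have e : c' = F^[c₀.mem.nat 6] c₀ := rfl
  have key : ∀ j ≤ q.n₃, (F^[j] c₀).mem.nat 7 = c.mem.nat 7 + j ∧
      (F^[j] c₀).mem.real 13 = ∑ i ∈ Finset.range j, edge H (s (c.mem.nat 7 + i)) ∧
      Frame [7, 12, 13, 14] [10, 11, 12, 13, 14] c (F^[j] c₀) ∧
      (F^[j] c₀).time ≤ c.time + 10 + 300 * ((q.W' + 1) * T) * j := by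
    intro j
    induction j with
    | zero => exact fun _ => ⟨h₀.1, by simpa using h₀.2.1, f₀, by simpa using h₀.2.2⟩
    | succ j ih =>
      intro hj
      obtain ⟨i1, i2, i3, i4⟩ := ih (by omega)
      rw [Function.iterate_succ_apply']
      obtain ⟨k1, k2, k3, k4⟩ := edgeCode_loop hs (F^[j] c₀)
        (h.frame i3 (by simp) (by simp)) (by omega)
      refine ⟨by rw [k2, i1, Nat.add_assoc], ?_, i3.trans k3, ?_⟩
      · rw [k1, i1, i2, Finset.sum_range_succ]
      · refine k4.trans ?_
        rw [Nat.mul_succ]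
        omega
  obtain ⟨i1, i2, i3, i4⟩ := key _ le_rfl
  rw [e, h6]
  exact ⟨i2, i1, i3, i4⟩

theorem gainCode_spec {q : Par} {T : ℕ} {H : X → ℝ} {s : ℕ → X × Label}
    (hs : Continues s data) (c : Config D) (h : Represents R q T H c.mem)
    (hp : c.mem.nat 7 + q.n₂ ≤ N) {d : D} (hd : c.mem.slot (c.mem.nat 8) = some d) :
    let c' := Det.gainCode.exec R data c
    c'.mem.real 13 =
      ∑ i ∈ Finset.range q.n₂, gain q.γ H (fun x => R.eval d x) (s (c.mem.nat 7 + i)) ∧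
    c'.mem.nat 7 = c.mem.nat 7 + q.n₂ ∧ Frame [7, 12, 13, 14] [10, 11, 12, 13, 14] c c' ∧
    c'.time ≤ c.time + 10 + 300 * ((q.W' + 1) * T) * q.n₂ := by
  intro c'
  set F : Config D → Config D := fun c' => (Det.seq .scoreCode (.seq .weightCode
      (.seq (.query (.lit 11) (Det.nreg 8) (Det.nreg 7))
      (.seq (.setReal (.lit 13) (.add (Det.rreg 13) (.mul (Det.rreg 12)
        (.sub (.mul (.label (Det.nreg 7)) (Det.rreg 11)) (.div (Det.rreg 1) (.ofNat (.lit 2)))))))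
      .nextCode)))).exec R data (c'.tick 1) with hF
  set c₀ := ((Det.setReal (.lit 13) (.ofNat (.lit 0))).exec R data c).tick 3 with hc₀
  have f₀ : Frame [7, 12, 13, 14] [10, 11, 12, 13, 14] c c₀ := by
    constructor <;> simp +contextual [hc₀, Det.exec, Config.setNat, Config.setReal, Config.tick, NExp.val, RExp.val,
          BExp.Holds, NExp.size, RExp.size, BExp.size]
  have h₀ : c₀.mem.nat 7 = c.mem.nat 7 ∧ c₀.mem.real 13 = 0 ∧ c₀.time ≤ c.time + 10 := by
    simp [hc₀, Det.exec, Config.setNat, Config.setReal, Config.tick, NExp.val, RExp.val,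
          BExp.Holds, NExp.size, RExp.size, BExp.size]
  have h5 : c₀.mem.nat 5 = q.n₂ := (f₀.nat 5 (by decide)).trans h.n₂
  have e : c' = F^[c₀.mem.nat 5] c₀ := rfl
  have key : ∀ j ≤ q.n₂, (F^[j] c₀).mem.nat 7 = c.mem.nat 7 + j ∧
      (F^[j] c₀).mem.real 13 =
        ∑ i ∈ Finset.range j, gain q.γ H (fun x => R.eval d x) (s (c.mem.nat 7 + i)) ∧
      Frame [7, 12, 13, 14] [10, 11, 12, 13, 14] c (F^[j] c₀) ∧
      (F^[j] c₀).time ≤ c.time + 10 + 300 * ((q.W' + 1) * T) * j := by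
    intro j
    induction j with
    | zero => exact fun _ => ⟨h₀.1, by simpa using h₀.2.1, f₀, by simpa using h₀.2.2⟩
    | succ j ih =>
      intro hj
      obtain ⟨i1, i2, i3, i4⟩ := ih (by omega)
      rw [Function.iterate_succ_apply']
      obtain ⟨k1, k2, k3, k4⟩ := gainCode_loop hs (F^[j] c₀)
        (h.frame i3 (by simp) (by simp)) (by omega) (d := d)
        (by rw [i3.slot, i3.nat 8 (by decide), hd])
      refine ⟨by rw [k2, i1, Nat.add_assoc], ?_, i3.trans k3, ?_⟩
      · rw [k1, i1, i2, Finset.sum_range_succ]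
      · refine k4.trans ?_
        rw [Nat.mul_succ]
        omega
  obtain ⟨i1, i2, i3, i4⟩ := key _ le_rfl
  rw [e, h5]
  exact ⟨i2, i1, i3, i4⟩

end det


/-! ### The boosting program -/

namespace Det

/-- If the coin shows `1`, keep the current data point. In any case go to the next one. -/
def acceptCode : Det :=
  .seq (.ite (.and (.natLE (.lit 1) (nreg 11)) (.natLE (.add (nreg 10) (.lit 1)) (nreg 0)))
    (.seq (.setNat (.add (.lit 40) (nreg 10)) (nreg 7))
      (.setNat (.lit 10) (.add (nreg 10) (.lit 1))))
    .skip)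
  nextCode

/-- Raise the flag for termination. -/
def haltCode : Det := .setNat (.lit 9) (.lit 1)

/-- Take one more step towards zero. -/
def flipCode : Det :=
  .setReal (.add (.lit 20) (nreg 8)) (.add (.mem (.add (.lit 20) (nreg 8))) (.ofNat (.lit 1)))

/-- Add the model in the first free slot. -/
def addCode : Det :=
  .seq (.setNat (.lit 8) (.add (nreg 8) (.lit 1)))
    (.setReal (.add (.lit 20) (nreg 8)) (.ofNat (.lit 0)))

/-- Add the model in the first free slot if it is useful. -/
def testCode : Det :=
  .seq gainCode (.ite (.realLE (.mul (.ofNat (nreg 5))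
    (.div (.mul (rreg 1) (rreg 0)) (.ofNat (.lit 4)))) (rreg 13)) addCode haltCode)

/-- The evaluation program. -/
def evalCode : Det :=
  .seq (.setNat (.lit 7) (.lit 0)) (.seq scoreCode
    (.ite (.realLE (.ofNat (.lit 0)) (rreg 10)) (.setNat (.lit 0) (.lit 1))
      (.setNat (.lit 0) (.lit 0))))

end Det

namespace Prog
open Det

/-- One trial of rejection sampling. -/
def trialCode : Prog :=
  .seq (.det (.seq .scoreCode .weightCode)) (.seq (.flip (.lit 11) (rreg 12)) (.det acceptCode))

/-- Rejection sampling. -/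
def trialsCode : Prog := .seq (.det (.setNat (.lit 10) (.lit 0))) (.loop (nreg 4) trialCode)

/-- Call the weak learner. -/
def weakCode : Prog :=
  .seq trialsCode (.ite (.natLE (nreg 0) (nreg 10))
    (.seq (.call (nreg 8) (.lit 40)) (.det testCode)) (.det haltCode))

/-- One step of the boosting algorithm. -/
def stepCode : Prog :=
  .ite (.natLE (nreg 9) (.lit 0))
    (.seq (.det edgeCode)
      (.ite (.realLE (rreg 13) (.mul (.ofNat (nreg 6))
          (.sub (.ofNat (.lit 0)) (.div (rreg 2) (.ofNat (.lit 2))))))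
        (.det flipCode)
        (.ite (.natLE (nreg 3) (nreg 8)) (.det haltCode) weakCode)))
    (.det .skip)

/-- The boosting program. -/
def boostCode : Prog := .loop (nreg 2) stepCode

end Prog

/-! ### The program simulates rejection sampling. -/

section sim
set_option linter.unusedSimpArgs false
variable {X D : Type*} {R : Rep X D} {q : Par} {T : ℕ} {H : X → ℝ}

/-- The candidate model goes into the first free slot. The score reads only slots below the counter,
so a rejected candidate can stay there. -/
theorem Represents.setSlot {m : Mem D} (h : Represents R q T H m) {d : D}
    (hd : ∀ x, R.time d x ≤ T) :
    Represents R q T H { m with slot := Function.update m.slot (m.nat 8) (some d) } := by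
  refine ⟨h.n₀, h.W', h.n₁, h.n₂, h.n₃, h.α, h.γ, h.ε, h.ε_pos, h.T_pos, h.cnt, h.nonneg, ?_, ?_, ?_⟩
  · intro j hj
    obtain ⟨d', hd'⟩ := h.slots j hj
    exact ⟨d', by simpa [Function.update_of_ne (show j ≠ m.nat 8 by simp at hj; omega)] using hd'⟩
  · intro j d' hd'
    by_cases hj : j = m.nat 8
    · subst hj
      simp only [Function.update_self, Option.some.injEq] at hd'
      exact hd' ▸ hd
    · simp only [Function.update_of_ne hj] at hd'
      exact h.time j d' hd'
  · intro x
    rw [← h.score]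
    refine scoreAt_congr (m := { m with slot := Function.update m.slot (m.nat 8) (some d) })
      (m' := m) R rfl rfl (m.nat 8) x (fun _ _ => rfl) fun i hi => ?_
    exact Function.update_of_ne (by omega) _ _

theorem Represents.add {m : Mem D} (h : Represents R q T H m) {d : D}
    (hd : m.slot (m.nat 8) = some d) (hw : m.nat 8 < q.W') :
    Represents R q T (fun x => H x + q.γ / 4 * R.eval d x)
      { m with
        nat := Function.update m.nat 8 (m.nat 8 + 1)
        real := Function.update m.real (20 + (m.nat 8 + 1)) 0 } := by
  have hr : ∀ a, a < 20 ∨ a < 20 + (m.nat 8 + 1) →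
      Function.update m.real (20 + (m.nat 8 + 1)) 0 a = m.real a :=
    fun a ha => Function.update_of_ne (by omega) _ _
  refine ⟨h.n₀, h.W', h.n₁, h.n₂, h.n₃, ?_, ?_, ?_, h.ε_pos, h.T_pos, ?_, ?_, ?_, h.time, ?_⟩
  · exact (hr 0 (by omega)).trans h.α
  · exact (hr 1 (by omega)).trans h.γ
  · exact (hr 2 (by omega)).trans h.ε
  · simp only [Function.update_self]
    omega
  · intro j
    simp only [Function.update_apply]
    split_ifs
    · exact le_rfl
    · exact h.nonneg j
  · intro j hj
    simp only [Function.update_self] at hj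
    by_cases hj' : j = m.nat 8
    · exact ⟨d, hj' ▸ hd⟩
    · exact h.slots j (by omega)
  · intro x
    simp only [Function.update_self, scoreAt, hd, Nat.floor_zero, Function.iterate_zero, id]
    rw [hr 1 (by omega), h.γ, ← h.score]
    congr 1
    exact scoreAt_congr R (hr 1 (by omega)) (hr 2 (by omega)) _ _ (fun i hi => hr _ (by omega))
      fun _ _ => rfl

theorem Represents.flip {m : Mem D} (h : Represents R q T H m) :
    Represents R q T (fun x => osc (q.ε / 16) (H x))
      { m with
        real := Function.update m.real (20 + m.nat 8) (m.real (20 + m.nat 8) + 1) } := by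
  have hr : ∀ a, a < 20 + m.nat 8 →
      Function.update m.real (20 + m.nat 8) (m.real (20 + m.nat 8) + 1) a = m.real a :=
    fun a ha => Function.update_of_ne (by omega) _ _
  refine ⟨h.n₀, h.W', h.n₁, h.n₂, h.n₃, ?_, ?_, ?_, h.ε_pos, h.T_pos, h.cnt, ?_, h.slots, h.time, ?_⟩
  · exact (hr 0 (by omega)).trans h.α
  · exact (hr 1 (by omega)).trans h.γ
  · exact (hr 2 (by omega)).trans h.ε
  · intro j
    simp only [Function.update_apply]
    split_ifs
    · linarith [h.nonneg (m.nat 8)]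
    · exact h.nonneg j
  · intro x
    have hn := h.nonneg (m.nat 8)
    rw [← h.score, ← h.ε]
    cases h8 : m.nat 8 with
    | zero =>
      rw [h8] at hn
      simp only [h8, scoreAt, Nat.add_zero, Function.update_self,
        Function.update_of_ne (show 2 ≠ 20 by decide)]
      -- The step count sits in a real register. Its nonnegativity is part of the invariant so that
      -- adding `1` adds `1` to the floor.
      rw [Nat.floor_add_one hn, Function.iterate_succ_apply']
    | succ j =>
      rw [h8] at hn hr
      simp only [h8, scoreAt, Function.update_self]
      rw [Nat.floor_add_one hn, Function.iterate_succ_apply', hr 1 (by omega), hr 2 (by omega)]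
      rw [scoreAt_congr (m := { m with
          real := Function.update m.real (20 + (j + 1)) (m.real (20 + (j + 1)) + 1) })
        (m' := m) R (hr 1 (by omega)) (hr 2 (by omega)) j x
        (fun i hi => hr _ (by omega)) fun _ _ => rfl]

variable {N : ℕ} {data : Fin N → X × Label} {s : ℕ → X × Label}

/-- The relation between configurations and abstract states after `i` trials. -/
structure TrialInv (R : Rep X D) (q : Par) (T N : ℕ) (H : X → ℝ) (s : ℕ → X × Label)
    (c₀ : Config D) (i : ℕ) (c : Config D) (st : ℕ × List (X × Label)) : Prop where
  rep : Represents R q T H c.mem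
  cnt : c.mem.nat 8 = c₀.mem.nat 8
  flag : c.mem.nat 9 = c₀.mem.nat 9
  calls : c.calls = c₀.calls
  pos : c.mem.nat 7 = c₀.mem.nat 7 + i
  pos' : st.1 = c₀.mem.nat 7 + i
  len : c.mem.nat 10 = st.2.length
  acc : ∀ j < st.2.length, c.mem.nat (40 + j) < N ∧ st.2[j]? = some (s (c.mem.nat (40 + j)))
  time : c.time ≤ c₀.time + 20 + 300 * ((q.W' + 1) * T) * i

/-- The invariant is assumed with an arbitrary clock `t`: when the coin has been flipped, the score
computation has already been paid for in `c.time`, and `ht` carries the new time budget separately.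
-/
theorem acceptCode_spec {c₀ c : Config D} {i : ℕ} {st : ℕ × List (X × Label)} {t : ℕ}
    (h : TrialInv R q T N H s c₀ i { c with time := t } st) (hp : c.mem.nat 7 < N)
    (ht : c.time + 60 ≤ c₀.time + 20 + 300 * ((q.W' + 1) * T) * (i + 1)) (r : Bool) {b : ℕ}
    (hb : 1 ≤ b ↔ r = true) :
    TrialInv R q T N H s c₀ (i + 1) (Det.acceptCode.exec R data ((c.setNat 11 b).tick 4))
      (st.1 + 1, if r = true ∧ st.2.length < q.n₀ then st.2 ++ [s st.1] else st.2) := by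
  have hlen : c.mem.nat 10 = st.2.length := h.len
  have h0 : c.mem.nat 0 = q.n₀ := h.rep.n₀
  have h7 : c.mem.nat 7 = c₀.mem.nat 7 + i := h.pos
  set c' := Det.acceptCode.exec R data ((c.setNat 11 b).tick 4) with hc'
  have hreal : c'.mem.real = c.mem.real := by
    simp only [hc', Det.acceptCode, Det.nextCode, Det.exec]
    split_ifs <;> rfl
  have hslot : c'.mem.slot = c.mem.slot := by
    simp only [hc', Det.acceptCode, Det.nextCode, Det.exec]
    split_ifs <;> rfl
  have hcalls : c'.calls = c.calls := by
    simp only [hc', Det.acceptCode, Det.nextCode, Det.exec]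
    split_ifs <;> rfl
  have htime : c'.time ≤ c.time + 60 := by
    simp only [hc', Det.acceptCode, Det.nextCode, Det.exec]
    split_ifs <;> simp [Prog.exec, Det.exec, Config.setNat, Config.setReal, Config.tick, NExp.val, RExp.val,
          BExp.Holds, NExp.size, RExp.size, BExp.size]
  have hnat : c'.mem.nat = if r = true ∧ st.2.length < q.n₀ then
      Function.update (Function.update (Function.update (Function.update c.mem.nat 11 b)
        (40 + st.2.length) (c.mem.nat 7)) 10 (st.2.length + 1)) 7 (c.mem.nat 7 + 1)
      else Function.update (Function.update c.mem.nat 11 b) 7 (c.mem.nat 7 + 1) := by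
    -- The list of accepted indices begins at register `40`, away from all working registers.
    have n1 : 7 ≠ 40 + st.2.length := by omega
    have n2 : 10 ≠ 40 + st.2.length := by omega
    rw [← hlen] at n1 n2
    have hB : (1 ≤ b ∧ c.mem.nat 10 + 1 ≤ c.mem.nat 0) ↔ (r = true ∧ st.2.length < q.n₀) := by
      rw [hb, h0, hlen, Nat.succ_le_iff]
    simp only [hc', Det.acceptCode, Det.nextCode, Det.exec]
    by_cases hr : r = true ∧ st.2.length < q.n₀
    · rw [if_pos hr, if_pos (by simpa [Prog.exec, Det.exec, Config.setNat, Config.setReal, Config.tick, NExp.val, RExp.val,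
          BExp.Holds, NExp.size, RExp.size, BExp.size] using hB.2 hr), ← hlen]
      simp [Prog.exec, Det.exec, Config.setNat, Config.setReal, Config.tick, NExp.val, RExp.val,
          BExp.Holds, NExp.size, RExp.size, BExp.size, n1, n2]
    · rw [if_neg hr, if_neg (by simpa [Prog.exec, Det.exec, Config.setNat, Config.setReal, Config.tick, NExp.val, RExp.val,
          BExp.Holds, NExp.size, RExp.size, BExp.size] using mt hB.1 hr)]
      simp [Prog.exec, Det.exec, Config.setNat, Config.setReal, Config.tick, NExp.val, RExp.val,
          BExp.Holds, NExp.size, RExp.size, BExp.size]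
  have hrep : Represents R q T H c'.mem := by
    refine h.rep.congr (fun a ha ha' => ?_) (fun a _ => by rw [hreal]) hslot
    rw [hnat]
    have h1 : a ≠ 11 := by omega
    have h2 : a ≠ 10 := by omega
    have h3 : a ≠ 40 + st.2.length := by omega
    split_ifs <;> simp [h1, h2, h3, ha']
  have h8 : c'.mem.nat 8 = c.mem.nat 8 := by
    rw [hnat]
    have h3 : 8 ≠ 40 + st.2.length := by omega
    split_ifs <;> simp [h3]
  have h9 : c'.mem.nat 9 = c.mem.nat 9 := by
    rw [hnat]
    have h3 : 9 ≠ 40 + st.2.length := by omega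
    split_ifs <;> simp [h3]
  refine ⟨hrep, h8.trans h.cnt, h9.trans h.flag, hcalls.trans h.calls, ?_, ?_, ?_, ?_,
    htime.trans ht⟩
  · rw [hnat, ← Nat.add_assoc, ← h7]
    split_ifs <;> simp
  · rw [← Nat.add_assoc, ← h.pos']
  · rw [hnat]
    split_ifs <;> simp [hlen]
  · rw [hnat]
    intro j hj
    have n1 : 40 + j ≠ 7 := by omega
    have n2 : 40 + j ≠ 10 := by omega
    have n3 : 40 + j ≠ 11 := by omega
    split_ifs at hj ⊢ with hr
    · rw [Function.update_of_ne n1, Function.update_of_ne n2]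
      by_cases hj' : j = st.2.length
      · rw [hj', Function.update_self]
        refine ⟨hp, ?_⟩
        simp [h.pos', h7]
      · have hj2 : j < st.2.length := by
          simp only [List.length_append, List.length_singleton] at hj
          omega
        rw [Function.update_of_ne (by omega), Function.update_of_ne n3,
          List.getElem?_append_left hj2]
        exact h.acc j hj2
    · rw [Function.update_of_ne n1, Function.update_of_ne n3]
      exact h.acc j hj

theorem trialCode_coupled {L : Learner (X × Label) q.n₀ D} (hs : Continues s data)
    {c₀ c : Config D} {i : ℕ} {st : ℕ × List (X × Label)}
    (h : TrialInv R q T N H s c₀ i c st) (hp : c.mem.nat 7 < N) :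
    Coupled (Prog.trialCode.exec R L data (c.tick 1)) (trial s H q.n₀ st)
      (TrialInv R q T N H s c₀ (i + 1)) := by
  obtain ⟨h1, h2, h3, h4⟩ := scoreCode_weightCode_spec hs (c.tick 1) h.rep hp
  set c₁ := Det.weightCode.exec R data (Det.scoreCode.exec R data (c.tick 1)) with hc₁
  have e : Prog.trialCode.exec R L data (c.tick 1) = (coin (c₁.mem.real 12)).map fun r =>
      Det.acceptCode.exec R data ((c₁.setNat 11 (if r = true then 1 else 0)).tick 4) := by
    have : Prog.trialCode.exec R L data (c.tick 1) = (PMF.pure c₁).bind fun c₂ =>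
        ((coin (c₂.mem.real 12)).map fun r => (c₂.setNat 11 (if r = true then 1 else 0)).tick 4).bind
          fun c₃ => PMF.pure (Det.acceptCode.exec R data c₃) := rfl
    rw [this, PMF.pure_bind, PMF.bind_map]
    exact PMF.bind_pure_comp _ _
  have h7 : c₁.mem.nat 7 = c.mem.nat 7 := h3.nat 7 (by decide)
  have hw : c₁.mem.real 12 = weight H (s st.1) := by
    rw [h2, h.pos', ← h.pos]
    rfl
  rw [e, hw, trial]
  -- Both processes flip a coin of the same bias; the coupling lets them share its outcome.
  refine Coupled.map fun r _ => acceptCode_spec (t := c.time) ?_ (h7.trans_lt hp) ?_ r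
    (by cases r <;> simp)
  · refine ⟨(h.rep.frame h3.of_tick (by simp) (by simp) : Represents R q T H c₁.mem), ?_, ?_, ?_, ?_, h.pos', ?_, ?_, h.time⟩
    · exact (h3.nat 8 (by decide)).trans h.cnt
    · exact (h3.nat 9 (by decide)).trans h.flag
    · exact h3.calls.trans h.calls
    · exact h7.trans h.pos
    · exact (h3.nat 10 (by decide)).trans h.len
    · intro j hj
      have : c₁.mem.nat (40 + j) = c.mem.nat (40 + j) := h3.nat _ (by simp; omega)
      simp only [this]
      exact h.acc j hj
  · have ht : c₁.time ≤ c.time + 1 + 160 * ((q.W' + 1) * T) + 40 := h4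
    have := h.time
    have hU : 1 ≤ (q.W' + 1) * T := Nat.mul_pos (by omega) h.rep.T_pos
    rw [Nat.mul_succ]
    omega

theorem trialsCode_coupled {L : Learner (X × Label) q.n₀ D} (hs : Continues s data)
    {c : Config D} (h : Represents R q T H c.mem) (hp : c.mem.nat 7 + q.n₁ ≤ N) :
    Coupled (Prog.trialsCode.exec R L data c)
      (kiter (trial s H q.n₀) q.n₁ (c.mem.nat 7, [])) (TrialInv R q T N H s c q.n₁) := by
  set c₀ := ((c.setNat 10 0).tick 3).tick 3 with hc₀
  have e : Prog.trialsCode.exec R L data c =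
      kiter (fun c' => Prog.trialCode.exec R L data (c'.tick 1)) (c₀.mem.nat 4) c₀ := by
    have : Prog.trialsCode.exec R L data c = (PMF.pure ((c.setNat 10 0).tick 3)).bind fun c' =>
        kiter (fun c' => Prog.trialCode.exec R L data (c'.tick 1)) (c'.mem.nat 4) (c'.tick 3) := rfl
    rw [this, PMF.pure_bind]
    rfl
  have h4 : c₀.mem.nat 4 = q.n₁ := by
    simpa [hc₀, Prog.exec, Det.exec, Config.setNat, Config.setReal, Config.tick, NExp.val, RExp.val,
          BExp.Holds, NExp.size, RExp.size, BExp.size] using h.n₁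
  rw [e, h4]
  refine Coupled.kiter (R := TrialInv R q T N H s c) ?_ ?_
  · constructor
    · refine h.congr (fun a ha ha' => ?_) (fun a _ => ?_) ?_
      · simp [hc₀, Prog.exec, Det.exec, Config.setNat, Config.setReal, Config.tick, NExp.val, RExp.val,
          BExp.Holds, NExp.size, RExp.size, BExp.size, show a ≠ 10 by omega]
      · simp [hc₀, Prog.exec, Det.exec, Config.setNat, Config.setReal, Config.tick, NExp.val, RExp.val,
          BExp.Holds, NExp.size, RExp.size, BExp.size]
      · simp [hc₀, Prog.exec, Det.exec, Config.setNat, Config.setReal, Config.tick, NExp.val, RExp.val,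
          BExp.Holds, NExp.size, RExp.size, BExp.size]
    all_goals simp [hc₀, Prog.exec, Det.exec, Config.setNat, Config.setReal, Config.tick, NExp.val, RExp.val,
          BExp.Holds, NExp.size, RExp.size, BExp.size]
  · intro i hi c' st hc'
    exact trialCode_coupled hs hc' (by rw [hc'.pos]; omega)

end sim


/-! ### The program simulates the boosting algorithm. -/

section sim
set_option linter.unusedSimpArgs false
variable {X D : Type*} {R : Rep X D} {q : Par} {T N : ℕ} {data : Fin N → X × Label}
  {s : ℕ → X × Label}

theorem Represents.halt {H : X → ℝ} {c : Config D} (h : Represents R q T H c.mem) :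
    Represents R q T H (Det.haltCode.exec R data c).mem :=
  h.congr (fun a ha _ => by simp [Det.haltCode, Prog.exec, Det.exec, Config.setNat, Config.setReal, Config.tick, NExp.val, RExp.val,
          BExp.Holds, NExp.size, RExp.size, BExp.size, show a ≠ 9 by omega])
    (fun _ _ => rfl) rfl

theorem addCode_mem (c : Config D) :
    (Det.addCode.exec R data c).mem = { c.mem with
      nat := Function.update c.mem.nat 8 (c.mem.nat 8 + 1)
      real := Function.update c.mem.real (20 + (c.mem.nat 8 + 1)) 0 } := by
  simp [Det.addCode, Prog.exec, Det.exec, Config.setNat, Config.setReal, Config.tick, NExp.val, RExp.val,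
          BExp.Holds, NExp.size, RExp.size, BExp.size]

/-- The relation between configurations and states after a call of the weak learner; `c₀` and `σ`
are the configuration and the state before it. -/
structure WeakInv (R : Rep X D) (q : Par) (T N : ℕ) (c₀ : Config D) (σ : St X)
    (c : Config D) (τ : St X) : Prop where
  rep : Represents R q T τ.score c.mem
  flag : c.mem.nat 9 = if τ.halted = true then 1 else 0
  active : τ.halted = false → c.mem.nat 8 = τ.weak ∧ c.mem.nat 7 = c₀.mem.nat 7 + q.n₁ + q.n₂ ∧
    c.calls = τ.weak ∧ τ.weak = σ.weak + 1 ∧ τ.flips = σ.flips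
  calls : c.calls ≤ q.W'
  pos : c.mem.nat 7 ≤ N
  time : c.time + 500 * ((q.W' + 1) * T) * c₀.mem.nat 7 ≤
    c₀.time + 500 * ((q.W' + 1) * T) * c.mem.nat 7 + 200

theorem testCode_spec (hs : Continues s data) {σ : St X} {c₀ c : Config D} {d : D}
    (h : Represents R q T σ.score c.mem) (h8 : c.mem.nat 8 = σ.weak) (h9 : c.mem.nat 9 = 0)
    (hd : c.mem.slot (c.mem.nat 8) = some d)
    (hcalls : c.calls = σ.weak + 1) (hw : σ.weak < q.W') (h7 : c.mem.nat 7 = c₀.mem.nat 7 + q.n₁)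
    (hp : c.mem.nat 7 + q.n₂ ≤ N) (hn : q.n₀ ≤ q.n₁)
    (ht : c.time ≤ c₀.time + 50 + 300 * ((q.W' + 1) * T) * q.n₁ + q.n₀) [Decidable
      (Useful q σ.score (fun x => R.eval d x) s (c₀.mem.nat 7 + q.n₁))] :
    WeakInv R q T N c₀ σ (Det.testCode.exec R data c)
      (if Useful q σ.score (fun x => R.eval d x) s (c₀.mem.nat 7 + q.n₁) then
        σ.add q fun x => R.eval d x else σ.halt) := by
  obtain ⟨k1, k2, k3, k4⟩ := gainCode_spec hs c h hp hd
  have hu : Useful q σ.score (fun x => R.eval d x) s (c₀.mem.nat 7 + q.n₁) ↔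
      q.n₂ * (q.γ * q.α / 4) ≤ (Det.gainCode.exec R data c).mem.real 13 := by
    rw [Useful, k1, h7]
  set c₁ := Det.gainCode.exec R data c with hc₁
  have hrep : Represents R q T σ.score c₁.mem := h.frame k3 (by simp) (by simp)
  have h8' : c₁.mem.nat 8 = σ.weak := (k3.nat 8 (by decide)).trans h8
  have h9' : c₁.mem.nat 9 = 0 := (k3.nat 9 (by decide)).trans h9
  have hcalls' : c₁.calls = σ.weak + 1 := k3.calls.trans hcalls
  have hd' : c₁.mem.slot (c₁.mem.nat 8) = some d := by
    rw [k3.slot, k3.nat 8 (by decide), hd]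
  have e : Det.testCode.exec R data c = if
      Useful q σ.score (fun x => R.eval d x) s (c₀.mem.nat 7 + q.n₁) then
        Det.addCode.exec R data (c₁.tick 16) else Det.haltCode.exec R data (c₁.tick 16) := by
    rw [Det.testCode, Det.exec, Det.exec]
    have : (BExp.realLE (.mul (.ofNat (Det.nreg 5)) (.div (.mul (Det.rreg 1) (Det.rreg 0))
        (.ofNat (.lit 4)))) (Det.rreg 13)).Holds data c₁.mem ↔
        Useful q σ.score (fun x => R.eval d x) s (c₀.mem.nat 7 + q.n₁) := by
      rw [hu]
      simp [Prog.exec, Det.exec, Config.setNat, Config.setReal, Config.tick, NExp.val, RExp.val,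
          BExp.Holds, NExp.size, RExp.size, BExp.size, hrep.n₂, hrep.γ, hrep.α]
    simp only [← hc₁, this]
    congr 1
  -- Reading the oracle's input takes `n₀ ≤ n₁` time steps, which are charged to the `n₁` points of
  -- the trials.
  have hU : q.n₁ ≤ (q.W' + 1) * T * q.n₁ :=
    Nat.le_mul_of_pos_left _ (Nat.mul_pos (by omega) h.T_pos)
  have htime : c₁.time + 60 + 500 * ((q.W' + 1) * T) * c₀.mem.nat 7 ≤
      c₀.time + 500 * ((q.W' + 1) * T) * c₁.mem.nat 7 + 200 := by
    rw [k2, h7, Nat.mul_add, Nat.mul_add]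
    simp only [Nat.mul_assoc] at *
    omega
  rw [e]
  split_ifs with hus
  · constructor
    · rw [addCode_mem]
      exact Represents.add (m := c₁.mem) hrep hd' (h8'.trans_lt hw)
    · simpa [addCode_mem, St.add, Config.tick] using h9'
    · intro _
      refine ⟨?_, ?_, ?_, rfl, rfl⟩
      · simp [addCode_mem, St.add, Config.tick, h8']
      · simp [addCode_mem, Config.tick, k2, h7]
      · exact hcalls'
    · change c₁.calls ≤ _
      omega
    · simp only [addCode_mem, Config.tick]
      rw [Function.update_of_ne (by decide), k2]
      exact hp
    · have h1 : (Det.addCode.exec R data (c₁.tick 16)).mem.nat 7 = c₁.mem.nat 7 := by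
        simp [addCode_mem, Config.tick]
      rw [h1]
      refine le_trans (Nat.add_le_add_right ?_ _) htime
      simp [Det.addCode, Prog.exec, Det.exec, Config.setNat, Config.setReal, Config.tick, NExp.val, RExp.val,
          BExp.Holds, NExp.size, RExp.size, BExp.size]
  · constructor
    · exact Represents.halt (c := c₁.tick 16) hrep
    · rfl
    · exact fun h => absurd h (by simp [St.halt])
    · change c₁.calls ≤ _
      omega
    · change c₁.mem.nat 7 ≤ N
      rw [k2]
      exact hp
    · change _ ≤ c₀.time + 500 * ((q.W' + 1) * T) * c₁.mem.nat 7 + 200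
      refine le_trans (Nat.add_le_add_right ?_ _) htime
      simp [Det.haltCode, Prog.exec, Det.exec, Config.setNat, Config.setReal, Config.tick, NExp.val, RExp.val,
          BExp.Holds, NExp.size, RExp.size, BExp.size]

theorem call_exec {n₀ : ℕ} {L : Learner (X × Label) n₀ D} {c : Config D} {j b : ℕ}
    (h : ∀ i : Fin n₀, c.mem.nat (b + i) < N) :
    c.call L data j b = (L fun i => data ⟨c.mem.nat (b + i), h i⟩).map fun d =>
      { mem := { c.mem with slot := Function.update c.mem.slot j (some d) }
        time := c.time + n₀
        calls := c.calls + 1 } := by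
  rw [Config.call, dif_pos h]

theorem weakCode_coupled {L : Learner (X × Label) q.n₀ D} (hs : Continues s data)
    (hT : ∀ z, ∀ d ∈ (L z).support, ∀ x, R.time d x ≤ T) (z₀ : X × Label) {σ : St X}
    {c : Config D} (h : Represents R q T σ.score c.mem) (h8 : c.mem.nat 8 = σ.weak)
    (h9 : c.mem.nat 9 = 0) (hcalls : c.calls = σ.weak) (hw : σ.weak < q.W')
    (hp : c.mem.nat 7 + q.n₁ + q.n₂ ≤ N) (hn : q.n₀ ≤ q.n₁) :
    Coupled (Prog.weakCode.exec R L data c) (weakStep q R L z₀ s (c.mem.nat 7) σ)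
      (WeakInv R q T N c σ) := by
  classical
  have e : Prog.weakCode.exec R L data c = (Prog.trialsCode.exec R L data c).bind
      ((Prog.ite (.natLE (Det.nreg 0) (Det.nreg 10))
        (.seq (.call (Det.nreg 8) (.lit 40)) (.det .testCode)) (.det .haltCode)).exec R L data) :=
    rfl
  rw [e, weakStep]
  refine (trialsCode_coupled hs h (by omega)).bind fun c₁ st hc₁ => ?_
  have hU : q.n₁ ≤ (q.W' + 1) * T * q.n₁ :=
    Nat.le_mul_of_pos_left _ (Nat.mul_pos (by omega) h.T_pos)
  have htime := hc₁.time
  have hcond : (BExp.natLE (Det.nreg 0) (Det.nreg 10)).Holds data c₁.mem ↔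
      ¬ st.2.length < q.n₀ := by
    simp [BExp.Holds, NExp.val, hc₁.len, hc₁.rep.n₀]
  rw [Prog.exec]
  by_cases hlt : st.2.length < q.n₀
  · rw [if_neg (by rw [hcond]; simpa using hlt), if_pos hlt]
    refine Coupled.pure ?_
    constructor
    · exact Represents.halt (c := c₁.tick _) hc₁.rep
    · rfl
    · exact fun h => absurd h (by simp [St.halt])
    · change c₁.calls ≤ _
      rw [hc₁.calls]
      omega
    · change c₁.mem.nat 7 ≤ N
      rw [hc₁.pos]
      omega
    · change _ ≤ c.time + 500 * ((q.W' + 1) * T) * c₁.mem.nat 7 + 200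
      rw [hc₁.pos, Nat.mul_add]
      simp only [Det.haltCode, Prog.exec, Det.exec, Config.setNat, Config.setReal, Config.tick, NExp.val, RExp.val,
          BExp.Holds, NExp.size, RExp.size, BExp.size]
      simp only [Nat.mul_assoc] at *
      omega
  · rw [if_pos (hcond.2 hlt), if_neg hlt]
    set c₂ := c₁.tick ((BExp.natLE (Det.nreg 0) (Det.nreg 10)).size + 1) with hc₂
    have hacc : ∀ i : Fin q.n₀, c₂.mem.nat (40 + i) < N := fun i =>
      (hc₁.acc i (by omega)).1
    have hv : (fun i : Fin q.n₀ => data ⟨c₂.mem.nat (40 + i), hacc i⟩) =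
        fun i : Fin q.n₀ => st.2.getD i z₀ := by
      funext i
      rw [hs, List.getD_eq_getElem?_getD, (hc₁.acc i (by omega)).2]
      rfl
    have e₂ : (Prog.seq (.call (Det.nreg 8) (.lit 40)) (.det .testCode)).exec R L data c₂ =
        (L fun i => st.2.getD i z₀).map fun d => Det.testCode.exec R data
          { mem := { c₂.mem with slot := Function.update c₂.mem.slot (c₂.mem.nat 8) (some d) }
            time := c₂.time + q.n₀ + 4
            calls := c₂.calls + 1 } := by
      have : (Prog.seq (.call (Det.nreg 8) (.lit 40)) (.det .testCode)).exec R L data c₂ =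
          ((c₂.call L data (c₂.mem.nat 8) 40).map (Config.tick 4)).bind
            fun c => PMF.pure (Det.testCode.exec R data c) := rfl
      rw [this, call_exec hacc, hv, PMF.map_comp, PMF.bind_map]
      exact PMF.bind_pure_comp _ _
    rw [e₂]
    -- Both sides call `L` on the same points, so they can share the returned description.
    refine Coupled.map fun d hd => ?_
    refine testCode_spec hs ?_ ?_ ?_ ?_ ?_ hw ?_ ?_ hn ?_
    · exact Represents.setSlot (m := c₂.mem) hc₁.rep (hT _ d hd)
    · exact hc₁.cnt.trans h8
    · exact hc₁.flag.trans h9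
    · exact Function.update_self _ _ _
    · change c₁.calls + 1 = _
      rw [hc₁.calls, hcalls]
    · exact hc₁.pos
    · change c₁.mem.nat 7 + q.n₂ ≤ N
      rw [hc₁.pos]
      exact hp
    · change c₁.time + _ + q.n₀ + 4 ≤ _
      simp only [BExp.size, NExp.size]
      omega

/-- The relation between configurations and states after `i` steps of the boosting algorithm. -/
structure StepInv (R : Rep X D) (q : Par) (T N : ℕ) (i : ℕ) (c : Config D) (σ : St X) : Prop where
  rep : Represents R q T σ.score c.mem
  flag : c.mem.nat 9 = if σ.halted = true then 1 else 0
  active : σ.halted = false → c.mem.nat 8 = σ.weak ∧ c.mem.nat 7 = σ.pos q ∧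
    c.calls = σ.weak ∧ σ.weak + σ.flips = i
  calls : c.calls ≤ q.W'
  pos : c.mem.nat 7 ≤ N
  time : c.time ≤ 20 + 500 * ((q.W' + 1) * T) * (c.mem.nat 7 + i)

theorem flipCode_mem (c : Config D) :
    (Det.flipCode.exec R data c).mem = { c.mem with
      real := Function.update c.mem.real (20 + c.mem.nat 8)
        (c.mem.real (20 + c.mem.nat 8) + 1) } := by
  simp [Det.flipCode, Prog.exec, Det.exec, Config.setNat, Config.setReal, Config.tick, NExp.val, RExp.val,
          BExp.Holds, NExp.size, RExp.size, BExp.size]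

/-- Amortized timing: every data point consumed pays `500 * ((W' + 1) * T)`, and every step pays the
same once more for its constant overhead. Register `7` therefore serves both as a data pointer and
as a clock. -/
theorem stepCode_coupled {L : Learner (X × Label) q.n₀ D} (hs : Continues s data)
    (hT : ∀ z, ∀ d ∈ (L z).support, ∀ x, R.time d x ≤ T) (z₀ : X × Label) {σ : St X}
    {c : Config D} {i W : ℕ} (hi : i < W) (hN : W * q.n₃ + q.W' * (q.n₁ + q.n₂) ≤ N)
    (hn : q.n₀ ≤ q.n₁) (h : StepInv R q T N i c σ) :
    Coupled (Prog.stepCode.exec R L data (c.tick 1)) (step q R L z₀ s σ)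
      (StepInv R q T N (i + 1)) := by
  classical
  have htime := h.time
  have hU : 1 ≤ (q.W' + 1) * T := Nat.mul_pos (by omega) h.rep.T_pos
  set U := (q.W' + 1) * T with hUdef
  have hmul : ∀ a b : ℕ, 500 * U * (a + (b + 1)) = 500 * U * (a + b) + 500 * U :=
    fun a b => by ring
  have hmul' : ∀ a b n : ℕ, 500 * U * (a + n + (b + 1)) =
      500 * U * (a + b) + 500 * (U * n) + 500 * U := fun a b n => by ring
  rw [Prog.stepCode, Prog.exec, step]
  cases hhalt : σ.halted with
  | true =>
    have hflag : c.mem.nat 9 = 1 := by rw [h.flag, if_pos hhalt]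
    rw [if_neg (by simp [BExp.Holds, NExp.val, Config.tick, hflag]), if_pos rfl]
    refine Coupled.pure ⟨h.rep, h.flag, fun h' => absurd h' (by simp [hhalt]), h.calls, h.pos, ?_⟩
    -- A halted machine idles without reading data; this is why the iteration number enters the time
    -- bound.
    change c.time + 1 + _ + 1 ≤ 20 + 500 * U * (c.mem.nat 7 + (i + 1))
    rw [hmul]
    simp only [BExp.size, NExp.size]
    omega
  | false =>
    obtain ⟨h8, h7, hcalls, hsum⟩ := h.active hhalt
    have hflag : c.mem.nat 9 = 0 := by rw [h.flag, if_neg (by simp [hhalt])]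
    rw [if_pos (by simp [BExp.Holds, NExp.val, Config.tick, hflag]), if_neg (by simp)]
    set c₀ := (c.tick 1).tick ((BExp.natLE (Det.nreg 9) (.lit 0)).size + 1) with hc₀
    have hn₃ : c.mem.nat 7 + q.n₃ ≤ N := by
      rw [h7, St.pos]
      have h1 : (σ.weak + σ.flips + 1) * q.n₃ ≤ W * q.n₃ := Nat.mul_le_mul_right _ (by omega)
      have h2 : σ.weak * (q.n₁ + q.n₂) ≤ q.W' * (q.n₁ + q.n₂) :=
        Nat.mul_le_mul_right _ (by rw [← h8]; exact h.rep.cnt)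
      rw [Nat.add_mul (σ.weak + σ.flips) 1] at h1
      omega
    obtain ⟨k1, k2, k3, k4⟩ := edgeCode_spec hs c₀ h.rep hn₃
    set c₁ := Det.edgeCode.exec R data c₀ with hc₁
    have h7₁ : c₁.mem.nat 7 = σ.pos q + q.n₃ := by
      rw [k2, ← h7]
      rfl
    have ht₁ : c₁.time ≤ c.time + 20 + 300 * U * q.n₃ := by
      refine k4.trans ?_
      change c.time + 1 + _ + 10 + 300 * U * q.n₃ ≤ _
      simp only [BExp.size, NExp.size]
      omega
    have hrep : Represents R q T σ.score c₁.mem :=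
      Represents.frame (c := c₀) h.rep k3 (by simp) (by simp)
    have h8₁ : c₁.mem.nat 8 = σ.weak := (k3.nat 8 (by decide)).trans h8
    have h9₁ : c₁.mem.nat 9 = 0 := (k3.nat 9 (by decide)).trans hflag
    have hcalls₁ : c₁.calls = σ.weak := k3.calls.trans hcalls
    have hp₁ : c₁.mem.nat 7 ≤ N := by
      rw [h7₁, ← h7]
      exact hn₃
    have e : (Prog.seq (.det .edgeCode) (.ite (.realLE (Det.rreg 13) (.mul (.ofNat (Det.nreg 6))
          (.sub (.ofNat (.lit 0)) (.div (Det.rreg 2) (.ofNat (.lit 2))))))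
        (.det .flipCode)
        (.ite (.natLE (Det.nreg 3) (Det.nreg 8)) (.det .haltCode) .weakCode))).exec R L data c₀ =
        (Prog.ite (.realLE (Det.rreg 13) (.mul (.ofNat (Det.nreg 6))
          (.sub (.ofNat (.lit 0)) (.div (Det.rreg 2) (.ofNat (.lit 2))))))
        (.det .flipCode)
        (.ite (.natLE (Det.nreg 3) (Det.nreg 8)) (.det .haltCode) .weakCode)).exec R L data c₁ :=
      PMF.pure_bind _ _
    have hcond : (BExp.realLE (Det.rreg 13) (.mul (.ofNat (Det.nreg 6))
          (.sub (.ofNat (.lit 0)) (.div (Det.rreg 2) (.ofNat (.lit 2)))))).Holds data c₁.mem ↔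
        TooLow q σ.score s (σ.pos q) := by
      have : c₀.mem.nat 7 = σ.pos q := h7
      rw [TooLow, ← this, ← k1]
      simp [BExp.Holds, NExp.val, RExp.val, hrep.n₃, hrep.ε]
    rw [e, Prog.exec]
    have h3n : 300 * U * q.n₃ ≤ 500 * (U * q.n₃) := by
      rw [Nat.mul_assoc]
      omega
    by_cases hlow : TooLow q σ.score s (σ.pos q)
    · rw [if_pos (hcond.2 hlow), if_pos hlow]
      refine Coupled.pure ?_
      constructor
      · rw [flipCode_mem]
        exact Represents.flip (m := c₁.mem) hrep
      · simpa [flipCode_mem, Config.tick, St.flip] using h9₁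
      · intro _
        refine ⟨?_, ?_, ?_, ?_⟩
        · simpa [flipCode_mem, Config.tick, St.flip] using h8₁
        · rw [flipCode_mem]
          refine h7₁.trans ?_
          simp only [St.flip, St.pos]
          ring
        · exact hcalls₁
        · simp only [St.flip]
          omega
      · change c₁.calls ≤ _
        rw [hcalls₁, ← hcalls]
        exact h.calls
      · rw [flipCode_mem]
        exact hp₁
      · have : (Det.flipCode.exec R data (c₁.tick ((BExp.realLE (Det.rreg 13)
            (.mul (.ofNat (Det.nreg 6))
            (.sub (.ofNat (.lit 0)) (.div (Det.rreg 2) (.ofNat (.lit 2)))))).size + 1))).mem.nat 7 =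
              c.mem.nat 7 + q.n₃ := by
          rw [flipCode_mem, h7]
          exact h7₁
        rw [this, ← hUdef, hmul']
        simp only [Det.flipCode, Prog.exec, Det.exec, Config.setNat, Config.setReal, Config.tick, NExp.val, RExp.val,
          BExp.Holds, NExp.size, RExp.size, BExp.size]
        omega
    · rw [if_neg (by rw [hcond]; exact hlow), if_neg hlow]
      set c₂ := c₁.tick ((BExp.realLE (Det.rreg 13) (.mul (.ofNat (Det.nreg 6))
          (.sub (.ofNat (.lit 0)) (.div (Det.rreg 2) (.ofNat (.lit 2)))))).size + 1) with hc₂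
      have ht₂ : c₂.time ≤ c₁.time + 20 := by
        simp [hc₂, Config.tick, BExp.size, RExp.size, NExp.size]
      have hcond₂ : (BExp.natLE (Det.nreg 3) (Det.nreg 8)).Holds data c₂.mem ↔ q.W' ≤ σ.weak := by
        have h1 : c₂.mem.nat 3 = q.W' := hrep.W'
        have h2 : c₂.mem.nat 8 = σ.weak := h8₁
        simp [BExp.Holds, NExp.val, h1, h2]
      rw [Prog.exec]
      by_cases hw : q.W' ≤ σ.weak
      · rw [if_pos (hcond₂.2 hw), if_pos hw]
        refine Coupled.pure ?_
        constructor
        · exact Represents.halt (c := c₂.tick _) hrep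
        · rfl
        · exact fun h => absurd h (by simp [St.halt])
        · change c₁.calls ≤ _
          rw [hcalls₁, ← hcalls]
          exact h.calls
        · exact hp₁
        · change _ ≤ 20 + 500 * U * (c₁.mem.nat 7 + (i + 1))
          rw [h7₁, ← h7, hmul']
          change c₂.time + _ + _ ≤ _
          simp only [BExp.size, NExp.size]
          omega
      · rw [if_neg (by rw [hcond₂]; exact hw), if_neg hw]
        rw [not_le] at hw
        set c₃ := c₂.tick ((BExp.natLE (Det.nreg 3) (Det.nreg 8)).size + 1) with hc₃
        have h7₃ : c₃.mem.nat 7 = σ.pos q + q.n₃ := h7₁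
        have hp₃ : c₃.mem.nat 7 + q.n₁ + q.n₂ ≤ N := by
          rw [h7₃, St.pos]
          have h1 : (σ.weak + σ.flips + 1) * q.n₃ ≤ W * q.n₃ := Nat.mul_le_mul_right _ (by omega)
          have h2 : (σ.weak + 1) * (q.n₁ + q.n₂) ≤ q.W' * (q.n₁ + q.n₂) :=
            Nat.mul_le_mul_right _ hw
          rw [Nat.add_mul _ 1] at h1 h2
          omega
        have ht₃ : c₃.time ≤ c₂.time + 10 := by
          simp [hc₃, Config.tick, BExp.size, NExp.size]
        rw [← h7₃]
        refine (weakCode_coupled hs hT z₀ (c := c₃) hrep h8₁ h9₁ hcalls₁ hw hp₃ hn).mono ?_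
        intro c' τ hc'
        refine ⟨hc'.rep, hc'.flag, ?_, hc'.calls, hc'.pos, ?_⟩
        · intro hτ
          obtain ⟨j1, j2, j3, j4, j5⟩ := hc'.active hτ
          refine ⟨j1, ?_, j3, by omega⟩
          rw [j2, h7₃, St.pos, St.pos, j4, j5]
          ring
        · have ht := hc'.time
          rw [h7₃, ← h7, Nat.mul_add, ← hUdef] at ht
          rw [← hUdef, hmul, Nat.mul_add]
          rw [Nat.mul_add] at htime
          have h5 : 500 * U * q.n₃ = 500 * (U * q.n₃) := Nat.mul_assoc _ _ _
          omega

theorem boostCode_coupled {L : Learner (X × Label) q.n₀ D} (hs : Continues s data)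
    (hT : ∀ z, ∀ d ∈ (L z).support, ∀ x, R.time d x ≤ T) (z₀ : X × Label) {c : Config D}
    {W : ℕ} (hN : W * q.n₃ + q.W' * (q.n₁ + q.n₂) ≤ N)
    (hn : q.n₀ ≤ q.n₁) (hW : c.mem.nat 2 = W)
    (hrep : Represents R q T (fun _ => 0) c.mem) (h7 : c.mem.nat 7 = 0) (h8 : c.mem.nat 8 = 0)
    (h9 : c.mem.nat 9 = 0) (hcalls : c.calls = 0) (htime : c.time = 0) :
    Coupled (Prog.boostCode.exec R L data c) (kiter (step q R L z₀ s) W ⟨fun _ => 0, 0, 0, false⟩)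
      (StepInv R q T N W) := by
  have e : Prog.boostCode.exec R L data c =
      kiter (fun c' => Prog.stepCode.exec R L data (c'.tick 1)) (c.mem.nat 2) (c.tick 3) := rfl
  rw [e, hW]
  refine Coupled.kiter (R := StepInv R q T N) ?_ fun i hi c' σ hc' =>
    stepCode_coupled hs hT z₀ hi hN hn hc'
  refine ⟨hrep, h9, fun _ => ⟨h8, ?_, hcalls, rfl⟩, ?_, ?_, ?_⟩
  · change c.mem.nat 7 = _
    rw [h7]
    simp [St.pos]
  · change c.calls ≤ _
    omega
  · change c.mem.nat 7 ≤ _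
    omega
  · change c.time + 3 ≤ _
    omega

end sim

/-! ### The evaluation program computes the sign of the score. -/

section eval
set_option linter.unusedSimpArgs false
variable {X D : Type*} {R : Rep X D} {q : Par} {T : ℕ} {H : X → ℝ}

theorem evalCode_spec {m : Mem D} (h : Represents R q T H m) (x : X) :
    ((Det.evalCode.rep R).eval m x : ℝ) = sg (H x) ∧
      (Det.evalCode.rep R).time m x ≤ 200 * ((q.W' + 1) * T) := by
  set z : X × Label := (x, ⟨0, by norm_num, by norm_num⟩) with hz
  set data : Fin 1 → X × Label := fun _ => z with hdata
  set c₀ : Config D := (Config.setNat 7 0 ⟨m, 0, 0⟩).tick 3 with hc₀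
  have h7 : c₀.mem.nat 7 = 0 := by simp [hc₀, Config.setNat, Config.tick]
  have hrep : Represents R q T H c₀.mem :=
    h.congr (fun a _ ha => by simp [hc₀, Config.setNat, Config.tick, ha]) (fun _ _ => rfl) rfl
  obtain ⟨k1, k2, k3⟩ := scoreCode_spec (data := data) c₀ hrep (by omega)
  set c₁ := Det.scoreCode.exec R data c₀ with hc₁
  have e : Det.evalCode.evalRun R m x = (Det.ite (.realLE (.ofNat (.lit 0)) (Det.rreg 10))
      (.setNat (.lit 0) (.lit 1)) (.setNat (.lit 0) (.lit 0))).exec R data c₁ := rfl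
  have k1' : c₁.mem.real 10 = H x := k1
  have hU : 1 ≤ (q.W' + 1) * T := Nat.mul_pos (by omega) h.T_pos
  have ht : c₁.time ≤ 3 + 160 * ((q.W' + 1) * T) := by
    simpa [hc₀, Config.tick, Config.setNat] using k3
  constructor
  · have e' : (Det.evalCode.evalRun R m x).mem.nat 0 = if 0 ≤ H x then 1 else 0 := by
      rw [e, Det.exec]
      by_cases h0 : 0 ≤ H x
      · rw [if_pos (by simpa [BExp.Holds, NExp.val, RExp.val, k1'] using h0), if_pos h0]
        simp [Prog.exec, Det.exec, Config.setNat, Config.setReal, Config.tick, NExp.val, RExp.val,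
          BExp.Holds, NExp.size, RExp.size, BExp.size]
      · rw [if_neg (by simpa [BExp.Holds, NExp.val, RExp.val, k1'] using h0), if_neg h0]
        simp [Prog.exec, Det.exec, Config.setNat, Config.setReal, Config.tick, NExp.val, RExp.val,
          BExp.Holds, NExp.size, RExp.size, BExp.size]
    simp only [Det.rep, e', sg]
    by_cases h0 : 0 ≤ H x <;> simp [h0]
  · change (Det.evalCode.evalRun R m x).time ≤ _
    refine le_trans (b := c₁.time + 20) ?_ (by omega)
    rw [e, Det.exec]
    split_ifs <;> simp [Prog.exec, Det.exec, Config.setNat, Config.setReal, Config.tick, NExp.val, RExp.val,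
          BExp.Holds, NExp.size, RExp.size, BExp.size]

end eval


/-! ### Choice of the parameters -/

section parameters

/-- Lets the logarithmic factors absorb the rounding of batch sizes to integers. -/
theorem one_le_logb_one_div {x : ℝ} (h₀ : 0 < x) (h₁ : x < 1 / 2) : 1 ≤ Real.logb 2 (1 / x) := by
  rw [Real.le_logb_iff_rpow_le one_lt_two (by positivity), Real.rpow_one, le_div_iff₀ h₀]
  linarith

theorem neg_log_le_logb_one_div {x : ℝ} (h₀ : 0 < x) (h₁ : x < 1 / 2) :
    -Real.log x ≤ Real.logb 2 (1 / x) := by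
  have h2 : 0 < Real.log 2 := Real.log_pos one_lt_two
  have h3 : Real.log 2 < 1 := Real.log_two_lt_d9.trans (by norm_num)
  rw [Real.logb, one_div, Real.log_inv, le_div_iff₀ h2]
  nlinarith [Real.log_neg h₀ (by linarith)]

theorem neg_log_half_le {x : ℝ} (h₀ : 0 < x) (h₁ : x < 1 / 2) :
    -Real.log (x / 2) ≤ 2 * Real.logb 2 (1 / x) := by
  have h3 : Real.log 2 < 1 := Real.log_two_lt_d9.trans (by norm_num)
  rw [Real.log_div h₀.ne' two_ne_zero]
  linarith [one_le_logb_one_div h₀ h₁, neg_log_le_logb_one_div h₀ h₁]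

theorem exists_good_parameters {α γ ε δ₂ δ₃ : ℝ} (hα : α ∈ Set.Ioo (0 : ℝ) (1 / 2))
    (hγ : γ ∈ Set.Ioo (0 : ℝ) (1 / 2)) (hε : ε ∈ Set.Ioo (0 : ℝ) (1 / 2))
    (hδ₂ : δ₂ ∈ Set.Ioo (0 : ℝ) (1 / 2)) (hδ₃ : δ₃ ∈ Set.Ioo (0 : ℝ) (1 / 2)) (n₀ : ℕ) :
    ∃ W W' n₁ n₂ n₃ : ℕ, Par.Good ⟨α, γ, ε, n₀, W', n₁, n₂, n₃⟩ δ₂ δ₃ W ∧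
      n₀ ≤ n₁ ∧ 1 ≤ n₃ ∧ 1 ≤ W' ∧ W' ≤ W ∧
      (W' : ℝ) ≤ 33 * (Real.logb 2 (1 / α) / (γ ^ 2 * α)) ∧ (W : ℝ) ≤ W' + 129 / ε ^ 2 ∧
      (n₁ + n₂ : ℝ) ≤ 2 * (n₀ / α) + 8198 * (Real.logb 2 (1 / δ₂) / (α ^ 2 * γ ^ 2)) ∧
      (n₃ : ℝ) ≤ 1025 * (Real.logb 2 (1 / δ₃) / ε ^ 2) := by
  obtain ⟨hα₀, hα₁⟩ := hα
  obtain ⟨hγ₀, hγ₁⟩ := hγ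
  obtain ⟨hε₀, hε₁⟩ := hε
  obtain ⟨hδ₂₀, hδ₂₁⟩ := hδ₂
  obtain ⟨hδ₃₀, hδ₃₁⟩ := hδ₃
  have hl := one_le_logb_one_div hα₀ hα₁
  have hl₂ := one_le_logb_one_div hδ₂₀ hδ₂₁
  have hl₃ := one_le_logb_one_div hδ₃₀ hδ₃₁
  have hk₂ := neg_log_half_le hδ₂₀ hδ₂₁
  have hk₃ := neg_log_le_logb_one_div hδ₃₀ hδ₃₁
  set l := Real.logb 2 (1 / α)
  set l₂ := Real.logb 2 (1 / δ₂)
  set l₃ := Real.logb 2 (1 / δ₃)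
  have hγ2 : γ ^ 2 ≤ 1 := pow_le_one₀ hγ₀.le (by linarith)
  have hε2 : ε ^ 2 ≤ 1 := pow_le_one₀ hε₀.le (by linarith)
  have hγα : γ ^ 2 * α ≤ 1 := mul_le_one₀ hγ2 hα₀.le (by linarith)
  have hx : l₂ / α ≤ l₂ / (α ^ 2 * γ ^ 2) := by
    refine div_le_div_of_nonneg_left (by linarith) (by positivity) ?_
    have : α * (γ ^ 2 * α) ≤ α * 1 := mul_le_mul_of_nonneg_left hγα hα₀.le
    linarith
  have hx₁ : 1 ≤ l₂ / α := by
    rw [one_le_div hα₀]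
    linarith
  have hy₁ : 1 ≤ l₃ / ε ^ 2 := by
    rw [one_le_div (by positivity)]
    linarith
  have hz₁ : 1 / (γ ^ 2 * α) ≤ l / (γ ^ 2 * α) := div_le_div_of_nonneg_right hl (by positivity)
  have hz₂ : 1 ≤ 1 / (γ ^ 2 * α) := by rwa [one_le_div (by positivity)]
  have hw : 1 ≤ 1 / ε ^ 2 := by rwa [one_le_div (by positivity)]
  -- An integer strictly above `32 / (γ ^ 2 * α)`, so that `W'` weak steps overspend the potential.
  -- The factor `log (1 / α)` is not needed for this and comes in only through `1 ≤ l`.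
  set W' := ⌊32 / (γ ^ 2 * α)⌋₊ + 1 with hW'
  -- Solves `n₀ - n₁ * α / 2 ≤ -2 * l₂ ≤ log (δ₂ / 2)`; the next two lines likewise solve the
  -- Chernoff conditions with exponents `n₂ * (γ * α) ^ 2 / 4096` and `n₃ * ε ^ 2 / 1024`.
  set n₁ := ⌈2 * (n₀ + 2 * l₂) / α⌉₊ with hn₁
  set n₂ := ⌈8192 * l₂ / (α ^ 2 * γ ^ 2)⌉₊ with hn₂
  set n₃ := ⌈1024 * l₃ / ε ^ 2⌉₊ with hn₃
  have e₁ : 2 * (n₀ + 2 * l₂) ≤ n₁ * α := (div_le_iff₀ hα₀).1 (Nat.le_ceil _)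
  have e₂ : 8192 * l₂ ≤ n₂ * (α ^ 2 * γ ^ 2) :=
    (div_le_iff₀ (by positivity)).1 (Nat.le_ceil _)
  have e₃ : 1024 * l₃ ≤ n₃ * ε ^ 2 := (div_le_iff₀ (by positivity)).1 (Nat.le_ceil _)
  have u₁ : (n₁ : ℝ) < 2 * (n₀ + 2 * l₂) / α + 1 := Nat.ceil_lt_add_one (by positivity)
  have u₂ : (n₂ : ℝ) < 8192 * l₂ / (α ^ 2 * γ ^ 2) + 1 := Nat.ceil_lt_add_one (by positivity)
  have u₃ : (n₃ : ℝ) < 1024 * l₃ / ε ^ 2 + 1 := Nat.ceil_lt_add_one (by positivity)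
  refine ⟨W' + ⌈128 / ε ^ 2⌉₊, W', n₁, n₂, n₃, ⟨hα₀, hγ₀, hγ₁, hα₁, hε₀, hε₁, hδ₂₀, hδ₃₀,
    ?_, ?_, ?_, ?_, ?_⟩, ?_, ?_, ?_, Nat.le_add_right _ _, ?_, ?_, ?_, ?_⟩
  · calc Real.exp n₀ * (1 - α / 2) ^ n₁ ≤ Real.exp n₀ * Real.exp (-(α / 2)) ^ n₁ := by
          gcongr
          · linarith
          · linarith [Real.add_one_le_exp (-(α / 2))]
      _ = Real.exp (n₀ + n₁ * -(α / 2)) := by rw [← Real.exp_nat_mul, Real.exp_add]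
      _ ≤ δ₂ / 2 := by
          rw [← Real.le_log_iff_exp_le (by positivity)]
          linarith
  · rw [← Real.le_log_iff_exp_le (by positivity)]
    change -(n₂ * (γ * α / 8) ^ 2 / 64) ≤ _
    linarith
  · rw [← Real.le_log_iff_exp_le hδ₃₀]
    change -(n₃ * (ε / 4) ^ 2 / 64) ≤ _
    linarith
  · change 1 < (W' : ℝ) * (γ ^ 2 * α / 32)
    have h1 : 32 / (γ ^ 2 * α) < W' := by
      rw [hW', Nat.cast_add, Nat.cast_one]
      exact Nat.lt_floor_add_one _
    rw [div_lt_iff₀ (by positivity)] at h1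
    linarith
  · push_cast
    exact add_le_add_right (Nat.le_ceil _) _
  · have : (n₀ : ℝ) ≤ n₁ := by
      have : (n₁ : ℝ) * α ≤ n₁ := mul_le_of_le_one_right (Nat.cast_nonneg _) (by linarith)
      have : (0 : ℝ) ≤ n₀ := Nat.cast_nonneg _
      linarith
    exact_mod_cast this
  · exact Nat.ceil_pos.2 (by positivity)
  · omega
  · have : (⌊32 / (γ ^ 2 * α)⌋₊ : ℝ) ≤ 32 / (γ ^ 2 * α) := Nat.floor_le (by positivity)
    rw [hW']
    push_cast
    have h32 : 32 / (γ ^ 2 * α) = 32 * (1 / (γ ^ 2 * α)) := by ring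
    linarith
  · have h1 : (⌈128 / ε ^ 2⌉₊ : ℝ) < 128 / ε ^ 2 + 1 := Nat.ceil_lt_add_one (by positivity)
    have h2 : 128 / ε ^ 2 = 128 * (1 / ε ^ 2) := by ring
    have h3 : 129 / ε ^ 2 = 129 * (1 / ε ^ 2) := by ring
    push_cast
    linarith
  · have h1 : 2 * (n₀ + 2 * l₂) / α = 2 * (n₀ / α) + 4 * (l₂ / α) := by ring
    have h2 : 8192 * l₂ / (α ^ 2 * γ ^ 2) = 8192 * (l₂ / (α ^ 2 * γ ^ 2)) := by ring
    linarith
  · have h1 : 1024 * l₃ / ε ^ 2 = 1024 * (l₃ / ε ^ 2) := by ring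
    linarith

end parameters

/-! ### The boosting algorithm as a learner -/

section learner
variable {X D : Type*}

theorem correlation_eq (μ : PMF (X × Label)) {f : X → Sign} {g : X → ℝ}
    (h : ∀ x, (f x : ℝ) = g x) : correlation μ f = expect μ fun z => z.2 * g z.1 := by
  simp only [correlation, h]

theorem prob_not_le_of_le_toReal {A : Type*} {p : PMF A} {s : Set A} {δ : ℝ}
    (h : 1 - δ ≤ (p.toOuterMeasure s).toReal) : prob p (fun a => a ∉ s) ≤ ENNReal.ofReal δ := by
  rw [toOuterMeasure_eq_prob] at h
  have h1 := prob_add_prob_not p fun a => a ∈ s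
  have ht : prob p (fun a => a ∈ s) ≠ ∞ := ((prob_le_one _ _).trans_lt ENNReal.one_lt_top).ne
  have ht' : prob p (fun a => a ∉ s) ≠ ∞ := ((prob_le_one _ _).trans_lt ENNReal.one_lt_top).ne
  refine (ENNReal.le_ofReal_iff_toReal_le ht' ?_).2 ?_
  all_goals
    have h2 := congrArg ENNReal.toReal h1
    rw [ENNReal.toReal_add ht ht', ENNReal.toReal_one] at h2
    have : 0 ≤ (prob p fun a => a ∉ s).toReal := ENNReal.toReal_nonneg
    linarith

theorem le_toReal_of_prob_not_le {A : Type*} {p : PMF A} {s : Set A} {δ : ℝ} (hδ : 0 ≤ δ)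
    (h : prob p (fun a => a ∉ s) ≤ ENNReal.ofReal δ) : 1 - δ ≤ (p.toOuterMeasure s).toReal := by
  rw [toOuterMeasure_eq_prob]
  have h1 := prob_add_prob_not p fun a => a ∈ s
  have ht : prob p (fun a => a ∈ s) ≠ ∞ := ((prob_le_one _ _).trans_lt ENNReal.one_lt_top).ne
  have ht' : prob p (fun a => a ∉ s) ≠ ∞ := ((prob_le_one _ _).trans_lt ENNReal.one_lt_top).ne
  have h2 := congrArg ENNReal.toReal h1
  rw [ENNReal.toReal_add ht ht', ENNReal.toReal_one] at h2
  have h3 := (ENNReal.le_ofReal_iff_toReal_le ht' hδ).1 h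
  linarith

/-- A single `b` reaching `α` already bounds the supremum from below. This is the only case that the
analysis needs, so extended reals can be left behind here. -/
theorem isWeakLearner_of_mem_WDCorM {R : Rep X D} {n₀ : ℕ} {L : Learner (X × Label) n₀ D}
    {S B : Set (Hyp X)} {α γ δ : ℝ} (h : R.models L ∈ WDCorM n₀ S B α γ δ) :
    IsWeakLearner R L S B α γ δ := by
  rintro ν hν ⟨b, hb, hα⟩
  have h1 : (α : EReal) ≤ benchmark B ν := le_trans (EReal.coe_le_coe_iff.2 hα)
    (le_iSup₂ (f := fun b (_ : b ∈ B) =>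
      ((expect ν (fun z => gprod (z.2 : ℝ) (b z.1)) : ℝ) : EReal)) b hb)
  have h2 := prob_not_le_of_le_toReal (h ν ⟨hν, h1⟩)
  have e : (iid ν n₀).bind (R.models L) = ((iid ν n₀).bind L).map R.eval := by
    rw [PMF.map_bind]
    rfl
  rw [e, prob_map] at h2
  refine (prob_mono fun d hd => ?_).trans h2
  rw [Set.mem_ofPred_eq, not_le]
  exact hd

theorem St.Correct.benchmark_sub_le {q : Par} {B : Set (Hyp X)} {μ : PMF (X × Label)} {σ : St X}
    (h : σ.Correct q B μ) {f : X → Sign} (hf : ∀ x, (f x : ℝ) = sg (σ.score x)) :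
    benchmark B μ - ((q.α + q.ε : ℝ) : EReal) ≤ (correlation μ f : EReal) := by
  rw [correlation_eq μ hf]
  refine EReal.sub_le_of_le_add ?_
  rw [← EReal.coe_add]
  exact iSup₂_le fun b hb => EReal.coe_le_coe_iff.2 (h.2 b hb)

theorem continues_extend (z₀ : X × Label) {n : ℕ} (data : Fin n → X × Label) :
    Continues (extend z₀ data) data := fun i h => by
  rw [extend, dif_pos h]

theorem represents_initConfig {R : Rep X D} {q : Par} {T n W : ℕ} (hε : 0 < q.ε) (hT : 1 ≤ T) :
    Represents R q T (fun _ => 0)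
      (initConfig D [q.n₀, n, W, q.W', q.n₁, q.n₂, q.n₃] [q.α, q.γ, q.ε]).mem where
  n₀ := rfl
  W' := rfl
  n₁ := rfl
  n₂ := rfl
  n₃ := rfl
  α := rfl
  γ := rfl
  ε := rfl
  ε_pos := hε
  T_pos := hT
  cnt := Nat.zero_le _
  nonneg j := by
    -- Exhibits the address as lying beyond the three real parameters, where the default `0` is
    -- read.
    rw [show 20 + j = (17 + j) + 3 by ring]
    exact le_rfl
  slots j hj := absurd hj (Nat.not_lt_zero j)
  time _ _ h := nomatch h
  score x := by
    change (osc _)^[⌊(0 : ℝ)⌋₊] 0 = 0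
    rw [Nat.floor_zero]
    rfl

variable {R : Rep X D} {q : Par} {L : Learner (X × Label) q.n₀ D} {T W n : ℕ} {δ₁ δ₂ δ₃ : ℝ}

theorem run_boostCode_coupled (hε : 0 < q.ε) (hT : 1 ≤ T) (hL : R.EvalTimeLE L T)
    (hn : q.n₀ ≤ q.n₁) (hN : W * q.n₃ + q.W' * (q.n₁ + q.n₂) ≤ n) (z₀ : X × Label)
    (data : Fin n → X × Label) :
    Coupled (Prog.boostCode.run R L [q.n₀, n, W, q.W', q.n₁, q.n₂, q.n₃] [q.α, q.γ, q.ε] data)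
      (kiter (step q R L z₀ (extend z₀ data)) W ⟨fun _ => 0, 0, 0, false⟩)
      (StepInv R q T n W) :=
  boostCode_coupled (continues_extend z₀ data)
    (fun z d hd x => by exact_mod_cast hL z d hd x) z₀ hN hn rfl
    (represents_initConfig hε hT) rfl rfl rfl rfl rfl

theorem learner_boostCode_mem_DCorM [Nonempty X] {S B : Set (Hyp X)} (hq : q.Good δ₂ δ₃ W)
    (hδ₁ : 0 < δ₁) (hT : 1 ≤ T) (hL : R.EvalTimeLE L T) (hn : q.n₀ ≤ q.n₁)
    (hN : W * q.n₃ + q.W' * (q.n₁ + q.n₂) = n) (h : IsWeakLearner R L S B q.α q.γ δ₁) :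
    (Det.evalCode.rep R).models (Prog.boostCode.learner R L
        [q.n₀, n, W, q.W', q.n₁, q.n₂, q.n₃] [q.α, q.γ, q.ε] n) ∈
      DCorM n S B (q.α + q.ε) (q.W' * (δ₁ + δ₂) + W * δ₃) := by
  intro μ hμ
  have hδ₂ := hq.δ₂_pos
  have hδ₃ := hq.δ₃_pos
  refine le_toReal_of_prob_not_le (by positivity) ?_
  -- Padding for the infinite sample; any point would do, and it exists because `X` is nonempty.
  set z₀ : X × Label := (Classical.arbitrary X, ⟨0, by norm_num, by norm_num⟩)
  have key := prob_not_correct_le hq hδ₁ z₀ h hμ W ⟨fun _ => 0, 0, 0, false⟩ n (fun _ => z₀) rfl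
    (bdd_const 0) (by simpa using potential_zero_le μ) (by simp) (by simpa using hN)
  have hpos : St.pos q (⟨fun _ => 0, 0, 0, false⟩ : St X) = 0 := by simp [St.pos]
  simp only [hpos, glue_zero] at key
  rw [draws, ev_map] at key
  rw [prob_bind]
  refine (ev_mono fun data => ?_).trans (key.trans (ENNReal.ofReal_le_ofReal ?_))
  · rw [Rep.models, Prog.learner, PMF.map_comp, prob_map]
    -- On coupled outcomes the memory represents the score of the abstract state, so a bad output
    -- forces an incorrect state.
    refine (run_boostCode_coupled hq.ε_pos hT hL hn hN.le z₀ data).prob_le fun c τ hc hbad hτ => ?_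
    exact hbad (hτ.benchmark_sub_le fun x => (evalCode_spec hc.rep x).1)
  · simp
    linarith

theorem run_boostCode_calls_time (hε : 0 < q.ε) (hT : 1 ≤ T) (hL : R.EvalTimeLE L T)
    (hn : q.n₀ ≤ q.n₁) (hn₃ : 1 ≤ q.n₃) (hW' : 1 ≤ q.W') (hWW : q.W' ≤ W)
    (hN : W * q.n₃ + q.W' * (q.n₁ + q.n₂) = n) {data : Fin n → X × Label} {c : Config D}
    (hc : c ∈ (Prog.boostCode.run R L [q.n₀, n, W, q.W', q.n₁, q.n₂, q.n₃]
      [q.α, q.γ, q.ε] data).support) :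
    c.calls ≤ q.W' ∧ c.time ≤ 2020 * (q.W' * T * n) := by
  -- Each of the `W` steps has its own batch of `n₃ ≥ 1` points reserved, so idle iterations are
  -- covered by `n`; also `n` is positive, so a data point can serve as padding.
  have hWn : W ≤ n := (Nat.le_mul_of_pos_right W hn₃).trans (by omega)
  obtain ⟨σ, hσ⟩ :=
    (run_boostCode_coupled hε hT hL hn hN.le (data ⟨0, by omega⟩) data).exists_of_mem_support hc
  refine ⟨hσ.calls, hσ.time.trans ?_⟩
  have h1 : (q.W' + 1) * T ≤ 2 * (q.W' * T) := by
    rw [← Nat.mul_assoc]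
    exact Nat.mul_le_mul_right T (by omega)
  have h2 : c.mem.nat 7 + W ≤ 2 * n := by
    have := hσ.pos
    omega
  have h3 : 1 ≤ q.W' * T * n := Nat.mul_pos (Nat.mul_pos hW' hT) (by omega)
  calc 20 + 500 * ((q.W' + 1) * T) * (c.mem.nat 7 + W)
      ≤ 20 * (q.W' * T * n) + 500 * (2 * (q.W' * T)) * (2 * n) := by gcongr; omega
    _ = 2020 * (q.W' * T * n) := by ring

theorem learner_boostCode_evalTime (hε : 0 < q.ε) (hT : 1 ≤ T)
    (hL : R.EvalTimeLE L T) (hn : q.n₀ ≤ q.n₁) (hW' : 1 ≤ q.W')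
    (hN : W * q.n₃ + q.W' * (q.n₁ + q.n₂) ≤ n) {data : Fin n → X × Label} {m : Mem D}
    (hm : m ∈ (Prog.boostCode.learner R L [q.n₀, n, W, q.W', q.n₁, q.n₂, q.n₃]
      [q.α, q.γ, q.ε] n data).support) (x : X) :
    (Det.evalCode.rep R).time m x ≤ 400 * (q.W' * T) := by
  rw [Prog.learner, PMF.support_map] at hm
  obtain ⟨c, hc, rfl⟩ := hm
  -- The point to be evaluated, with label `0`, serves as padding.
  obtain ⟨σ, hσ⟩ := (run_boostCode_coupled hε hT hL hn hN
    (x, ⟨0, by norm_num, by norm_num⟩) data).exists_of_mem_support hc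
  refine (evalCode_spec hσ.rep x).2.trans ?_
  have h1 : (q.W' + 1) * T ≤ 2 * q.W' * T := Nat.mul_le_mul_right T (by omega)
  rw [Nat.mul_assoc 2] at h1
  omega

end learner

end
end CompLearn

theorem mainTheorem8 :
    ∃ (C : ℝ) (P : CompLearn.Prog) (E : CompLearn.Det), 0 < C ∧
      ∀ α ∈ Set.Ioo (0 : ℝ) (1 / 2), ∀ γ ∈ Set.Ioo (0 : ℝ) (1 / 2),
      ∀ ε ∈ Set.Ioo (0 : ℝ) (1 / 2), ∀ δ₁ ∈ Set.Ioo (0 : ℝ) (1 / 2),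
      ∀ δ₂ ∈ Set.Ioo (0 : ℝ) (1 / 2), ∀ δ₃ ∈ Set.Ioo (0 : ℝ) (1 / 2), ∀ n₀ : ℕ,
      ∃ W W' n n₁ n₂ n₃ : ℕ,
        (W' : ℝ) ≤ C * (Real.logb 2 (1 / α) / (γ ^ 2 * α)) ∧
        W' ≤ W ∧ (W : ℝ) ≤ W' + C / ε ^ 2 ∧
        (n : ℝ) ≤ C * (W' * (n₀ / α + Real.logb 2 (1 / δ₂) / (α ^ 2 * γ ^ 2))
          + W * (Real.logb 2 (1 / δ₃) / ε ^ 2)) ∧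
        ∀ (X : Type*) [Nonempty X] (D : Type*) (R : CompLearn.Rep X D)
          (S B : Set (CompLearn.Hyp X)) (L : CompLearn.Learner (X × CompLearn.Label) n₀ D)
          (T : ℕ), 1 ≤ T → R.EvalTimeLE L T → R.models L ∈ CompLearn.WDCorM n₀ S B α γ δ₁ →
          let ints : List ℕ := [n₀, n, W, W', n₁, n₂, n₃]
          let reals : List ℝ := [α, γ, ε]
          let L' := P.learner R L ints reals n
          (E.rep R).models L' ∈
              CompLearn.DCorM n S B (α + ε) (W' * (δ₁ + δ₂) + W * δ₃) ∧
            (∀ data : Fin n → X × CompLearn.Label,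
              ∀ c ∈ (P.run R L ints reals data).support,
                c.calls ≤ W' ∧ (c.time : ℝ) ≤ C * (W' * T * n)) ∧
            (E.rep R).EvalTimeLE L' (C * (W' * T)) := by
  -- Exceeds every constant that occurs: `33`, `129`, `8198`, `1025` for the parameters, `2020` for
  -- the running time, `400` for evaluation.
  refine ⟨20000, CompLearn.Prog.boostCode, CompLearn.Det.evalCode, by norm_num, ?_⟩
  intro α hα γ hγ ε hε δ₁ hδ₁ δ₂ hδ₂ δ₃ hδ₃ n₀
  obtain ⟨W, W', n₁, n₂, n₃, hq, hn, hn₃, hW', hWW, b₁, b₂, b₃, b₄⟩ :=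
    CompLearn.exists_good_parameters hα hγ hε hδ₂ hδ₃ n₀
  have hl := CompLearn.one_le_logb_one_div hα.1 hα.2
  have hl₂ := CompLearn.one_le_logb_one_div hδ₂.1 hδ₂.2
  have hl₃ := CompLearn.one_le_logb_one_div hδ₃.1 hδ₃.2
  have hα₀ := hα.1
  have hγ₀ := hγ.1
  have hε₀ := hε.1
  -- One edge batch per step, and one batch each of trials and of test points per weak call.
  refine ⟨W, W', W * n₃ + W' * (n₁ + n₂), n₁, n₂, n₃, ?_, hWW, ?_, ?_, ?_⟩
  · refine b₁.trans (mul_le_mul_of_nonneg_right (by norm_num) (by positivity))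
  · refine b₂.trans (add_le_add_right ?_ _)
    exact div_le_div_of_nonneg_right (by norm_num) (by positivity)
  · push_cast
    have h1 : (W : ℝ) * n₃ ≤ W * (20000 * (Real.logb 2 (1 / δ₃) / ε ^ 2)) := by
      refine mul_le_mul_of_nonneg_left (b₄.trans ?_) (Nat.cast_nonneg _)
      exact mul_le_mul_of_nonneg_right (by norm_num) (by positivity)
    have h2 : (W' : ℝ) * (n₁ + n₂) ≤
        W' * (20000 * (n₀ / α + Real.logb 2 (1 / δ₂) / (α ^ 2 * γ ^ 2))) := by
      refine mul_le_mul_of_nonneg_left (b₃.trans ?_) (Nat.cast_nonneg _)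
      rw [mul_add]
      gcongr <;> norm_num
    linarith
  · intro X _ D R S B L T hT hL hweak
    refine ⟨?_, ?_, ?_⟩
    · exact CompLearn.learner_boostCode_mem_DCorM hq hδ₁.1 hT hL hn rfl
        (CompLearn.isWeakLearner_of_mem_WDCorM hweak)
    · intro data c hc
      obtain ⟨h1, h2⟩ := CompLearn.run_boostCode_calls_time (q := ⟨α, γ, ε, n₀, W', n₁, n₂, n₃⟩)
        hε₀ hT hL hn hn₃ hW' hWW rfl hc
      refine ⟨h1, ?_⟩
      have h3 : (c.time : ℝ) ≤ 2020 * (W' * T * ((W * n₃ + W' * (n₁ + n₂) : ℕ) : ℝ)) := by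
        exact_mod_cast h2
      refine h3.trans (mul_le_mul_of_nonneg_right (by norm_num) (by positivity))
    · intro data m hm x
      have h1 := CompLearn.learner_boostCode_evalTime (q := ⟨α, γ, ε, n₀, W', n₁, n₂, n₃⟩)
        hε₀ hT hL hn hW' le_rfl hm x
      have h2 : (((CompLearn.Det.evalCode.rep R).time m x : ℕ) : ℝ) ≤ 400 * (W' * T) := by
        exact_mod_cast h1
      refine h2.trans (mul_le_mul_of_nonneg_right (by norm_num) (by positivity))
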